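/- **Setting.** Let $X$ be a finite domain. A database is a finite multiset $D$ over $X$; $D,D'$ are neighbours if they differ in exactly one tuple, $|(D\setminus D')\cup(D'\setminus D)|=1$. A row counting query (RCQ) is a subset $q\subseteq X$ with true answer $q(D)=\#\{t\in D: t\in q\}$; workloads and strategies are finite sets of RCQs, viewed as 0/1 matrices whose rows are the queries; $\|\cdot\|_1$ is the maximal column sum. The global strategy is the set of nodes of a $k$-ary tree $\mathcal T$ with root query $X$: leaves are single domain values, and every internal node has between $2$ and $k$ children whose queries partition its own. A cache stores for every node its latest noise parameter $b$, noisy response $\tilde y$ and time stamp $t$ ($t=0$: no valid entry); it is initially empty. **The system.** The inputs are $D$ and a total budget $\epsilon_{\mathrm{total}}\ge 0$; the consumed budget starts at $0$. In each round the (adaptive) analyst, knowing all earlier responses, stops or submits a workload $W$ with accuracy parameters $\alpha>0$, $0<\beta<1$. The system then does the following. 1. *Strategy.* Each $w\in W$ is decomposed top-down into tree nodes; $A$ is the set of all nodes obtained. The rows of $A$ induce a partition of the values they cover into nonempty buckets; the mapped matrices of $A$ and $W$ over the buckets have entry $1$ iff the bucket is contained in the query, and $A^+$ is the Moore–Penrose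 pseudoinverse of the mapped $A$. Norms in item 2 are of matrices mapped over the buckets of the strategy at hand; norms in items 3 and 5 are over $X$. 2. *Cost of MMM.* For a noise parameter $b$, the set $F$ of free rows consists of the cached rows of $A$ with cached parameter $\le b$, and the set of paid rows is $P=A\setminus F$. A candidate $b$ is tested by a Monte Carlo simulation with $10000$ samples $\eta$ of independent Laplace noise (cached parameters on free rows, $b$ on paid rows): with $\beta_e$ the fraction of samples with $\|WA^+\eta\|_\infty>\alpha$ and $p=\beta/100$, accept iff $\beta_e+z_{1-p/2}\sqrt{\beta_e(1-\beta_e)/10000}+p/2<\beta$, where $z_q$ is the standard normal $q$-quantile. A binary search with this test over $b_L=\alpha\sqrt{\beta/2}/\|WA^+\|_F$ and the cached parameters of rows of $A$ exceeding $b_L$, followed by a bisection (a fixed number of steps) up to the next larger cached parameter or, if there is none, up to $\|A\|_1/\epsilon_{\min}$, gives $b_P$ (if $WA^+=0$, take $b_L=\|A\|_1/\epsilon_{\min}$). Here $\epsilon_{\min}>0$ is the budget precision. The cost is $\|P\|_1/b_P$. 3. *Cost of Relax Privacy (RP).* The target $b$ is the result of item 2 with an empty cache. Among the nonempty sets $A_j$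 of cached queries with common time stamp $j$ (and noise parameter $b_j$) such that $A\subseteq A_j$ and $0<b\le b_j$, choose the one with least cost $\|A_j\|_1/b-\|A_j\|_1/b_j$; if there is none, RP is not available. 4. *Cost of MMM with the optional strategy expander (SE).* Going through the other cached queries in ascending order of noise parameter, those that intersect a row of $A$ are added to $A$, until a fixed maximal number has been added or the noise parameter exceeds $b_P$; item 2 is applied to the expanded strategy. 5. *Answer.* The option with the smallest cost $\epsilon_i$ is chosen. If $\epsilon_i$ plus the consumed budget is $\ge\epsilon_{\mathrm{total}}$, the workload is rejected. Otherwise MMM answers the paid rows $P$ (with the optional proactive querying (PQ) module: also uncached tree nodes selected by a top-down traversal that adds an unmarked node $v$ only if the number of nodes that may still be added on its path, initially $\|P\|_1$ and decreased at every paid or added node, exceeds the maximal number of paid nodes on a path below $v$) with fresh independent $\mathrm{Lap}(b_P)$ noise. RP replaces the noise $\eta_o=\tilde y-q(D)$ of each $q\in A_j$, independently, by noise drawn from the law of $Y$ given $Y+Z=\eta_o$, where $Y\sim\mathrm{Lap}(b)$ and $Z$ are independent, $Z=0$ with probability $b^2/b_j^2$ and $Z\sim\mathrm{Lap}(b_j)$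 otherwise. New responses are stored in the cache, the analyst receives $WA^+\tilde y$ (with $A$ the chosen strategy and $\tilde y$ its cached responses) and $\epsilon_i$, and $\epsilon_i$ is added to the consumed budget. **Theorem.** For every such tree, all values of the tuning parameters, every adaptive (measurable) analyst and every number of rounds, the system, as the randomized map from $D$ to the sequence of all responses returned to the analyst, is well defined (its output law is a probability measure) and satisfies $\epsilon_{\mathrm{total}}$-differential privacy: for all neighbouring $D,D'$ and every measurable set $O$ of response sequences, $$\Pr[M(D)\in O]\le e^{\epsilon_{\mathrm{total}}}\Pr[M(D')\in O].$$ -/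

import Mathlib

open MeasureTheory

namespace CacheDP

universe u

/-! ## Databases, neighbours, differential privacy -/

/-- Databases over the full domain `X` are multisets; two databases are neighbours when they
differ in exactly one tuple (one is obtained from the other by adding a tuple). -/
def Neighbor {X : Type u} [DecidableEq X] (D D' : Multiset X) : Prop :=
  Multiset.card ((D - D') ∪ (D' - D)) = 1

/-- A randomized mechanism, given by its output law on each database, is `ε`-differentially
private. -/
def IsDP {X : Type u} [DecidableEq X] {O : Type*} [MeasurableSpace O]
    (M : Multiset X → Measure O) (ε : ℝ) : Prop :=
  ∀ D D' : Multiset X, Neighbor D D' → ∀ S : Set O, MeasurableSet S →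
    M D S ≤ ENNReal.ofReal (Real.exp ε) * M D' S

/-- A row counting query, identified with the set of domain values satisfying its predicate.
Workloads and strategies are finite sets of such queries (the rows of the matrix). -/
abbrev Query (X : Type u) : Type u := Finset X

/-- The true answer of a row counting query: the number of tuples of `D` lying in `q`. -/
noncomputable def trueCount {X : Type u} [DecidableEq X] (D : Multiset X) (q : Query X) : ℝ :=
  ∑ x ∈ q, (D.count x : ℝ)

/-! ## The global strategy: a hierarchical (`k`-ary tree) decomposition of the domain -/

/-- Trees whose leaves are domain values. -/
inductive StrategyTree (X : Type u) : Type u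
  | leaf (x : X) : StrategyTree X
  | node {m : ℕ} (child : Fin m → StrategyTree X) : StrategyTree X

namespace StrategyTree

variable {X : Type u} [DecidableEq X]

/-- The counting query of the root of a tree: all domain values below it. -/
def query : StrategyTree X → Query X
  | leaf x => {x}
  | node child => Finset.univ.biUnion fun i => (child i).query

/-- Every internal node has between `2` and `k` children, with pairwise disjoint queries. -/
def IsHierarchical (k : ℕ) : StrategyTree X → Prop
  | leaf _ => True
  | node (m := m) child => 2 ≤ m ∧ m ≤ k ∧
      (∀ i j, i ≠ j → Disjoint (child i).query (child j).query) ∧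
      ∀ i, (child i).IsHierarchical k

/-- `decomposeWorkload`: top-down decomposition of the query `w` into tree nodes. -/
def decompose : StrategyTree X → Query X → Finset (Query X)
  | leaf x, w => if ({x} : Query X) = w then {{x}} else ∅
  | node child, w =>
      if (Finset.univ.biUnion fun i => (child i).query) = w then {w}
      else Finset.univ.biUnion fun i =>
        if w ∩ (child i).query = ∅ then ∅ else (child i).decompose (w ∩ (child i).query)

/-- Subtree norm with respect to the marked queries `P`: the maximal number of marked nodes
on a path from the root to a leaf. -/
def subtreeNorm (P : Finset (Query X)) : StrategyTree X → ℕ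
  | leaf x => if ({x} : Query X) ∈ P then 1 else 0
  | node child =>
      (if (Finset.univ.biUnion fun i => (child i).query) ∈ P then 1 else 0) +
        Finset.univ.sup fun i => (child i).subtreeNorm P

/-- `searchProactiveNodes`: `C` are the cached queries, `P` the paid ones, and `r` is the number
of nodes that may still be fetched on a path below the current node. -/
def searchProactive (C P : Finset (Query X)) : StrategyTree X → ℕ → Finset (Query X)
  | leaf x, r =>
      if ({x} : Query X) ∈ P then ∅
      else if ({x} : Query X) ∉ C ∧ (leaf x).subtreeNorm P < r then {{x}} else ∅
  | node child, r =>
      let q : Query X := Finset.univ.biUnion fun i => (child i).query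
      if q ∈ P then
        if 0 < r - 1 then
          Finset.univ.biUnion fun i => (child i).searchProactive C P (r - 1)
        else ∅
      else if q ∉ C ∧ (node child).subtreeNorm P < r then
        insert q (if 0 < r - 1 then
          Finset.univ.biUnion fun i => (child i).searchProactive C P (r - 1)
        else ∅)
      else if 0 < r then
        Finset.univ.biUnion fun i => (child i).searchProactive C P r
      else ∅

/-- Strategy generator: the instant strategy of a workload. -/
def instantStrategy (T : StrategyTree X) (W : Finset (Query X)) : Finset (Query X) :=
  W.biUnion T.decompose

end StrategyTree

section Strategy

variable {X : Type u} [Fintype X] [DecidableEq X]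

/-- `L₁` norm (maximal column sum) of the 0/1 matrix over the full domain with row set `A`. -/
def rawNorm (A : Finset (Query X)) : ℕ :=
  Finset.univ.sup fun x : X => (A.filter fun a => x ∈ a).card

/-! ## Full-rank transformation -/

/-- One step of `getTransformationMatrix`: refine the current buckets by the strategy row `a`
(empty buckets are dropped). -/
def refineBuckets (B : Finset (Query X)) (a : Query X) : Finset (Query X) :=
  if a ∈ B then B
  else ((B.filter fun t => Disjoint t a) ∪
      ((B.filter fun t => ¬ Disjoint t a).image fun t => t ∩ a) ∪
      ((B.filter fun t => ¬ Disjoint t a).image fun t => t \ a) ∪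
      {a \ B.sup id}).erase ∅

/-- The buckets (rows of the transformation matrix) generated by the strategy `A`. -/
noncomputable def buckets (A : Finset (Query X)) : Finset (Query X) :=
  A.toList.foldl refineBuckets ∅

/-- The mapped 0/1 matrix of the query set `A` over the buckets `B`: entry `1` iff the bucket is
contained in the query. Rows outside `A` and columns outside `B` are zero padding (so that all
matrices share one index type); padding by zeros changes neither products, norms nor the
pseudoinverse apart from the corresponding padding. -/
noncomputable def mappedMatrix (A B : Finset (Query X)) : Matrix (Query X) (Query X) ℝ :=
  Matrix.of fun a t => if a ∈ A ∧ t ∈ B ∧ t ⊆ a then 1 else 0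

/-- `L₁` norm (maximal column sum) of `mappedMatrix A B`. -/
def mappedNorm (A B : Finset (Query X)) : ℕ :=
  B.sup fun t => (A.filter fun a => t ⊆ a).card

/-- The Penrose equations: `N` is the Moore-Penrose pseudoinverse of the real matrix `M`. -/
structure IsPseudoinverse {m n : Type*} [Fintype m] [Fintype n]
    (M : Matrix m n ℝ) (N : Matrix n m ℝ) : Prop where
  mul_mul_left : M * N * M = M
  mul_mul_right : N * M * N = N
  symm_left : (M * N).transpose = M * N
  symm_right : (N * M).transpose = N * M

/-- The Moore-Penrose pseudoinverse. -/
noncomputable def pinv {m n : Type*} [Fintype m] [Fintype n] (M : Matrix m n ℝ) :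
    Matrix n m ℝ :=
  Classical.epsilon (IsPseudoinverse M)

/-- The matrix `W A⁺` of the matrix mechanism, over the buckets of `A`. -/
noncomputable def answerMatrix (W A : Finset (Query X)) : Matrix (Query X) (Query X) ℝ :=
  mappedMatrix W (buckets A) * pinv (mappedMatrix A (buckets A))

noncomputable def frobeniusNorm (M : Matrix (Query X) (Query X) ℝ) : ℝ :=
  Real.sqrt (∑ i, ∑ j, M i j ^ 2)

end Strategy

/-! ## Laplace noise -/

/-- The Laplace distribution with scale `b > 0`. -/
noncomputable def laplace (b : ℝ) : Measure ℝ :=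
  volume.withDensity fun x => ENNReal.ofReal (1 / (2 * b) * Real.exp (-|x| / b))

/-- `lapNoiseDown`: the law of the refined noise at scale `b` given the old noise `η` at scale
`b₀`, for `0 < b ≤ b₀`. It is the conditional law of `Y` given `Y + Z = η`, for independent
`Y` of law `Lap(b)` and `Z` which is `0` with probability `b² / b₀²` and of law `Lap(b₀)`
otherwise (so that `Y + Z` has law `Lap(b₀)`). -/
noncomputable def lapNoiseDown (b₀ b η : ℝ) : Measure ℝ :=
  ENNReal.ofReal (b / b₀ * Real.exp (-(1 / b - 1 / b₀) * |η|)) • Measure.dirac η +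
  volume.withDensity fun y => ENNReal.ofReal
    ((1 - b ^ 2 / b₀ ^ 2) * (1 / (2 * b)) *
      Real.exp (-|y| / b - |η - y| / b₀ + |η| / b₀))

/-! ## The cache -/

section Cache

variable {X : Type u} [Fintype X] [DecidableEq X]

/-- The cache: latest noise parameter, noisy response and time stamp of every query. Time stamp
`0` means that there is no valid entry. (Only nodes of the global strategy ever get an entry.) -/
abbrev Cache (X : Type u) : Type u := Query X → ℝ × ℝ × ℕ

def cacheScale (c : Cache X) (a : Query X) : ℝ := (c a).1
def cacheResponse (c : Cache X) (a : Query X) : ℝ := (c a).2.1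
def cacheTime (c : Cache X) (a : Query X) : ℕ := (c a).2.2

/-- The cache without valid entries. -/
def emptyCache : Cache X := fun _ => (0, 0, 0)

/-- The queries with a valid cache entry. -/
def cached (c : Cache X) : Finset (Query X) := Finset.univ.filter fun a => 0 < cacheTime c a

open Classical in
/-- The queries of `S` in ascending order of their cached noise parameter. -/
noncomputable def sortByScale (c : Cache X) (S : Finset (Query X)) : List (Query X) :=
  S.toList.mergeSort fun a a' => decide (cacheScale c a ≤ cacheScale c a')

open Classical in
/-- Free strategy for the noise parameter `b`: cached rows that are at least as accurate. -/
noncomputable def freeStrategy (c : Cache X) (A : Finset (Query X)) (b : ℝ) :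
    Finset (Query X) :=
  A.filter fun a => a ∈ cached c ∧ cacheScale c a ≤ b

noncomputable def paidStrategy (c : Cache X) (A : Finset (Query X)) (b : ℝ) :
    Finset (Query X) :=
  A \ freeStrategy c A b

/-! ## System parameters and accuracy check -/

/-- Data-independent tuning parameters of the system. -/
structure Config where
  /-- the smallest possible privacy budget -/
  budgetPrecision : ℝ
  budgetPrecision_pos : 0 < budgetPrecision
  /-- number of bisection steps in the continuous search -/
  searchSteps : ℕ
  /-- maximal number of rows added by the strategy expander -/
  expandLimit : ℕ
  /-- whether the proactive querying module is on -/
  usePQ : Bool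
  /-- whether the strategy expander module is on -/
  useSE : Bool

/-- Sample size of the Monte Carlo simulation. -/
def mcSamples : ℕ := 10000

/-- The `q`-quantile of the standard normal distribution. -/
noncomputable def normalQuantile (q : ℝ) : ℝ :=
  sInf {z : ℝ | q ≤ ProbabilityTheory.cdf (ProbabilityTheory.gaussianReal 0 1) z}

open Classical in
/-- Independent noise on the rows of `A` with row-wise scales; no noise on other rows. -/
noncomputable def laplaceVector (A : Finset (Query X)) (scale : Query X → ℝ) :
    Measure (Query X → ℝ) :=
  Measure.pi fun a => if a ∈ A then laplace (scale a) else Measure.dirac 0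

open Classical in
/-- Acceptance test of the Monte Carlo simulation, for given noise samples `η`. -/
noncomputable def mcAccept (W A : Finset (Query X)) (α β : ℝ)
    (η : Fin mcSamples → Query X → ℝ) : Bool :=
  -- the norm on `Query X → ℝ` is the maximum norm
  let failures : ℕ :=
    (Finset.univ.filter fun i => α < ‖(answerMatrix W A).mulVec (η i)‖).card
  let βe : ℝ := failures / mcSamples
  let p : ℝ := β / 100
  let δβ : ℝ := normalQuantile (1 - p / 2) * Real.sqrt (βe * (1 - βe) / mcSamples)
  decide (βe + δβ + p / 2 < β)

open Classical in
/-- `checkAccuracy`: Monte Carlo simulation of the error of answering `W` through `A` when the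
paid rows have noise parameter `b` and the free rows keep their cached noise parameters. -/
noncomputable def checkAccuracy (c : Cache X) (W A : Finset (Query X)) (α β b : ℝ) :
    Measure Bool :=
  (Measure.pi fun _ : Fin mcSamples =>
    laplaceVector A fun a => if a ∈ freeStrategy c A b then cacheScale c a else b).map
      (mcAccept W A α β)

/-! ## Cost estimation -/

/-- Binary search in the sorted list `L` for the last entry passing the (random) test, between
the positions `lo` and `hi`; the position `lo` is the fallback. The first argument bounds the
number of steps. -/
noncomputable def listSearch (check : ℝ → Measure Bool) (L : List ℝ) :
    ℕ → ℕ → ℕ → Measure ℝ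
  | 0, lo, _ => Measure.dirac (L.getD lo 0)
  | n + 1, lo, hi =>
      if lo < hi then
        (check (L.getD ((lo + hi + 1) / 2) 0)).bind fun ok =>
          if ok then listSearch check L n ((lo + hi + 1) / 2) hi
          else listSearch check L n lo ((lo + hi + 1) / 2 - 1)
      else Measure.dirac (L.getD lo 0)

/-- Bisection in the interval `[lo, hi]` for the largest value passing the (random) test. -/
noncomputable def bisect (check : ℝ → Measure Bool) : ℕ → ℝ → ℝ → Measure ℝ
  | 0, lo, _ => Measure.dirac lo
  | n + 1, lo, hi =>
      (check ((lo + hi) / 2)).bind fun ok =>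
        if ok then bisect check n ((lo + hi) / 2) hi else bisect check n lo ((lo + hi) / 2)

/-- The upper bound on the noise parameter. -/
noncomputable def topNoise (cfg : Config) (A : Finset (Query X)) : ℝ :=
  mappedNorm A (buckets A) / cfg.budgetPrecision

open Classical in
/-- The loose bound on the noise parameter. If `W A⁺ = 0` then every noise parameter is accurate
and the bound is the upper bound. -/
noncomputable def looseNoise (cfg : Config) (W A : Finset (Query X)) (α β : ℝ) : ℝ :=
  if frobeniusNorm (answerMatrix W A) = 0 then topNoise cfg A
  else α * Real.sqrt (β / 2) / frobeniusNorm (answerMatrix W A)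

open Classical in
/-- `MMM.estimatePrivacyBudget`: the law of the noise parameter for the paid strategy. A discrete
search among the loose bound and the larger cached noise parameters is followed by a continuous
search up to the next larger cached noise parameter (or the upper bound, if there is none). -/
noncomputable def estimateNoise (cfg : Config) (c : Cache X) (W A : Finset (Query X))
    (α β : ℝ) : Measure ℝ :=
  let bL := looseNoise cfg W A α β
  let bs : List ℝ :=
    (sortByScale c (A.filter fun a => a ∈ cached c ∧ bL < cacheScale c a)).map (cacheScale c)
  let check := checkAccuracy c W A α β
  (listSearch check (bL :: bs) bs.length 0 bs.length).bind fun bD =>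
    bisect check cfg.searchSteps bD
      (max bD ((bs.find? fun b => decide (bD < b)).getD (topNoise cfg A)))

/-- The privacy cost reported by MMM for strategy `A` and paid noise parameter `b`. -/
noncomputable def mmmCost (c : Cache X) (A : Finset (Query X)) (b : ℝ) : ℝ :=
  mappedNorm (paidStrategy c A b) (buckets A) / b

open Classical in
/-- The loop of the strategy expander over the remaining cache entries. -/
noncomputable def expandLoop (limit : ℕ) (c : Cache X) (A : Finset (Query X)) (b : ℝ) :
    List (Query X) → Finset (Query X) → Finset (Query X)
  | [], E => E
  | a :: l, E =>
      if A.card + limit ≤ E.card ∨ b < cacheScale c a then E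
      else if ∃ a' ∈ A, ¬ Disjoint a' a then expandLoop limit c A b l (insert a E)
      else expandLoop limit c A b l E

/-- `SE.generateExpandedStrategy`. -/
noncomputable def expandStrategy (cfg : Config) (c : Cache X) (A : Finset (Query X)) (b : ℝ) :
    Finset (Query X) :=
  expandLoop cfg.expandLimit c A b (sortByScale c (cached c \ A)) A

/-- The cached strategy with time stamp `j`. -/
def timeGroup (c : Cache X) (j : ℕ) : Finset (Query X) :=
  (cached c).filter fun a => cacheTime c a = j

open Classical in
/-- The noise parameter of the cached strategy with time stamp `j` (common to all its rows). -/
noncomputable def groupScale (c : Cache X) (j : ℕ) : ℝ :=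
  if h : (timeGroup c j).Nonempty then (timeGroup c j).inf' h (cacheScale c) else 0

/-- The cost of relaxing the cached strategy with time stamp `j` to the noise parameter `b`. -/
noncomputable def rpCost (c : Cache X) (j : ℕ) (b : ℝ) : ℝ :=
  rawNorm (timeGroup c j) / b - rawNorm (timeGroup c j) / groupScale c j

open Classical in
/-- `RP.estimatePrivacyBudget`, for the target noise parameter `b`: among the cached strategies
that contain `A` and whose noise can be reduced to `b` (noise is only ever refined, that is
`0 < b ≤ b_j`), the time stamp of the cheapest one, if there is any. -/
noncomputable def rpChoice (c : Cache X) (now : ℕ) (A : Finset (Query X)) (b : ℝ) : Option ℕ :=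
  ((List.range now).filter fun j => decide
    ((timeGroup c j).Nonempty ∧ A ⊆ timeGroup c j ∧ 0 < b ∧ b ≤ groupScale c j)).argmin
      fun j => rpCost c j b

/-- A mechanism with its parameters. -/
inductive Plan (X : Type u) : Type u
  /-- MMM with strategy `A` and noise parameter `b` for the paid rows -/
  | mmm (A : Finset (Query X)) (b : ℝ) : Plan X
  /-- RP: relax the cached strategy with time stamp `j` to `b`, answering through `A` -/
  | rp (A : Finset (Query X)) (j : ℕ) (b : ℝ) : Plan X

noncomputable def Plan.cost (c : Cache X) : Plan X → ℝ
  | mmm A b => mmmCost c A b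
  | rp _ j b => rpCost c j b

/-- The cheapest among MMM, RP and MMM with the expanded strategy, for the noise parameters
`b₁`, `b₂`, `b₃` found by the three cost estimations. -/
noncomputable def choosePlan (cfg : Config) (c : Cache X) (now : ℕ)
    (A Ae : Finset (Query X)) (b₁ b₂ b₃ : ℝ) : Plan X :=
  let plans : List (Plan X) :=
    [.mmm A b₁] ++ ((rpChoice c now A b₂).toList.map fun j => .rp A j b₂) ++
      (if cfg.useSE then [.mmm Ae b₃] else [])
  (plans.argmin (Plan.cost c)).getD (.mmm A b₁)

/-! ## Answering workloads -/

open Classical in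
/-- The fresh cache contents after storing the responses `y` for the queries `P`. -/
noncomputable def updateCache (c : Cache X) (P : Finset (Query X)) (b : ℝ) (y : Query X → ℝ)
    (now : ℕ) : Cache X :=
  fun a => if a ∈ P then (b, y a, now) else c a

open Classical in
/-- The workload answer `W A⁺ y`, with the strategy responses `y` taken from the cache. -/
noncomputable def workloadAnswer (c : Cache X) (W A : Finset (Query X)) : Query X → ℝ :=
  (answerMatrix W A).mulVec fun a => if a ∈ A then cacheResponse c a else 0

/-- The queries perturbed by MMM: the paid strategy, extended by proactive querying if on. -/
noncomputable def perturbedStrategy (T : StrategyTree X) (cfg : Config) (c : Cache X)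
    (A : Finset (Query X)) (b : ℝ) : Finset (Query X) :=
  let P := paidStrategy c A b
  if cfg.usePQ then P ∪ T.searchProactive (cached c) P (rawNorm P) else P

open Classical in
/-- `answerWorkload` on the database `D`: the law of the updated cache. For MMM, the perturbed
rows get fresh Laplace noise; for RP, the noise of every row of the relaxed strategy is
refined. -/
noncomputable def runPlan (T : StrategyTree X) (cfg : Config) (D : Multiset X) (c : Cache X)
    (now : ℕ) : Plan X → Measure (Cache X)
  | .mmm A b =>
      let P := perturbedStrategy T cfg c A b
      (laplaceVector P fun _ => b).map fun η =>
        updateCache c P b (fun a => trueCount D a + η a) now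
  | .rp _ j b =>
      let A₀ := timeGroup c j
      (Measure.pi fun a => if a ∈ A₀ then
          lapNoiseDown (groupScale c j) b (cacheResponse c a - trueCount D a)
        else Measure.dirac 0).map fun η =>
        updateCache c A₀ b (fun a => trueCount D a + η a) now

/-- The strategy through which the workload is answered. -/
def Plan.strategy : Plan X → Finset (Query X)
  | mmm A _ => A
  | rp A _ _ => A

end Cache

/-! ## The interactive system -/

/-- What happened in a round: no workload was submitted, it was rejected, or answered. -/
inductive Status
  | idle
  | rejected
  | answered

instance : MeasurableSpace Status := ⊤

/-- What the analyst sees in one round: the status, the noisy workload answer (indexed by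
queries, zero outside the workload) and the privacy cost. -/
abbrev Response (X : Type u) : Type u := Status × (Query X → ℝ) × ℝ

/-- The responses of all rounds (rounds that have not taken place are idle). -/
abbrev Transcript (X : Type u) : Type u := ℕ → Response X

/-- A workload with accuracy requirement `(α, β)`. -/
structure Request (X : Type u) where
  workload : Finset (Query X)
  α : ℝ
  β : ℝ

/-- An adaptive analyst: chooses the next request, or stops (`none`), in view of all responses
received so far. -/
structure Analyst (X : Type u) where
  workload : Transcript X → Option (Finset (Query X))
  measurable_workload : ∀ W, MeasurableSet {h | workload h = W}
  α : Transcript X → ℝ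
  measurable_α : Measurable α
  α_pos : ∀ h, 0 < α h
  β : Transcript X → ℝ
  measurable_β : Measurable β
  β_pos : ∀ h, 0 < β h
  β_lt_one : ∀ h, β h < 1

def Analyst.next {X : Type u} (an : Analyst X) (h : Transcript X) : Option (Request X) :=
  (an.workload h).map fun W => ⟨W, an.α h, an.β h⟩

/-- The state of the system: number of past rounds, consumed budget, cache, and the responses
returned so far. -/
structure State (X : Type u) where
  round : ℕ
  consumed : ℝ
  cache : Cache X
  transcript : Transcript X

instance {X : Type u} : MeasurableSpace (State X) :=
  MeasurableSpace.comap (fun s => (s.round, s.consumed, s.cache, s.transcript)) inferInstance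

section System

variable {X : Type u} [Fintype X] [DecidableEq X]

def initialState : State X where
  round := 0
  consumed := 0
  cache := emptyCache
  transcript := fun _ => (Status.idle, 0, 0)

/-- End a round by returning the response `r`, with new cache `c` and additional cost `ε`. -/
def State.advance (s : State X) (c : Cache X) (ε : ℝ) (r : Response X) : State X where
  round := s.round + 1
  consumed := s.consumed + ε
  cache := c
  transcript := Function.update s.transcript s.round r

open Classical in
/-- The end of a round, once a mechanism has been chosen: reject if the total budget `εtotal`
would be reached, otherwise run the mechanism, answer, and charge its cost. -/
noncomputable def finishRound (T : StrategyTree X) (cfg : Config) (εtotal : ℝ)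
    (D : Multiset X) (s : State X) (W : Finset (Query X)) (plan : Plan X) :
    Measure (State X) :=
  let ε := plan.cost s.cache
  if εtotal ≤ ε + s.consumed then
    Measure.dirac (s.advance s.cache 0 (Status.rejected, 0, 0))
  else
    (runPlan T cfg D s.cache (s.round + 1) plan).map fun c =>
      s.advance c ε (Status.answered, workloadAnswer c W plan.strategy, ε)

/-- One round of the system on the database `D`. -/
noncomputable def step (T : StrategyTree X) (cfg : Config) (εtotal : ℝ) (an : Analyst X)
    (D : Multiset X) (s : State X) : Measure (State X) :=
  match an.next s.transcript with
  | none => Measure.dirac s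
  | some req =>
      let W := req.workload
      let A := T.instantStrategy W
      (estimateNoise cfg s.cache W A req.α req.β).bind fun b₁ =>
      (estimateNoise cfg emptyCache W A req.α req.β).bind fun b₂ =>
      let Ae := expandStrategy cfg s.cache A b₁
      (estimateNoise cfg s.cache W Ae req.α req.β).bind fun b₃ =>
      finishRound T cfg εtotal D s W (choosePlan cfg s.cache (s.round + 1) A Ae b₁ b₂ b₃)

/-- The law of the state after the given number of rounds. -/
noncomputable def stateLaw (T : StrategyTree X) (cfg : Config) (εtotal : ℝ) (an : Analyst X)
    (D : Multiset X) : ℕ → Measure (State X)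
  | 0 => Measure.dirac initialState
  | n + 1 => (stateLaw T cfg εtotal an D n).bind (step T cfg εtotal an D)

/-- The system as a mechanism: on the database `D`, the law of everything returned to the
analyst in the given number of rounds. -/
noncomputable def system (T : StrategyTree X) (cfg : Config) (εtotal : ℝ) (an : Analyst X)
    (rounds : ℕ) (D : Multiset X) : Measure (Transcript X) :=
  (stateLaw T cfg εtotal an D rounds).map State.transcript

end System

end CacheDP

/-!
The proof follows the likelihood ratio of the whole state of the system (consumed budget, cache,
transcript) between two neighbouring databases `D` and `D'`, and bounds it by a function of the
state.

A relaxed response is not private on its own given the response that it refines: the conditional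
law of the refined noise only satisfies a bound with `1 / b + 1 / b₀` in the exponent, although RP
charges for `1 / b - 1 / b₀`. The loss telescopes only jointly, because the pair of the old and the
new response has the law of the new response followed by a data-independent perturbation
(`withDensity_lapRatio_lapNoiseDown`). Hence the bound must know which part of the loss charged for
the responses in the cache they have really caused. For a state `s` it is
`exp (consumed s - ∑ a, slack a)` (`ratioBound`), where the slack of a cached response is its
worst-case loss at its current scale minus its actual log-likelihood ratio. In a valid state every
slack is nonnegative and the consumed budget is at most `εtotal`, so that `ratioBound` is at most
`exp εtotal`.

The laws of the state satisfy this bound after every round (`stateLaw_le_withDensity`). By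
`bind_le_withDensity` this reduces to a statement about a single round from a valid state `s`: the
kernel on `D`, multiplied by `ratioBound s`, has density at most `ratioBound` with respect to the
kernel on `D'` (`Dominates`, `dominates_step`). The cost estimation does not look at the database,
so only the execution of a chosen plan matters (`Plan.IsSound.dominates_responsesLaw`). There both
mechanisms replace some cached responses by new ones of a common scale `b`, and the claim becomes
`∑ |q(D) - q(D')| / b ≤ cost + ∑ (slack + credit)` over the replaced queries
(`Plan.IsSound.sum_loss_le_cost`). For MMM it follows from the sensitivity bound: neighbours differ
by at most the `L₁` norm of the perturbed strategy (`Neighbor.sum_abs_trueCount_sub_le`), proactive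
querying does not increase this norm (`IsHierarchical.rawNorm_union_searchProactive_le`), and
mapping the paid strategy over the buckets does not decrease it (`rawNorm_le_mappedNorm`). For RP,
slack and credit add up to the loss at the old scale.

The other half of the proof is that these laws are what they should be. A bind along a
non-measurable family would be a junk value, so every building block of a round is shown to be a
measurable family of measures of mass at most one (`IsSubMarkov`), functions with discrete values
being treated through their level sets (`LevelMeasurable`). On valid states all noise parameters in
use are positive (`Usable`) and refinements go from a larger to a smaller scale, so that a round is
a probability measure on valid states (`isLawOn_step`).
-/

namespace CacheDP

universe u

/-! ### The decomposition tree -/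

namespace StrategyTree

variable {X : Type u} [DecidableEq X]

/-- The queries of all nodes of a tree. -/
def nodes : StrategyTree X → Finset (Query X)
  | leaf x => {{x}}
  | node child => insert (Finset.univ.biUnion fun i => (child i).query)
      (Finset.univ.biUnion fun i => (child i).nodes)

theorem IsHierarchical.query_nonempty {k : ℕ} :
    ∀ {T : StrategyTree X}, T.IsHierarchical k → T.query.Nonempty
  | leaf x, _ => by simp [query]
  | node (m := m) child, h => by
    obtain ⟨hm, -, -, hc⟩ := h
    obtain ⟨x, hx⟩ := (hc ⟨0, by omega⟩).query_nonempty
    exact ⟨x, by simp only [query, Finset.mem_biUnion]; exact ⟨_, Finset.mem_univ _, hx⟩⟩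

theorem subset_query_of_mem_nodes :
    ∀ {T : StrategyTree X} {q : Query X}, q ∈ T.nodes → q ⊆ T.query
  | leaf x, q, h => by simp_all [nodes, query]
  | node child, q, h => by
    simp only [nodes, Finset.mem_insert, Finset.mem_biUnion, Finset.mem_univ, true_and] at h
    rcases h with rfl | ⟨i, hi⟩
    · simp [query]
    · exact (subset_query_of_mem_nodes hi).trans
        (Finset.subset_biUnion_of_mem (fun i => (child i).query) (Finset.mem_univ i))

theorem IsHierarchical.nonempty_of_mem_nodes {k : ℕ} :
    ∀ {T : StrategyTree X} {q : Query X}, T.IsHierarchical k → q ∈ T.nodes → q.Nonempty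
  | leaf x, q, _, hq => by simp_all [nodes]
  | node child, q, h, hq => by
    simp only [nodes, Finset.mem_insert, Finset.mem_biUnion, Finset.mem_univ, true_and] at hq
    rcases hq with rfl | ⟨i, hi⟩
    · exact h.query_nonempty
    · exact (h.2.2.2 i).nonempty_of_mem_nodes hi

/-- The root query of an internal node does not reappear below it: every child misses the
nonempty query of one of its siblings. -/
theorem IsHierarchical.query_notMem_nodes_child {k m : ℕ} {child : Fin m → StrategyTree X}
    (h : (node child).IsHierarchical k) (i : Fin m) :
    (Finset.univ.biUnion fun i => (child i).query) ∉ (child i).nodes := by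
  intro hq
  obtain ⟨hm, -, hd, hc⟩ := h
  have : Nontrivial (Fin m) := Fin.nontrivial_iff_two_le.2 hm
  obtain ⟨j, hj⟩ := exists_ne i
  obtain ⟨x, hx⟩ := (hc j).query_nonempty
  have h1 : x ∈ (child i).query := subset_query_of_mem_nodes hq
    (Finset.mem_biUnion.2 ⟨j, Finset.mem_univ _, hx⟩)
  exact Finset.disjoint_left.1 (hd j i hj) hx h1

theorem decompose_subset_nodes :
    ∀ (T : StrategyTree X) (w : Query X), T.decompose w ⊆ T.nodes
  | leaf x, w => by
    rw [decompose]; split_ifs <;> simp [nodes]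
  | node child, w => by
    rw [decompose]
    split_ifs with h
    · simp [nodes, h]
    · refine Finset.biUnion_subset.2 fun i _ => ?_
      split_ifs
      · simp
      · exact (decompose_subset_nodes (child i) _).trans
          ((Finset.subset_biUnion_of_mem (fun i => (child i).nodes) (Finset.mem_univ i)).trans
            (Finset.subset_insert _ _))

theorem instantStrategy_subset_nodes (T : StrategyTree X) (W : Finset (Query X)) :
    T.instantStrategy W ⊆ T.nodes :=
  Finset.biUnion_subset.2 fun w _ => T.decompose_subset_nodes w

theorem searchProactive_subset_nodes (C P : Finset (Query X)) :
    ∀ (T : StrategyTree X) (r : ℕ), T.searchProactive C P r ⊆ T.nodes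
  | leaf x, r => by
    rw [searchProactive]; split_ifs <;> simp [nodes]
  | node child, r => by
    have key : ∀ r, (Finset.univ.biUnion fun i => (child i).searchProactive C P r) ⊆
        Finset.univ.biUnion fun i => (child i).nodes := fun r =>
      Finset.biUnion_mono fun i _ => searchProactive_subset_nodes C P (child i) r
    simp only [searchProactive, nodes]
    split_ifs
    · exact (key _).trans (Finset.subset_insert _ _)
    · simp
    · exact Finset.insert_subset_insert _ (key _)
    · simp
    · exact (key _).trans (Finset.subset_insert _ _)
    · simp

/-- Number of queries of `S` that contain the domain value `x`. -/
def hits (S : Finset (Query X)) (x : X) : ℕ := (S.filter fun a => x ∈ a).card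

theorem hits_mono {S S' : Finset (Query X)} (h : S ⊆ S') (x : X) : hits S x ≤ hits S' x :=
  Finset.card_le_card (Finset.filter_subset_filter _ h)

/-- The subtree norm is attained: some path, hence some domain value, meets that many marked
nodes. -/
theorem IsHierarchical.exists_subtreeNorm_le_hits {k : ℕ} (P : Finset (Query X)) :
    ∀ {T : StrategyTree X}, T.IsHierarchical k →
      ∃ x ∈ T.query, T.subtreeNorm P ≤ hits (P ∩ T.nodes) x
  | leaf x, _ => by
    refine ⟨x, by simp [query], ?_⟩
    rw [subtreeNorm]
    split_ifs with h
    · refine Finset.card_pos.2 ⟨{x}, ?_⟩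
      simp [nodes, h]
    · exact Nat.zero_le _
  | node (m := m) child, h => by
    obtain ⟨i, -, hi⟩ := Finset.exists_mem_eq_sup (Finset.univ : Finset (Fin m))
      ⟨⟨0, by have := h.1; omega⟩, Finset.mem_univ _⟩ fun i => (child i).subtreeNorm P
    obtain ⟨x, hx, hle⟩ := (h.2.2.2 i).exists_subtreeNorm_le_hits P
    have hxq : x ∈ Finset.univ.biUnion fun i => (child i).query :=
      Finset.mem_biUnion.2 ⟨i, Finset.mem_univ _, hx⟩
    refine ⟨x, hxq, ?_⟩
    rw [subtreeNorm, hi]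
    have hsub : P ∩ (child i).nodes ⊆ P ∩ (node child).nodes :=
      Finset.inter_subset_inter_left ((Finset.subset_biUnion_of_mem
        (fun i => (child i).nodes) (Finset.mem_univ i)).trans (Finset.subset_insert _ _))
    split_ifs with hq
    · have hnot : (Finset.univ.biUnion fun i => (child i).query) ∉
          (P ∩ (child i).nodes).filter fun a => x ∈ a := fun hmem =>
        h.query_notMem_nodes_child i (Finset.mem_inter.1 (Finset.mem_filter.1 hmem).1).2
      have : insert (Finset.univ.biUnion fun i => (child i).query)
          ((P ∩ (child i).nodes).filter fun a => x ∈ a) ⊆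
          (P ∩ (node child).nodes).filter fun a => x ∈ a := by
        refine Finset.insert_subset ?_ (Finset.filter_subset_filter _ hsub)
        simp only [Finset.mem_filter, Finset.mem_inter]
        exact ⟨⟨hq, Finset.mem_insert_self _ _⟩, hxq⟩
      have := Finset.card_le_card this
      rw [Finset.card_insert_of_notMem hnot] at this
      unfold hits at hle ⊢
      omega
    · have := hits_mono hsub x
      omega

/-- Proactive querying respects the path budget `r`: as long as the marked nodes alone do, no
domain value is hit by more than `r` marked or added nodes. -/
theorem IsHierarchical.hits_searchProactive_le {k : ℕ} (C P : Finset (Query X)) :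
    ∀ {T : StrategyTree X}, T.IsHierarchical k → ∀ {r : ℕ}, T.subtreeNorm P ≤ r →
      ∀ x, hits (P ∩ T.nodes ∪ T.searchProactive C P r) x ≤ r
  | leaf y, _, r, hr, x => by
    have hle : ∀ S : Finset (Query X), S ⊆ {{y}} → hits S x ≤ 1 := fun S hS =>
      (Finset.card_le_card ((Finset.filter_subset _ _).trans hS)).trans (by simp)
    rw [subtreeNorm] at hr
    by_cases hy : ({y} : Query X) ∈ P
    · rw [if_pos hy] at hr
      refine (hle _ ?_).trans hr
      rw [searchProactive, if_pos hy]
      simp [nodes, hy]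
    · have hP : P ∩ (leaf y).nodes = ∅ := by simp [nodes, hy]
      rw [hP, Finset.empty_union, searchProactive, if_neg hy]
      split_ifs with h
      · exact (hle _ subset_rfl).trans (by omega)
      · simp [hits]
  | node (m := m) child, h, r, hr, x => by
    set q : Query X := Finset.univ.biUnion fun i => (child i).query with hq
    by_cases hx : x ∈ q
    swap
    · have : hits (P ∩ (node child).nodes ∪ (node child).searchProactive C P r) x = 0 := by
        refine Finset.card_eq_zero.2 (Finset.filter_eq_empty_iff.2 fun a ha hxa => hx ?_)
        have : a ∈ (node child).nodes := by
          rcases Finset.mem_union.1 ha with ha | ha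
          · exact (Finset.mem_inter.1 ha).2
          · exact searchProactive_subset_nodes _ _ _ _ ha
        exact subset_query_of_mem_nodes this hxa
      omega
    obtain ⟨i, -, hi⟩ := Finset.mem_biUnion.1 hx
    -- only the child below which `x` lies contributes
    have hchild : ∀ j, ∀ a ∈ (child j).nodes, x ∈ a → j = i := fun j a ha hxa => by
      by_contra hne
      exact Finset.disjoint_left.1 (h.2.2.1 j i hne) (subset_query_of_mem_nodes ha hxa) hi
    have hsup : (child i).subtreeNorm P ≤ Finset.univ.sup fun i => (child i).subtreeNorm P :=
      Finset.le_sup (f := fun i => (child i).subtreeNorm P) (Finset.mem_univ i)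
    rw [subtreeNorm, ← hq] at hr
    have ih := fun {r : ℕ} (hr : (child i).subtreeNorm P ≤ r) =>
      (h.2.2.2 i).hits_searchProactive_le C P hr x
    have marked : ∀ a ∈ P ∩ (node child).nodes, x ∈ a →
        (a = q ∧ q ∈ P) ∨ a ∈ P ∩ (child i).nodes := by
      intro a ha hxa
      obtain ⟨haP, han⟩ := Finset.mem_inter.1 ha
      simp only [nodes, Finset.mem_insert, Finset.mem_biUnion, Finset.mem_univ, true_and] at han
      rcases han with rfl | ⟨j, hj⟩
      · exact Or.inl ⟨rfl, haP⟩
      · exact Or.inr (Finset.mem_inter.2 ⟨haP, hchild j a hj hxa ▸ hj⟩)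
    have below : ∀ s, ∀ a ∈ Finset.univ.biUnion fun i => (child i).searchProactive C P s,
        x ∈ a → a ∈ (child i).searchProactive C P s := by
      intro s a ha hxa
      obtain ⟨j, -, hj⟩ := Finset.mem_biUnion.1 ha
      exact hchild j a (searchProactive_subset_nodes _ _ _ _ hj) hxa ▸ hj
    have bound_insert : ∀ (S U : Finset (Query X)), (∀ a ∈ S, x ∈ a → a = q ∨ a ∈ U) →
        hits S x ≤ hits U x + 1 := by
      intro S U hSU
      refine (Finset.card_le_card (t := insert q (U.filter fun a => x ∈ a)) ?_).trans
        (Finset.card_insert_le _ _)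
      intro a ha
      obtain ⟨ha, hxa⟩ := Finset.mem_filter.1 ha
      rcases hSU a ha hxa with h | h
      · exact Finset.mem_insert.2 (Or.inl h)
      · exact Finset.mem_insert.2 (Or.inr (Finset.mem_filter.2 ⟨h, hxa⟩))
    have bound : ∀ (S U : Finset (Query X)), (∀ a ∈ S, x ∈ a → a ∈ U) →
        hits S x ≤ hits U x := fun S U hSU => Finset.card_le_card fun a ha =>
      Finset.mem_filter.2 ⟨hSU a (Finset.mem_filter.1 ha).1 (Finset.mem_filter.1 ha).2,
        (Finset.mem_filter.1 ha).2⟩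
    simp only [searchProactive, ← hq]
    by_cases hqP : q ∈ P
    -- a marked node uses one unit of the budget, which its children do not have
    · rw [if_pos hqP] at hr
      simp only [if_pos hqP]
      have h1 := ih (r := r - 1) (by omega)
      refine (bound_insert _ (P ∩ (child i).nodes ∪ (child i).searchProactive C P (r - 1))
        ?_).trans (by omega)
      intro a ha hxa
      rcases Finset.mem_union.1 ha with ha | ha
      · rcases marked a ha hxa with h | h
        · exact Or.inl h.1
        · exact Or.inr (Finset.mem_union_left _ h)
      · split_ifs at ha
        · exact Or.inr (Finset.mem_union_right _ (below _ a ha hxa))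
        · simp at ha
    -- an unmarked node is added only if the marked nodes below leave one unit of the budget
    · rw [if_neg hqP, zero_add] at hr
      simp only [if_neg hqP]
      split_ifs with hC h0 h0
      · have hr' : (child i).subtreeNorm P ≤ r - 1 := by
          have := hC.2
          rw [subtreeNorm, ← hq, if_neg hqP] at this
          omega
        have h1 := ih hr'
        refine (bound_insert _ (P ∩ (child i).nodes ∪ (child i).searchProactive C P (r - 1))
          ?_).trans (by omega)
        intro a ha hxa
        rcases Finset.mem_union.1 ha with ha | ha
        · exact Or.inr (Finset.mem_union_left _ ((marked a ha hxa).resolve_left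
            fun h => hqP h.2))
        · rcases Finset.mem_insert.1 ha with ha | ha
          · exact Or.inl ha
          · exact Or.inr (Finset.mem_union_right _ (below _ a ha hxa))
      · have hr' : (child i).subtreeNorm P ≤ r - 1 := by
          have := hC.2
          rw [subtreeNorm, ← hq, if_neg hqP] at this
          omega
        have h1 := ih hr'
        refine (bound_insert _ (P ∩ (child i).nodes ∪ (child i).searchProactive C P (r - 1))
          ?_).trans (by omega)
        intro a ha hxa
        rcases Finset.mem_union.1 ha with ha | ha
        · exact Or.inr (Finset.mem_union_left _ ((marked a ha hxa).resolve_left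
            fun h => hqP h.2))
        · rcases Finset.mem_insert.1 ha with ha | ha
          · exact Or.inl ha
          · simp at ha
      · have h1 := ih (hsup.trans hr)
        refine (bound _ (P ∩ (child i).nodes ∪ (child i).searchProactive C P r) ?_).trans h1
        intro a ha hxa
        rcases Finset.mem_union.1 ha with ha | ha
        · exact Finset.mem_union_left _ ((marked a ha hxa).resolve_left fun h => hqP h.2)
        · exact Finset.mem_union_right _ (below _ a ha hxa)
      · have h1 := ih (hsup.trans hr)
        refine (bound _ (P ∩ (child i).nodes ∪ (child i).searchProactive C P r) ?_).trans h1
        intro a ha hxa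
        rcases Finset.mem_union.1 ha with ha | ha
        · exact Finset.mem_union_left _ ((marked a ha hxa).resolve_left fun h => hqP h.2)
        · simp at ha

/-- Adding the proactively queried nodes does not increase the `L₁` norm of a strategy of tree
nodes. -/
theorem IsHierarchical.rawNorm_union_searchProactive_le [Fintype X] {k : ℕ}
    {T : StrategyTree X} (hT : T.IsHierarchical k) (C : Finset (Query X))
    {P : Finset (Query X)} (hP : P ⊆ T.nodes) :
    rawNorm (P ∪ T.searchProactive C P (rawNorm P)) ≤ rawNorm P := by
  obtain ⟨x, -, hx⟩ := hT.exists_subtreeNorm_le_hits P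
  have h1 : hits (P ∩ T.nodes) x ≤ rawNorm P := (hits_mono Finset.inter_subset_left x).trans
    (Finset.le_sup (f := fun x => (P.filter fun a => x ∈ a).card) (Finset.mem_univ x))
  refine Finset.sup_le fun y _ => ?_
  have := hT.hits_searchProactive_le C P (hx.trans h1) y
  rwa [Finset.inter_eq_left.2 hP] at this

end StrategyTree

/-! ### Buckets and the `L₁` norm -/

section Buckets

variable {X : Type u} [DecidableEq X]

/-- Invariant of the full-rank transformation after the rows `L` have been processed: the buckets
are nonempty, cover all rows, and no row cuts a bucket. -/
structure IsBucketing (L : List (Query X)) (B : Finset (Query X)) : Prop where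
  nonempty : ∀ t ∈ B, t.Nonempty
  disjoint : ∀ t ∈ B, ∀ t' ∈ B, t ≠ t' → Disjoint t t'
  covers : ∀ a ∈ L, ∀ x ∈ a, ∃ t ∈ B, x ∈ t
  subset_or_disjoint : ∀ a ∈ L, ∀ t ∈ B, t ⊆ a ∨ Disjoint t a

theorem IsBucketing.refine {L : List (Query X)} {B : Finset (Query X)} (h : IsBucketing L B)
    (a : Query X) : IsBucketing (L ++ [a]) (refineBuckets B a) := by
  rw [refineBuckets]
  split_ifs with ha
  · refine ⟨h.nonempty, h.disjoint, ?_, ?_⟩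
    · intro b hb x hx
      rcases List.mem_append.1 hb with hb | hb
      · exact h.covers b hb x hx
      · obtain rfl := List.mem_singleton.1 hb
        exact ⟨b, ha, hx⟩
    · intro b hb t ht
      rcases List.mem_append.1 hb with hb | hb
      · exact h.subset_or_disjoint b hb t ht
      · obtain rfl := List.mem_singleton.1 hb
        by_cases htb : t = b
        · exact Or.inl htb.subset
        · exact Or.inr (h.disjoint t ht b ha htb)
  · -- every new bucket is `t`, `t ∩ a`, `t \ a` for an old bucket `t`, or the uncovered part of `a`
    have hmem : ∀ s, s ∈ ((B.filter fun t => Disjoint t a) ∪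
        ((B.filter fun t => ¬ Disjoint t a).image fun t => t ∩ a) ∪
        ((B.filter fun t => ¬ Disjoint t a).image fun t => t \ a) ∪
        {a \ B.sup id}).erase ∅ ↔ s ≠ ∅ ∧ ((s ∈ B ∧ Disjoint s a) ∨
          (∃ t ∈ B, ¬ Disjoint t a ∧ t ∩ a = s) ∨ (∃ t ∈ B, ¬ Disjoint t a ∧ t \ a = s) ∨
          s = a \ B.sup id) := by
      intro s
      simp only [Finset.mem_erase, Finset.mem_union, Finset.mem_filter, Finset.mem_image,
        Finset.mem_singleton, and_assoc, or_assoc]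
    have hside : ∀ s, (s ∈ B ∧ Disjoint s a) ∨
          (∃ t ∈ B, ¬ Disjoint t a ∧ t ∩ a = s) ∨ (∃ t ∈ B, ¬ Disjoint t a ∧ t \ a = s) ∨
          s = a \ B.sup id →
        ((∃ t ∈ B, s ⊆ t ∧ (s = t ∩ a ∨ s = t \ a)) ∨ s = a \ B.sup id) := by
      rintro s (⟨hs, hd⟩ | ⟨t, ht, -, rfl⟩ | ⟨t, ht, -, rfl⟩ | rfl)
      · exact Or.inl ⟨s, hs, subset_rfl, Or.inr (Finset.sdiff_eq_self_of_disjoint hd).symm⟩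
      · exact Or.inl ⟨t, ht, Finset.inter_subset_left, Or.inl rfl⟩
      · exact Or.inl ⟨t, ht, Finset.sdiff_subset, Or.inr rfl⟩
      · exact Or.inr rfl
    refine ⟨?_, ?_, ?_, ?_⟩
    · intro s hs
      exact Finset.nonempty_iff_ne_empty.2 ((hmem s).1 hs).1
    · intro s hs s' hs' hne
      rw [Finset.disjoint_left]
      intro x hx hx'
      have hout : ∀ t ∈ B, x ∈ t → x ∉ a \ B.sup id := by
        intro t ht hxt hxo
        exact (Finset.mem_sdiff.1 hxo).2 (Finset.mem_sup.2 ⟨t, ht, hxt⟩)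
      rcases hside s ((hmem s).1 hs).2 with ⟨t, ht, hst, hst'⟩ | rfl <;>
      rcases hside s' ((hmem s').1 hs').2 with ⟨t', ht', hst2, hst2'⟩ | rfl
      · have htt : t = t' := by
          by_contra hn
          exact Finset.disjoint_left.1 (h.disjoint t ht t' ht' hn) (hst hx) (hst2 hx')
        subst htt
        rcases hst' with rfl | rfl <;> rcases hst2' with rfl | rfl <;> simp_all
      · exact hout t ht (hst hx) hx'
      · exact hout t' ht' (hst2 hx') hx
      · exact hne rfl
    · have hcov : ∀ t ∈ B, ∀ x ∈ t, ∃ s, (s ≠ ∅ ∧ ((s ∈ B ∧ Disjoint s a) ∨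
          (∃ t ∈ B, ¬ Disjoint t a ∧ t ∩ a = s) ∨ (∃ t ∈ B, ¬ Disjoint t a ∧ t \ a = s) ∨
          s = a \ B.sup id)) ∧ x ∈ s := by
        intro t ht x hx
        by_cases hd : Disjoint t a
        · exact ⟨t, ⟨Finset.ne_empty_of_mem hx, Or.inl ⟨ht, hd⟩⟩, hx⟩
        · by_cases hxa : x ∈ a
          · have : x ∈ t ∩ a := Finset.mem_inter.2 ⟨hx, hxa⟩
            exact ⟨_, ⟨Finset.ne_empty_of_mem this, Or.inr (Or.inl ⟨t, ht, hd, rfl⟩)⟩, this⟩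
          · have : x ∈ t \ a := Finset.mem_sdiff.2 ⟨hx, hxa⟩
            exact ⟨_, ⟨Finset.ne_empty_of_mem this,
              Or.inr (Or.inr (Or.inl ⟨t, ht, hd, rfl⟩))⟩, this⟩
      intro b hb x hx
      simp only [hmem]
      rcases List.mem_append.1 hb with hb | hb
      · obtain ⟨t, ht, hxt⟩ := h.covers b hb x hx
        exact hcov t ht x hxt
      · obtain rfl := List.mem_singleton.1 hb
        by_cases hxB : x ∈ B.sup id
        · obtain ⟨t, ht, hxt⟩ := Finset.mem_sup.1 hxB
          exact hcov t ht x hxt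
        · have : x ∈ b \ B.sup id := Finset.mem_sdiff.2 ⟨hx, hxB⟩
          exact ⟨_, ⟨Finset.ne_empty_of_mem this, Or.inr (Or.inr (Or.inr rfl))⟩, this⟩
    · intro b hb s hs
      rcases List.mem_append.1 hb with hb | hb
      · rcases hside s ((hmem s).1 hs).2 with ⟨t, ht, hst, -⟩ | rfl
        · rcases h.subset_or_disjoint b hb t ht with h | h
          · exact Or.inl (hst.trans h)
          · exact Or.inr (Finset.disjoint_of_subset_left hst h)
        · refine Or.inr (Finset.disjoint_left.2 fun x hx hxb => ?_)
          obtain ⟨t, ht, hxt⟩ := h.covers b hb x hxb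
          exact (Finset.mem_sdiff.1 hx).2 (Finset.mem_sup.2 ⟨t, ht, hxt⟩)
      · obtain rfl := List.mem_singleton.1 hb
        rcases hside s ((hmem s).1 hs).2 with ⟨t, ht, -, rfl | rfl⟩ | rfl
        · exact Or.inl Finset.inter_subset_right
        · exact Or.inr Finset.sdiff_disjoint
        · exact Or.inl Finset.sdiff_subset

theorem isBucketing_buckets (A : Finset (Query X)) : IsBucketing A.toList (buckets A) := by
  have key : ∀ (L L₀ : List (Query X)) (B : Finset (Query X)), IsBucketing L₀ B →
      IsBucketing (L₀ ++ L) (L.foldl refineBuckets B) := by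
    intro L
    induction L with
    | nil => intro L₀ B h; simpa using h
    | cons a L ih =>
      intro L₀ B h
      have := ih (L₀ ++ [a]) _ (h.refine a)
      simpa using this
  have := key A.toList [] ∅ ⟨by simp, by simp, by simp, by simp⟩
  simpa [buckets] using this

variable [Fintype X]

theorem hits_le_rawNorm (P : Finset (Query X)) (x : X) : StrategyTree.hits P x ≤ rawNorm P :=
  Finset.le_sup (f := fun x => (P.filter fun a => x ∈ a).card) (Finset.mem_univ x)

/-- Over the buckets of a strategy, the mapped `L₁` norm of any of its subsets is at least the
norm over the full domain, since a domain value is hit by a row iff its bucket is. -/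
theorem rawNorm_le_mappedNorm {P A : Finset (Query X)} (hP : P ⊆ A) :
    rawNorm P ≤ mappedNorm P (buckets A) := by
  have hB := isBucketing_buckets A
  refine Finset.sup_le fun x _ => ?_
  rcases (P.filter fun a => x ∈ a).eq_empty_or_nonempty with h | ⟨a, ha⟩
  · simp [h]
  obtain ⟨haP, hxa⟩ := Finset.mem_filter.1 ha
  obtain ⟨t, ht, hxt⟩ := hB.covers a (Finset.mem_toList.2 (hP haP)) x hxa
  have hle : (P.filter fun a => x ∈ a).card ≤ (P.filter fun a => t ⊆ a).card := by
    refine Finset.card_le_card fun b hb => ?_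
    obtain ⟨hbP, hxb⟩ := Finset.mem_filter.1 hb
    refine Finset.mem_filter.2 ⟨hbP, ?_⟩
    exact (hB.subset_or_disjoint b (Finset.mem_toList.2 (hP hbP)) t ht).resolve_right
      fun hd => Finset.disjoint_left.1 hd hxt hxb
  exact hle.trans (Finset.le_sup (f := fun t => (P.filter fun a => t ⊆ a).card) ht)

theorem mappedNorm_pos {A : Finset (Query X)} {a : Query X} (ha : a ∈ A) (hne : a.Nonempty) :
    0 < mappedNorm A (buckets A) := by
  obtain ⟨x, hx⟩ := hne
  refine lt_of_lt_of_le ?_ (rawNorm_le_mappedNorm subset_rfl)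
  exact lt_of_lt_of_le (Finset.card_pos.2 ⟨a, Finset.mem_filter.2 ⟨ha, hx⟩⟩)
    (hits_le_rawNorm A x)

end Buckets

/-! ### Laplace noise and its refinement -/

section Laplace

open Set

theorem lintegral_exp_neg_mul_Ioi {p : ℝ} (hp : 0 < p) (c : ℝ) :
    ∫⁻ x in Ioi c, ENNReal.ofReal (Real.exp (-p * x)) = ENNReal.ofReal (Real.exp (-p * c) / p) := by
  rw [← ofReal_integral_eq_lintegral_ofReal (integrableOn_exp_mul_Ioi (by linarith) c)
    (ae_of_all _ fun _ => (Real.exp_pos _).le), integral_exp_mul_Ioi (by linarith)]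
  congr 1
  field_simp

theorem lintegral_exp_mul_Iic {p : ℝ} (hp : 0 < p) (c : ℝ) :
    ∫⁻ x in Iic c, ENNReal.ofReal (Real.exp (p * x)) = ENNReal.ofReal (Real.exp (p * c) / p) := by
  rw [← ofReal_integral_eq_lintegral_ofReal (integrableOn_exp_mul_Iic hp c)
    (ae_of_all _ fun _ => (Real.exp_pos _).le), integral_exp_mul_Iic hp]

theorem lintegral_exp_neg_mul_Ioc {p : ℝ} (hp : 0 < p) {c : ℝ} (hc : 0 ≤ c) :
    ∫⁻ x in Ioc 0 c, ENNReal.ofReal (Real.exp (-p * x)) =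
      ENNReal.ofReal ((1 - Real.exp (-p * c)) / p) := by
  have hint : IntegrableOn (fun x => Real.exp (-p * x)) (Ioc 0 c) :=
    (Continuous.integrableOn_Icc (by fun_prop)).mono_set Ioc_subset_Icc_self
  rw [← ofReal_integral_eq_lintegral_ofReal hint (ae_of_all _ fun _ => (Real.exp_pos _).le),
    ← intervalIntegral.integral_of_le hc]
  congr 1
  have hderiv : ∀ x ∈ uIcc 0 c, HasDerivAt (fun x => -Real.exp (-p * x) / p)
      (Real.exp (-p * x)) x := by
    intro x _
    have h := (((hasDerivAt_id x).const_mul (-p)).exp.neg).div_const p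
    refine h.congr_deriv ?_
    rw [div_eq_iff hp.ne']
    simp
  rw [intervalIntegral.integral_eq_sub_of_hasDerivAt hderiv
    (Continuous.intervalIntegrable (by fun_prop) _ _)]
  simp
  ring

theorem isProbabilityMeasure_laplace {b : ℝ} (hb : 0 < b) :
    IsProbabilityMeasure (laplace b) := by
  refine ⟨?_⟩
  have hp : 0 < 1 / b := by positivity
  rw [laplace, withDensity_apply _ MeasurableSet.univ, setLIntegral_univ,
    ← lintegral_add_compl _ (measurableSet_Iic (a := (0 : ℝ))), compl_Iic]
  have h1 : ∫⁻ x in Iic (0 : ℝ), ENNReal.ofReal (1 / (2 * b) * Real.exp (-|x| / b)) =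
      ∫⁻ x in Iic (0 : ℝ), ENNReal.ofReal (1 / (2 * b)) *
        ENNReal.ofReal (Real.exp (1 / b * x)) := by
    refine setLIntegral_congr_fun measurableSet_Iic fun x hx => ?_
    rw [← ENNReal.ofReal_mul (by positivity), abs_of_nonpos hx]
    congr 3
    ring
  have h2 : ∫⁻ x in Ioi (0 : ℝ), ENNReal.ofReal (1 / (2 * b) * Real.exp (-|x| / b)) =
      ∫⁻ x in Ioi (0 : ℝ), ENNReal.ofReal (1 / (2 * b)) *
        ENNReal.ofReal (Real.exp (-(1 / b) * x)) := by
    refine setLIntegral_congr_fun measurableSet_Ioi fun x hx => ?_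
    rw [← ENNReal.ofReal_mul (by positivity), abs_of_pos hx]
    congr 3
    ring
  rw [h1, h2, lintegral_const_mul _ (by fun_prop), lintegral_const_mul _ (by fun_prop),
    lintegral_exp_mul_Iic hp, lintegral_exp_neg_mul_Ioi hp, ← ENNReal.ofReal_mul (by positivity),
    ← ENNReal.ofReal_mul (by positivity), ← ENNReal.ofReal_add (by positivity) (by positivity), ENNReal.ofReal_eq_one]
  simp
  field_simp
  norm_num

theorem laplace_eq_zero {b : ℝ} (hb : b ≤ 0) : laplace b = 0 := by
  have : (fun x : ℝ => ENNReal.ofReal (1 / (2 * b) * Real.exp (-|x| / b))) = 0 := by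
    funext x
    refine ENNReal.ofReal_of_nonpos (mul_nonpos_of_nonpos_of_nonneg ?_ (Real.exp_pos _).le)
    exact div_nonpos_of_nonneg_of_nonpos zero_le_one (by linarith)
  rw [laplace, this, withDensity_zero]

theorem laplace_univ_le_one (b : ℝ) : laplace b univ ≤ 1 := by
  rcases le_or_gt b 0 with hb | hb
  · simp [laplace_eq_zero hb]
  · exact (isProbabilityMeasure_laplace hb).measure_univ.le

/-- The integral is split at `0` and at `η`, between which the exponent is `-(p - q) * y`. -/
theorem lintegral_lapNoiseDown_aux {p q : ℝ} (hq : 0 < q) (hpq : q < p) {η : ℝ} (hη : 0 ≤ η) :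
    ∫⁻ y, ENNReal.ofReal (Real.exp (-p * |y| - q * |η - y| + q * |η|)) =
      ENNReal.ofReal ((1 + Real.exp (-(p - q) * η)) / (p + q) +
        (1 - Real.exp (-(p - q) * η)) / (p - q)) := by
  have hs : 0 < p + q := by linarith
  have hd : 0 < p - q := by linarith
  have hE : Real.exp (-(p - q) * η) ≤ 1 := Real.exp_le_one_iff.2 (by nlinarith)
  rw [← lintegral_add_compl _ (measurableSet_Iic (a := (0 : ℝ))), compl_Iic,
    ← Ioc_union_Ioi_eq_Ioi hη, lintegral_union measurableSet_Ioi
      (disjoint_left.2 fun x hx hx' => not_lt.2 hx.2 hx')]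
  have h1 : ∫⁻ y in Iic (0 : ℝ), ENNReal.ofReal (Real.exp (-p * |y| - q * |η - y| + q * |η|)) =
      ∫⁻ y in Iic (0 : ℝ), ENNReal.ofReal (Real.exp ((p + q) * y)) := by
    refine setLIntegral_congr_fun measurableSet_Iic fun y hy => ?_
    rw [mem_Iic] at hy
    simp only [abs_of_nonpos hy, abs_of_nonneg hη, abs_of_nonneg (show 0 ≤ η - y by linarith)]
    congr 2
    ring
  have h2 : ∫⁻ y in Ioc (0 : ℝ) η,
        ENNReal.ofReal (Real.exp (-p * |y| - q * |η - y| + q * |η|)) =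
      ∫⁻ y in Ioc (0 : ℝ) η, ENNReal.ofReal (Real.exp (-(p - q) * y)) := by
    refine setLIntegral_congr_fun measurableSet_Ioc fun y hy => ?_
    simp only [abs_of_pos hy.1, abs_of_nonneg hη, abs_of_nonneg (sub_nonneg.2 hy.2)]
    congr 2
    ring
  have h3 : ∫⁻ y in Ioi η, ENNReal.ofReal (Real.exp (-p * |y| - q * |η - y| + q * |η|)) =
      ∫⁻ y in Ioi η, ENNReal.ofReal (Real.exp (2 * q * η)) *
        ENNReal.ofReal (Real.exp (-(p + q) * y)) := by
    refine setLIntegral_congr_fun measurableSet_Ioi fun y hy => ?_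
    rw [mem_Ioi] at hy
    rw [← ENNReal.ofReal_mul (Real.exp_pos _).le, ← Real.exp_add, abs_of_pos (hη.trans_lt hy),
      abs_of_nonneg hη, abs_of_neg (sub_neg.2 hy)]
    congr 2
    ring
  rw [h1, h2, h3, lintegral_const_mul _ (by fun_prop), lintegral_exp_mul_Iic hs,
    lintegral_exp_neg_mul_Ioc hd hη, lintegral_exp_neg_mul_Ioi hs,
    ← ENNReal.ofReal_mul (Real.exp_pos _).le,
    ← ENNReal.ofReal_add (div_nonneg (by linarith) hd.le) (by positivity),
    ← ENNReal.ofReal_add (by positivity)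
      (add_nonneg (div_nonneg (by linarith) hd.le) (by positivity)),
    ← mul_div_assoc, ← Real.exp_add]
  congr 1
  have : 2 * q * η + -(p + q) * η = -(p - q) * η := by ring
  rw [this, mul_zero, Real.exp_zero]
  ring

/-- The integral of the conditional density of the refined noise, for noise of either sign. -/
theorem lintegral_lapNoiseDown {p q : ℝ} (hq : 0 < q) (hpq : q < p) (η : ℝ) :
    ∫⁻ y, ENNReal.ofReal (Real.exp (-p * |y| - q * |η - y| + q * |η|)) =
      ENNReal.ofReal ((1 + Real.exp (-(p - q) * |η|)) / (p + q) +
        (1 - Real.exp (-(p - q) * |η|)) / (p - q)) := by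
  rcases le_total 0 η with hη | hη
  · rw [lintegral_lapNoiseDown_aux hq hpq hη, abs_of_nonneg hη]
  · have h := lintegral_lapNoiseDown_aux hq hpq (neg_nonneg.2 hη)
    rw [← lintegral_neg_eq_self, abs_of_nonpos hη, ← h, abs_neg, abs_of_nonpos hη]
    refine lintegral_congr fun y => ?_
    have : |η - -y| = |-η - y| := by rw [← abs_neg]; congr 1; ring
    rw [this, abs_neg]

/-- The mass of the density complements the point mass at the old noise. -/
theorem isProbabilityMeasure_lapNoiseDown {b₀ b : ℝ} (hb : 0 < b) (hb₀ : b ≤ b₀) (η : ℝ) :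
    IsProbabilityMeasure (lapNoiseDown b₀ b η) := by
  have h₀ : 0 < b₀ := hb.trans_le hb₀
  refine ⟨?_⟩
  have hK : 0 ≤ (1 - b ^ 2 / b₀ ^ 2) * (1 / (2 * b)) := by
    refine mul_nonneg (sub_nonneg.2 ?_) (by positivity)
    rw [div_le_one (by positivity)]
    gcongr
  rw [lapNoiseDown, Measure.add_apply, Measure.smul_apply, measure_univ, smul_eq_mul, mul_one,
    withDensity_apply _ MeasurableSet.univ, setLIntegral_univ]
  simp_rw [ENNReal.ofReal_mul hK]
  rw [lintegral_const_mul _ (by fun_prop)]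
  -- for equal scales the noise is kept and the density vanishes
  rcases hb₀.eq_or_lt with rfl | hlt
  · simp [hb.ne']
  have hpq : 1 / b₀ < 1 / b := one_div_lt_one_div_of_lt hb hlt
  have hq : 0 < 1 / b₀ := by positivity
  have hE : Real.exp (-(1 / b - 1 / b₀) * |η|) ≤ 1 :=
    Real.exp_le_one_iff.2 (by nlinarith [abs_nonneg η])
  have hcongr : (fun y : ℝ => ENNReal.ofReal (Real.exp (-|y| / b - |η - y| / b₀ + |η| / b₀))) =
      fun y => ENNReal.ofReal
        (Real.exp (-(1 / b) * |y| - 1 / b₀ * |η - y| + 1 / b₀ * |η|)) := by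
    funext y
    congr 2
    ring
  rw [hcongr, lintegral_lapNoiseDown hq hpq, ← ENNReal.ofReal_mul hK,
    ← ENNReal.ofReal_add (by positivity) (mul_nonneg hK (add_nonneg (by positivity)
      (div_nonneg (by linarith) (by linarith)))), ENNReal.ofReal_eq_one]
  generalize Real.exp (-(1 / b - 1 / b₀) * |η|) = E
  have h1 : b₀ - b ≠ 0 := by linarith
  have h2 : 1 / b - 1 / b₀ = (b₀ - b) / (b * b₀) := by field_simp
  have h3 : 1 / b + 1 / b₀ = (b₀ + b) / (b * b₀) := by field_simp
  have h4 : b₀ + b ≠ 0 := by positivity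
  rw [h2, h3]
  field_simp
  ring

/-! ### Likelihood ratios -/

theorem map_const_add_withDensity_volume (m : ℝ) (f : ℝ → ENNReal) :
    (volume.withDensity f).map (fun x => m + x) =
      volume.withDensity fun y => f (y - m) := by
  ext S hS
  rw [Measure.map_apply (by fun_prop) hS, withDensity_apply _ hS,
    withDensity_apply _ (measurable_const_add m hS),
    ← lintegral_indicator (measurable_const_add m hS), ← lintegral_indicator hS,
    ← lintegral_add_left_eq_self (S.indicator fun y => f (y - m)) m]
  refine lintegral_congr fun x => ?_
  simp only [indicator, mem_preimage, add_sub_cancel_left]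
  rfl

/-- Likelihood ratio of a response `y` with Laplace noise of scale `b`, between the true answers
`m` and `m'`. -/
noncomputable def lapRatio (m m' b y : ℝ) : ℝ := Real.exp ((|y - m'| - |y - m|) / b)

theorem lapRatio_pos (m m' b y : ℝ) : 0 < lapRatio m m' b y := Real.exp_pos _

theorem measurable_lapRatio (m m' b : ℝ) : Measurable (lapRatio m m' b) := by
  unfold lapRatio; fun_prop

theorem withDensity_lapRatio_laplace (m m' b : ℝ) :
    ((laplace b).map (fun x => m' + x)).withDensity (fun y => ENNReal.ofReal (lapRatio m m' b y)) =
      (laplace b).map (fun x => m + x) := by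
  have := measurable_lapRatio m m' b
  rw [laplace, map_const_add_withDensity_volume,
    map_const_add_withDensity_volume, ← withDensity_mul _ (by fun_prop)
    (by fun_prop)]
  congr 1
  funext y
  rw [Pi.mul_apply, ← ENNReal.ofReal_mul' (lapRatio_pos ..).le, lapRatio, mul_assoc,
    ← Real.exp_add]
  congr 3
  ring

/-- Refining the noise of the response `r` from scale `b₀` to `b` turns the likelihood ratio of
`r` at scale `b₀` into that of the new response at scale `b`: the conditional law depends on the
true answer, but the joint law of the old and the new response is that of the new one followed by
a data-independent perturbation. -/
theorem withDensity_lapRatio_lapNoiseDown (m m' b₀ b r : ℝ) :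
    ((lapNoiseDown b₀ b (r - m')).map (fun x => m' + x)).withDensity
        (fun y => ENNReal.ofReal (lapRatio m m' b y)) =
      ENNReal.ofReal (lapRatio m m' b₀ r) •
        (lapNoiseDown b₀ b (r - m)).map (fun x => m + x) := by
  have hm := measurable_lapRatio m m' b
  have hadd : ∀ c : ℝ, Measurable fun x : ℝ => c + x := fun c => by fun_prop
  rw [lapNoiseDown, lapNoiseDown, Measure.map_add _ _ (hadd _), Measure.map_add _ _ (hadd _),
    Measure.map_smul, Measure.map_smul, Measure.map_dirac' (hadd _), Measure.map_dirac' (hadd _),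
    map_const_add_withDensity_volume,
    map_const_add_withDensity_volume, withDensity_add_measure,
    withDensity_smul_measure, dirac_withDensity, ← withDensity_mul _ (by fun_prop)
    (by fun_prop), smul_add, ← withDensity_smul _ (by fun_prop), smul_smul, smul_smul,
    add_sub_cancel, add_sub_cancel, ← ENNReal.ofReal_mul' (lapRatio_pos ..).le,
    ← ENNReal.ofReal_mul (lapRatio_pos ..).le]
  congr 1
  · congr 2
    rw [lapRatio, lapRatio, mul_assoc, mul_left_comm (Real.exp ((|r - m'| - |r - m|) / b₀)), ← Real.exp_add,
      ← Real.exp_add]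
    congr 2
    ring
  · congr 1
    funext y
    rw [Pi.mul_apply, ← ENNReal.ofReal_mul' (lapRatio_pos ..).le, Pi.smul_apply, smul_eq_mul,
      ← ENNReal.ofReal_mul (lapRatio_pos ..).le, lapRatio, lapRatio, mul_assoc,
      mul_left_comm (Real.exp ((|r - m'| - |r - m|) / b₀)), ← Real.exp_add, ← Real.exp_add]
    have : r - m' - (y - m') = r - m - (y - m) := by ring
    rw [this]
    congr 3
    ring

end Laplace

/-! ### Products, binds and pushforwards of measurable families of measures -/

section Families

open Set

theorem pi_withDensity {ι : Type*} [Fintype ι] {α : ι → Type*} [∀ i, MeasurableSpace (α i)]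
    (μ : ∀ i, Measure (α i)) [∀ i, IsProbabilityMeasure (μ i)] {f : ∀ i, α i → ENNReal}
    (hf : ∀ i, Measurable (f i)) [∀ i, SigmaFinite ((μ i).withDensity (f i))] :
    Measure.pi (fun i => (μ i).withDensity (f i)) =
      (Measure.pi μ).withDensity fun x => ∏ i, f i (x i) := by
  refine Measure.pi_eq fun s hs => ?_
  have hg : ∀ i, Measurable ((s i).indicator (f i)) := fun i => (hf i).indicator (hs i)
  have hind : (univ.pi s).indicator (fun x => ∏ i, f i (x i)) =
      fun x => ∏ i, (s i).indicator (f i) (x i) := by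
    funext x
    by_cases hx : x ∈ univ.pi s
    · rw [indicator_of_mem hx]
      exact Finset.prod_congr rfl fun i _ => (indicator_of_mem (hx i (mem_univ i)) _).symm
    · rw [indicator_of_notMem hx]
      simp only [mem_pi, mem_univ, true_implies, not_forall] at hx
      obtain ⟨i, hi⟩ := hx
      exact (Finset.prod_eq_zero (Finset.mem_univ i) (indicator_of_notMem hi _)).symm
  have hprod := ProbabilityTheory.lintegral_prod_eq_prod_lintegral_of_indepFun
    (μ := Measure.pi μ) Finset.univ (fun i (x : ∀ i, α i) => (s i).indicator (f i) (x i))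
    (ProbabilityTheory.iIndepFun_pi fun i => (hg i).aemeasurable)
    (fun i => (hg i).comp (measurable_pi_apply i))
  rw [withDensity_apply _ (MeasurableSet.univ_pi hs),
    ← lintegral_indicator (MeasurableSet.univ_pi hs), hind, hprod]
  refine Finset.prod_congr rfl fun i _ => ?_
  rw [(measurePreserving_eval μ i).lintegral_comp (hg i), lintegral_indicator (hs i),
    withDensity_apply _ (hs i)]

variable {Ω : Type*} [MeasurableSpace Ω]

theorem measurable_measure_pi {ι : Type*} [Fintype ι] {α : ι → Type*}
    [∀ i, MeasurableSpace (α i)] {μ : Ω → ∀ i, Measure (α i)} [∀ ω i, IsFiniteMeasure (μ ω i)]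
    (h : ∀ i, Measurable fun ω => μ ω i) : Measurable fun ω => Measure.pi (μ ω) := by
  have hpi : ∀ s : ∀ i, Set (α i), (∀ i, MeasurableSet (s i)) →
      Measurable fun ω => Measure.pi (μ ω) (univ.pi s) := by
    intro s hs
    simp_rw [Measure.pi_pi]
    exact Finset.measurable_fun_prod _ fun i _ => (Measure.measurable_coe (hs i)).comp (h i)
  refine Measurable.measure_of_isPiSystem generateFrom_pi.symm isPiSystem_pi ?_ ?_
  · rintro _ ⟨s, hs, rfl⟩
    exact hpi s fun i => hs i (mem_univ i)
  · simpa using hpi (fun _ => univ) fun _ => MeasurableSet.univ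

/-- A measurable family of measures of total mass at most one. Noise with an invalid scale has
mass zero, so this is what the building blocks of the system satisfy for all parameters. -/
structure IsSubMarkov {β : Type*} [MeasurableSpace β] (κ : Ω → Measure β) : Prop where
  measurable : Measurable κ
  le_one : ∀ ω, κ ω univ ≤ 1

namespace IsSubMarkov

variable {β γ : Type*} [MeasurableSpace β] [MeasurableSpace γ] {κ : Ω → Measure β}

theorem isFiniteMeasure (h : IsSubMarkov κ) (ω : Ω) : IsFiniteMeasure (κ ω) :=
  ⟨(h.le_one ω).trans_lt ENNReal.one_lt_top⟩

theorem comp {Ω' : Type*} [MeasurableSpace Ω'] (h : IsSubMarkov κ) {g : Ω' → Ω}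
    (hg : Measurable g) : IsSubMarkov fun ω => κ (g ω) :=
  ⟨h.measurable.comp hg, fun _ => h.le_one _⟩

theorem measurable_bind (h : IsSubMarkov κ) {f : Ω → β → Measure γ}
    (hf : Measurable fun p : Ω × β => f p.1 p.2) :
    Measurable fun ω => (κ ω).bind (f ω) := by
  let K : ProbabilityTheory.Kernel Ω β := ⟨κ, h.measurable⟩
  have : ProbabilityTheory.IsFiniteKernel K := ⟨⟨1, ENNReal.one_lt_top, h.le_one⟩⟩
  refine Measure.measurable_of_measurable_coe _ fun S hS => ?_
  have heq : (fun ω => (κ ω).bind (f ω) S) = fun ω => ∫⁻ b, f ω b S ∂(K ω) := by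
    funext ω
    exact Measure.bind_apply hS (hf.comp measurable_prodMk_left).aemeasurable
  rw [heq]
  exact Measurable.lintegral_kernel_prod_right' (κ := K)
    (f := fun p : Ω × β => f p.1 p.2 S) ((Measure.measurable_coe hS).comp hf)

theorem bind (h : IsSubMarkov κ) {f : Ω → β → Measure γ}
    (hf : IsSubMarkov fun p : Ω × β => f p.1 p.2) : IsSubMarkov fun ω => (κ ω).bind (f ω) := by
  refine ⟨h.measurable_bind hf.measurable, fun ω => ?_⟩
  have hfω : Measurable (f ω) := hf.measurable.comp measurable_prodMk_left
  rw [Measure.bind_apply MeasurableSet.univ hfω.aemeasurable]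
  calc ∫⁻ b, f ω b univ ∂(κ ω) ≤ ∫⁻ _, 1 ∂(κ ω) := lintegral_mono fun b => hf.le_one (ω, b)
    _ ≤ 1 := by simpa using h.le_one ω

theorem dirac {g : Ω → β} (hg : Measurable g) : IsSubMarkov fun ω => Measure.dirac (g ω) :=
  ⟨Measure.measurable_dirac.comp hg, fun _ => by simp⟩

theorem map (h : IsSubMarkov κ) {g : Ω → β → γ} (hg : Measurable fun p : Ω × β => g p.1 p.2) :
    IsSubMarkov fun ω => (κ ω).map (g ω) := by
  have heq : (fun ω => (κ ω).map (g ω)) =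
      fun ω => (κ ω).bind fun b => Measure.dirac (g ω b) := by
    funext ω
    exact (Measure.bind_dirac_eq_map _ (hg.comp measurable_prodMk_left)).symm
  rw [heq]
  exact h.bind (dirac hg)

theorem pi {ι : Type*} [Fintype ι] {α : ι → Type*} [∀ i, MeasurableSpace (α i)]
    {μ : Ω → ∀ i, Measure (α i)} (h : ∀ i, IsSubMarkov fun ω => μ ω i) :
    IsSubMarkov fun ω => Measure.pi (μ ω) := by
  have : ∀ ω i, IsFiniteMeasure (μ ω i) := fun ω i => (h i).isFiniteMeasure ω
  refine ⟨measurable_measure_pi fun i => (h i).measurable, fun ω => ?_⟩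
  rw [Measure.pi_univ]
  exact Finset.prod_le_one' fun i _ => (h i).le_one ω

theorem ite {κ' : Ω → Measure β} {p : Ω → Prop} [DecidablePred p]
    (hp : MeasurableSet {ω | p ω}) (h : IsSubMarkov κ) (h' : IsSubMarkov κ') :
    IsSubMarkov fun ω => if p ω then κ ω else κ' ω :=
  ⟨Measurable.ite hp h.measurable h'.measurable, fun ω => by
    split_ifs
    exacts [h.le_one ω, h'.le_one ω]⟩

end IsSubMarkov

/-! ### Measurable functions with countably many values -/

/-- All level sets of `g` are measurable. For a countable codomain this is measurability with
respect to the discrete σ-algebra, without installing the latter on types of finite sets, lists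
and options. -/
def LevelMeasurable {ι : Type*} (g : Ω → ι) : Prop := ∀ i, MeasurableSet {ω | g ω = i}

namespace LevelMeasurable

variable {ι ι' : Type*} {β : Type*} [MeasurableSpace β]

theorem const (i : ι) : LevelMeasurable fun _ : Ω => i := fun _ => MeasurableSet.const _

theorem of_measurable [MeasurableSpace ι] [MeasurableSingletonClass ι] {g : Ω → ι}
    (hg : Measurable g) : LevelMeasurable g := fun i => hg (measurableSet_singleton i)

theorem measurable_of_eq [Countable ι] {g : Ω → ι} (hg : LevelMeasurable g) {f : Ω → β}
    (h : ∀ i, ∃ F : Ω → β, Measurable F ∧ ∀ ω, g ω = i → f ω = F ω) : Measurable f := by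
  intro S hS
  choose F hF heq using h
  have : f ⁻¹' S = ⋃ i, {ω | g ω = i} ∩ F i ⁻¹' S := by
    ext ω
    simp only [mem_preimage, mem_iUnion, mem_inter_iff, mem_ofPred_eq]
    exact ⟨fun h => ⟨g ω, rfl, heq _ ω rfl ▸ h⟩, fun ⟨i, hi, h⟩ => heq i ω hi ▸ h⟩
  rw [this]
  exact MeasurableSet.iUnion fun i => (hg i).inter (hF i hS)

/-- Case distinction over the countably many values of `g`. -/
theorem measurable_cases [Countable ι] {g : Ω → ι} (hg : LevelMeasurable g) {F : ι → Ω → β}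
    (hF : ∀ i, Measurable (F i)) : Measurable fun ω => F (g ω) ω :=
  hg.measurable_of_eq fun i => ⟨F i, hF i, fun _ h => by rw [h]⟩

theorem levelMeasurable_cases [Countable ι] {g : Ω → ι} (hg : LevelMeasurable g)
    {F : ι → Ω → ι'} (hF : ∀ i, LevelMeasurable (F i)) :
    LevelMeasurable fun ω => F (g ω) ω := by
  intro j
  have : {ω | F (g ω) ω = j} = ⋃ i, {ω | g ω = i} ∩ {ω | F i ω = j} := by
    ext ω; simp
  rw [this]
  exact MeasurableSet.iUnion fun i => (hg i).inter (hF i j)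

theorem comp [Countable ι] {g : Ω → ι} (hg : LevelMeasurable g) (f : ι → ι') :
    LevelMeasurable fun ω => f (g ω) :=
  hg.levelMeasurable_cases (F := fun i _ => f i) fun i => const (f i)

theorem subMarkov_cases [Countable ι] {g : Ω → ι} (hg : LevelMeasurable g)
    {F : ι → Ω → Measure β} (hF : ∀ i, IsSubMarkov (F i)) : IsSubMarkov fun ω => F (g ω) ω :=
  ⟨hg.measurable_cases fun i => (hF i).measurable, fun ω => (hF _).le_one ω⟩

theorem measurableSet_cases [Countable ι] {g : Ω → ι} (hg : LevelMeasurable g)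
    {p : ι → Ω → Prop} (hp : ∀ i, MeasurableSet {ω | p i ω}) : MeasurableSet {ω | p (g ω) ω} := by
  have : {ω | p (g ω) ω} = ⋃ i, {ω | g ω = i} ∩ {ω | p i ω} := by ext ω; simp
  rw [this]
  exact MeasurableSet.iUnion fun i => (hg i).inter (hp i)

theorem measurableSet [Countable ι] {g : Ω → ι} (hg : LevelMeasurable g) (p : ι → Prop) :
    MeasurableSet {ω | p (g ω)} :=
  hg.measurableSet_cases (p := fun i _ => p i) fun _ => MeasurableSet.const _

theorem pi {κ : Type*} [Countable κ] {g : Ω → κ → ι} (h : ∀ k, LevelMeasurable fun ω => g ω k) :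
    LevelMeasurable g := by
  intro i
  have : {ω | g ω = i} = ⋂ k, {ω | g ω k = i k} := by ext ω; simp [funext_iff]
  rw [this]
  exact MeasurableSet.iInter fun k => h k (i k)

theorem ite {p : Ω → Prop} [DecidablePred p] (hp : MeasurableSet {ω | p ω}) {f g : Ω → ι}
    (hf : LevelMeasurable f) (hg : LevelMeasurable g) :
    LevelMeasurable fun ω => if p ω then f ω else g ω := by
  intro i
  have : {ω | (if p ω then f ω else g ω) = i} =
      ({ω | p ω} ∩ {ω | f ω = i}) ∪ ({ω | p ω}ᶜ ∩ {ω | g ω = i}) := by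
    ext ω
    by_cases h : p ω <;> simp [h]
  rw [this]
  exact (hp.inter (hf i)).union (hp.compl.inter (hg i))

theorem decide {p : Ω → Prop} [DecidablePred p] (hp : MeasurableSet {ω | p ω}) :
    LevelMeasurable fun ω => decide (p ω) := by
  have := ite hp (const true) (const false)
  simpa using this

theorem finset [Countable ι] {g : Ω → Finset ι} (h : ∀ a, MeasurableSet {ω | a ∈ g ω}) :
    LevelMeasurable g := by
  intro S
  have : {ω | g ω = S} = ⋂ a, {ω | a ∈ g ω ↔ a ∈ S} := by ext ω; simp [Finset.ext_iff]
  rw [this]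
  exact MeasurableSet.iInter fun a => (h a).iff (MeasurableSet.const _)

end LevelMeasurable

end Families

/-! ### Measurability of the noise laws -/

section NoiseFamilies

open Set

variable {Ω : Type*} [MeasurableSpace Ω]

theorem measurable_withDensity_volume {f : Ω → ℝ → ENNReal}
    (hf : Measurable fun p : Ω × ℝ => f p.1 p.2) :
    Measurable fun ω => (volume : Measure ℝ).withDensity (f ω) := by
  refine Measure.measurable_of_measurable_coe _ fun S hS => ?_
  simp_rw [withDensity_apply _ hS]
  exact hf.lintegral_prod_right' (ν := volume.restrict S)

theorem isSubMarkov_laplace {b : Ω → ℝ} (hb : Measurable b) :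
    IsSubMarkov fun ω => laplace (b ω) :=
  ⟨measurable_withDensity_volume (by fun_prop), fun _ => laplace_univ_le_one _⟩

theorem measurable_lapNoiseDown {b₀ b η : Ω → ℝ} (hb₀ : Measurable b₀) (hb : Measurable b)
    (hη : Measurable η) : Measurable fun ω => lapNoiseDown (b₀ ω) (b ω) (η ω) := by
  unfold lapNoiseDown
  refine Measurable.add ?_ (measurable_withDensity_volume (by fun_prop))
  refine Measure.measurable_of_measurable_coe _ fun S hS => ?_
  simp only [Measure.smul_apply, smul_eq_mul]
  exact Measurable.mul (by fun_prop)
    ((Measure.measurable_coe hS).comp (Measure.measurable_dirac.comp hη))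

/-- Away from valid pairs of scales the refinement law is replaced by a point mass, as it may
have infinite mass there. -/
theorem isSubMarkov_lapNoiseDown {b₀ b η : Ω → ℝ} (hb₀ : Measurable b₀) (hb : Measurable b)
    (hη : Measurable η) : IsSubMarkov fun ω =>
      if 0 < b ω ∧ b ω ≤ b₀ ω then lapNoiseDown (b₀ ω) (b ω) (η ω) else Measure.dirac 0 := by
  refine ⟨Measurable.ite ?_ (measurable_lapNoiseDown hb₀ hb hη) measurable_const, fun ω => ?_⟩
  · exact (measurableSet_lt measurable_const hb).inter (measurableSet_le hb hb₀)
  · split_ifs with h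
    · exact (isProbabilityMeasure_lapNoiseDown h.1 h.2 _).measure_univ.le
    · simp

theorem nonempty_le_gaussian_cdf (q : ℝ) (hq : q < 1) :
    {z : ℝ | q ≤ ProbabilityTheory.cdf (ProbabilityTheory.gaussianReal 0 1) z}.Nonempty := by
  obtain ⟨z, hz⟩ := ((ProbabilityTheory.tendsto_cdf_atTop
    (ProbabilityTheory.gaussianReal 0 1)).eventually (lt_mem_nhds hq)).exists
  exact ⟨z, hz.le⟩

theorem bddBelow_le_gaussian_cdf (q : ℝ) (hq : 0 < q) :
    BddBelow {z : ℝ | q ≤ ProbabilityTheory.cdf (ProbabilityTheory.gaussianReal 0 1) z} := by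
  obtain ⟨z₀, hz₀⟩ := ((ProbabilityTheory.tendsto_cdf_atBot
    (ProbabilityTheory.gaussianReal 0 1)).eventually (gt_mem_nhds hq)).exists
  refine ⟨z₀, fun z hz => ?_⟩
  by_contra hlt
  exact absurd (ProbabilityTheory.monotone_cdf _ (not_le.1 hlt).le)
    (not_le.2 (hz₀.trans_le hz))

/-- The normal quantile is monotone on `(0, 1)`. Outside `[0, 1]` it takes the junk value `0`, being
the infimum of the whole line or of the empty set. -/
theorem measurable_normalQuantile : Measurable normalQuantile := by
  refine measurable_of_Iic fun z => ?_
  have hlow : ∀ q ≤ 0, normalQuantile q = 0 := by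
    intro q hq
    have : {z : ℝ | q ≤ ProbabilityTheory.cdf (ProbabilityTheory.gaussianReal 0 1) z} = univ :=
      eq_univ_of_forall fun z => hq.trans (ProbabilityTheory.cdf_nonneg _ z)
    rw [normalQuantile, this, Real.sInf_univ]
  have hhigh : ∀ q > 1, normalQuantile q = 0 := by
    intro q hq
    have : {z : ℝ | q ≤ ProbabilityTheory.cdf (ProbabilityTheory.gaussianReal 0 1) z} = ∅ :=
      eq_empty_of_forall_notMem fun z hz =>
        absurd (ProbabilityTheory.cdf_le_one (ProbabilityTheory.gaussianReal 0 1) z)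
          (not_le.2 (hq.trans_le hz))
    rw [normalQuantile, this, Real.sInf_empty]
  have hmono : ∀ q q', 0 < q → q ≤ q' → q' < 1 → normalQuantile q ≤ normalQuantile q' :=
    fun q q' h0 hle h1 => csInf_le_csInf (bddBelow_le_gaussian_cdf q h0)
      (nonempty_le_gaussian_cdf q' h1) fun z hz => hle.trans hz
  have hsplit : normalQuantile ⁻¹' Iic z =
      (Ioo 0 1 ∩ normalQuantile ⁻¹' Iic z) ∪ ((Iic 0 ∪ Ioi 1) ∩ {_q : ℝ | 0 ≤ z}) ∪
        ({1} ∩ {_q : ℝ | normalQuantile 1 ≤ z}) := by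
    ext q
    simp only [mem_preimage, mem_Iic, mem_union, mem_inter_iff, mem_Ioo, mem_Ioi,
      mem_singleton_iff, mem_ofPred_eq]
    rcases le_or_gt q 0 with h0 | h0
    · have h1 : q ≠ 1 := by linarith
      simp [hlow q h0, h0, h0.not_gt, h1]
    · rcases lt_trichotomy q 1 with h1 | h1 | h1
      · simp [h0, h1, h0.not_ge, h1.not_gt, h1.ne]
      · subst h1; simp
      · simp [hhigh q h1, h0, h1, h1.not_gt, h1.ne', h0.not_ge]
  rw [hsplit]
  refine (MeasurableSet.union (OrdConnected.measurableSet ?_)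
    ((measurableSet_Iic.union measurableSet_Ioi).inter (MeasurableSet.const _))).union
    ((measurableSet_singleton 1).inter (MeasurableSet.const _))
  refine ordConnected_of_Ioo fun a ha b hb _ y hy => ?_
  exact ⟨⟨ha.1.1.trans hy.1, hy.2.trans hb.1.2⟩,
    (hmono y b (ha.1.1.trans hy.1) hy.2.le hb.1.2).trans hb.2⟩

end NoiseFamilies

/-! ### Measurability of the cost estimation -/

section CostEstimation

open Set

variable {X : Type u} {Ω : Type*} [MeasurableSpace Ω]
variable {c : Ω → Cache X} {α β b : Ω → ℝ}

theorem measurable_cacheScale (hc : Measurable c) (a : Query X) :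
    Measurable fun ω => cacheScale (c ω) a := ((measurable_pi_apply a).comp hc).fst

theorem measurable_cacheResponse (hc : Measurable c) (a : Query X) :
    Measurable fun ω => cacheResponse (c ω) a := ((measurable_pi_apply a).comp hc).snd.fst

theorem measurable_cacheTime (hc : Measurable c) (a : Query X) :
    Measurable fun ω => cacheTime (c ω) a := ((measurable_pi_apply a).comp hc).snd.snd

theorem measurable_getD_map (hc : Measurable c) (l : List (Query X)) (i : ℕ) :
    Measurable fun ω => (l.map (cacheScale (c ω))).getD i 0 := by
  induction l generalizing i with
  | nil => simp
  | cons a l ih =>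
    cases i with
    | zero => simpa using measurable_cacheScale hc a
    | succ i => simpa using ih i

theorem measurable_find?_map (hc : Measurable c) (hb : Measurable b) (l : List (Query X))
    (d : ℝ) : Measurable fun ω =>
      ((l.map (cacheScale (c ω))).find? fun s => decide (b ω < s)).getD d := by
  induction l with
  | nil => simp
  | cons a l ih =>
    have : (fun ω => (((a :: l).map (cacheScale (c ω))).find? fun s =>
        decide (b ω < s)).getD d) = fun ω => if b ω < cacheScale (c ω) a then cacheScale (c ω) a
          else ((l.map (cacheScale (c ω))).find? fun s => decide (b ω < s)).getD d := by
      funext ω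
      by_cases h : b ω < cacheScale (c ω) a <;> simp [h]
    rw [this]
    exact Measurable.ite (measurableSet_lt hb (measurable_cacheScale hc a))
      (measurable_cacheScale hc a) ih

variable [Fintype X]

theorem mem_cached {c : Cache X} {a : Query X} : a ∈ cached c ↔ 0 < cacheTime c a := by
  simp [cached]

theorem levelMeasurable_cached (hc : Measurable c) : LevelMeasurable fun ω => cached (c ω) :=
  .finset fun a => by
    simp only [mem_cached]
    exact measurableSet_lt measurable_const (measurable_cacheTime hc a)

theorem measurableSet_mem_cached (hc : Measurable c) (a : Query X) :
    MeasurableSet {ω | a ∈ cached (c ω)} :=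
  (levelMeasurable_cached hc).measurableSet (a ∈ ·)

/-- The sorted list depends on the cache only through the finitely many comparisons of scales. -/
theorem levelMeasurable_sortByScale (hc : Measurable c) (S : Finset (Query X)) :
    LevelMeasurable fun ω => sortByScale (c ω) S := by
  classical
  have h : LevelMeasurable fun ω (p : Query X × Query X) =>
      decide (cacheScale (c ω) p.1 ≤ cacheScale (c ω) p.2) :=
    .pi fun p => .decide (measurableSet_le (measurable_cacheScale hc _)
      (measurable_cacheScale hc _))
  convert h.comp fun f => S.toList.mergeSort fun a a' => f (a, a') using 1
  funext ω
  rw [sortByScale]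

variable [DecidableEq X]

theorem mem_freeStrategy {c : Cache X} {A : Finset (Query X)} {b : ℝ} {a : Query X} :
    a ∈ freeStrategy c A b ↔ a ∈ A ∧ a ∈ cached c ∧ cacheScale c a ≤ b := by
  simp [freeStrategy]

theorem levelMeasurable_freeStrategy (hc : Measurable c) (hb : Measurable b)
    (A : Finset (Query X)) : LevelMeasurable fun ω => freeStrategy (c ω) A (b ω) :=
  .finset fun a => by
    simp only [mem_freeStrategy]
    exact (MeasurableSet.const _).inter ((measurableSet_mem_cached hc a).inter
      (measurableSet_le (measurable_cacheScale hc a) hb))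

theorem levelMeasurable_paidStrategy (hc : Measurable c) (hb : Measurable b)
    (A : Finset (Query X)) : LevelMeasurable fun ω => paidStrategy (c ω) A (b ω) :=
  (levelMeasurable_freeStrategy hc hb A).comp fun F => A \ F

theorem isSubMarkov_laplaceVector (A : Finset (Query X)) {scale : Ω → Query X → ℝ}
    (h : ∀ a, Measurable fun ω => scale ω a) :
    IsSubMarkov fun ω => laplaceVector A (scale ω) := by
  unfold laplaceVector
  refine IsSubMarkov.pi fun a => ?_
  split_ifs
  · exact isSubMarkov_laplace (h a)
  · exact .dirac measurable_const

theorem measurable_mcAccept (W A : Finset (Query X)) (hα : Measurable α) (hβ : Measurable β) :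
    Measurable fun p : Ω × (Fin mcSamples → Query X → ℝ) =>
      mcAccept W A (α p.1) (β p.1) p.2 := by
  classical
  refine measurable_to_bool ?_
  have hnorm : ∀ i : Fin mcSamples, MeasurableSet {p : Ω × (Fin mcSamples → Query X → ℝ) |
      α p.1 < ‖(answerMatrix W A).mulVec (p.2 i)‖} := fun i => by
    have hcont : Continuous fun v : Query X → ℝ => ‖(answerMatrix W A).mulVec v‖ :=
      (continuous_const.matrix_mulVec continuous_id).norm
    exact measurableSet_lt (hα.comp measurable_fst)
      (hcont.measurable.comp ((measurable_pi_apply i).comp measurable_snd))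
  have hcard : Measurable fun p : Ω × (Fin mcSamples → Query X → ℝ) =>
      (((Finset.univ.filter fun i => α p.1 < ‖(answerMatrix W A).mulVec (p.2 i)‖).card : ℕ) :
        ℝ) := by
    simp_rw [Finset.card_filter]
    push_cast
    exact Finset.measurable_fun_sum _ fun i _ =>
      Measurable.ite (hnorm i) measurable_const measurable_const
  have hq := measurable_normalQuantile
  have hβ' : Measurable fun p : Ω × (Fin mcSamples → Query X → ℝ) => β p.1 :=
    hβ.comp measurable_fst
  have hset : (fun p : Ω × (Fin mcSamples → Query X → ℝ) =>
      mcAccept W A (α p.1) (β p.1) p.2) ⁻¹' {true} = {p |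
        (fun n : ℝ => n / mcSamples + normalQuantile (1 - β p.1 / 100 / 2) *
          Real.sqrt (n / mcSamples * (1 - n / mcSamples) / mcSamples) + β p.1 / 100 / 2)
        (((Finset.univ.filter fun i => α p.1 < ‖(answerMatrix W A).mulVec (p.2 i)‖).card : ℕ) :
          ℝ) < β p.1} := by
    ext p
    simp only [mcAccept, mem_preimage, mem_singleton_iff, decide_eq_true_eq, mem_ofPred_eq]
  rw [hset]
  refine measurableSet_lt ?_ hβ'
  fun_prop

theorem isSubMarkov_checkAccuracy (W A : Finset (Query X)) (hc : Measurable c)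
    (hα : Measurable α) (hβ : Measurable β) (hb : Measurable b) :
    IsSubMarkov fun ω => checkAccuracy (c ω) W A (α ω) (β ω) (b ω) := by
  classical
  unfold checkAccuracy
  refine IsSubMarkov.map (IsSubMarkov.pi fun _ => isSubMarkov_laplaceVector A fun a => ?_)
    (measurable_mcAccept W A hα hβ)
  exact Measurable.ite ((levelMeasurable_freeStrategy hc hb A).measurableSet (a ∈ ·))
    (measurable_cacheScale hc a) hb

theorem isSubMarkov_ite_bool {γ : Type*} [MeasurableSpace γ] {κ κ' : Ω → Measure γ}
    (h : IsSubMarkov κ) (h' : IsSubMarkov κ') :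
    IsSubMarkov fun p : Ω × Bool => if p.2 then κ p.1 else κ' p.1 :=
  .ite (measurable_snd (measurableSet_singleton true)) (h.comp measurable_fst)
    (h'.comp measurable_fst)

theorem isSubMarkov_listSearch {check : Ω → ℝ → Measure Bool}
    (hcheck : IsSubMarkov fun p : Ω × ℝ => check p.1 p.2) {L : Ω → List ℝ}
    (hL : ∀ i, Measurable fun ω => (L ω).getD i 0) (n lo hi : ℕ) :
    IsSubMarkov fun ω => listSearch (check ω) (L ω) n lo hi := by
  induction n generalizing lo hi with
  | zero => exact .dirac (hL lo)
  | succ n ih =>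
    simp only [listSearch]
    split_ifs
    · exact IsSubMarkov.bind (hcheck.comp (measurable_id.prodMk (hL _)))
        (isSubMarkov_ite_bool (ih _ _) (ih _ _))
    · exact .dirac (hL lo)

theorem isSubMarkov_bisect {check : Ω → ℝ → Measure Bool}
    (hcheck : IsSubMarkov fun p : Ω × ℝ => check p.1 p.2) (n : ℕ) {lo hi : Ω → ℝ}
    (hlo : Measurable lo) (hhi : Measurable hi) :
    IsSubMarkov fun ω => bisect (check ω) n (lo ω) (hi ω) := by
  induction n generalizing lo hi with
  | zero => exact .dirac hlo
  | succ n ih =>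
    have hmid : Measurable fun ω => (lo ω + hi ω) / 2 := by fun_prop
    exact IsSubMarkov.bind (hcheck.comp (measurable_id.prodMk hmid))
      (isSubMarkov_ite_bool (ih hmid hhi) (ih hlo hmid))

theorem measurable_looseNoise (cfg : Config) (W A : Finset (Query X)) (hα : Measurable α)
    (hβ : Measurable β) : Measurable fun ω => looseNoise cfg W A (α ω) (β ω) := by
  unfold looseNoise
  split_ifs
  · exact measurable_const
  · fun_prop

theorem isSubMarkov_estimateNoise (cfg : Config) (W A : Finset (Query X)) (hc : Measurable c)
    (hα : Measurable α) (hβ : Measurable β) :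
    IsSubMarkov fun ω => estimateNoise cfg (c ω) W A (α ω) (β ω) := by
  classical
  have hloose := measurable_looseNoise cfg W A hα hβ
  have hsel : LevelMeasurable fun ω => A.filter fun a =>
      a ∈ cached (c ω) ∧ looseNoise cfg W A (α ω) (β ω) < cacheScale (c ω) a :=
    .finset fun a => by
      simp only [Finset.mem_filter]
      exact (MeasurableSet.const _).inter ((measurableSet_mem_cached hc a).inter
        (measurableSet_lt hloose (measurable_cacheScale hc a)))
  have hlist : LevelMeasurable fun ω => sortByScale (c ω) (A.filter fun a =>
      a ∈ cached (c ω) ∧ looseNoise cfg W A (α ω) (β ω) < cacheScale (c ω) a) :=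
    hsel.levelMeasurable_cases (F := fun S ω => sortByScale (c ω) S)
      fun S => levelMeasurable_sortByScale hc S
  have hcheck : IsSubMarkov fun p : Ω × ℝ =>
      checkAccuracy (c p.1) W A (α p.1) (β p.1) p.2 :=
    isSubMarkov_checkAccuracy W A (hc.comp measurable_fst) (hα.comp measurable_fst)
      (hβ.comp measurable_fst) measurable_snd
  have main := hlist.subMarkov_cases (F := fun (l : List (Query X)) ω =>
    (listSearch (checkAccuracy (c ω) W A (α ω) (β ω))
      (looseNoise cfg W A (α ω) (β ω) :: l.map (cacheScale (c ω)))
      (l.map (cacheScale (c ω))).length 0 (l.map (cacheScale (c ω))).length).bind fun bD =>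
        bisect (checkAccuracy (c ω) W A (α ω) (β ω)) cfg.searchSteps bD
          (max bD (((l.map (cacheScale (c ω))).find? fun s => decide (bD < s)).getD
            (topNoise cfg A)))) fun l => by
    simp only [List.length_map]
    refine IsSubMarkov.bind (isSubMarkov_listSearch hcheck (fun i => ?_) _ _ _) ?_
    · cases i with
      | zero => simpa using hloose
      | succ i => simpa using measurable_getD_map hc l i
    · refine isSubMarkov_bisect (Ω := Ω × ℝ)
        (check := fun p => checkAccuracy (c p.1) W A (α p.1) (β p.1))
        (hcheck.comp ((measurable_fst.comp measurable_fst).prodMk measurable_snd)) _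
        measurable_snd (measurable_snd.max ?_)
      exact measurable_find?_map (hc.comp measurable_fst) measurable_snd l _
  convert main using 1
  funext ω
  unfold estimateNoise
  congr!

end CostEstimation

/-! ### Measurability of the choice of a mechanism -/

section Planning

open Set

variable {X : Type u} [Fintype X] {Ω : Type*} [MeasurableSpace Ω]
variable {c : Ω → Cache X} {b : Ω → ℝ}

theorem mem_timeGroup {c : Cache X} {j : ℕ} {a : Query X} :
    a ∈ timeGroup c j ↔ a ∈ cached c ∧ cacheTime c a = j := by
  simp [timeGroup]

/-- It suffices that `κ` agrees on every level set of `g` with some measurable family, which may behave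
differently elsewhere. -/
theorem LevelMeasurable.subMarkov_of_eq {ι β : Type*} [MeasurableSpace β] [Countable ι]
    {g : Ω → ι} (hg : LevelMeasurable g) {κ : Ω → Measure β}
    (h : ∀ i, ∃ F : Ω → Measure β, IsSubMarkov F ∧ ∀ ω, g ω = i → κ ω = F ω) :
    IsSubMarkov κ := by
  refine ⟨hg.measurable_of_eq fun i => ?_, fun ω => ?_⟩
  · obtain ⟨F, hF, heq⟩ := h i
    exact ⟨F, hF.measurable, heq⟩
  · obtain ⟨F, hF, heq⟩ := h (g ω)
    rw [heq ω rfl]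
    exact hF.le_one ω

/-- `List.argmin` scans the list and compares two values at each step. -/
theorem levelMeasurable_argmin {ι : Type*} [Countable ι] {f : Ω → ι → ℝ}
    (hf : ∀ i, Measurable fun ω => f ω i) (l : List ι) :
    LevelMeasurable fun ω => l.argmin (f ω) := by
  induction l using List.reverseRecOn with
  | nil => exact .const _
  | append_singleton l a ih =>
    simp only [List.argmin_concat]
    refine ih.levelMeasurable_cases (F := fun (o : Option ι) ω =>
      (Option.casesOn o (some a) fun m => if f ω a < f ω m then some a else some m : Option ι)) ?_
    rintro (_ | m)
    · exact .const _
    · exact .ite (measurableSet_lt (hf a) (hf m)) (.const _) (.const _)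

theorem levelMeasurable_filter {ι : Type*} [Countable ι] {p : Ω → ι → Prop}
    [∀ ω i, Decidable (p ω i)] (hp : ∀ i, MeasurableSet {ω | p ω i}) (l : List ι) :
    LevelMeasurable fun ω => l.filter fun i => decide (p ω i) := by
  induction l with
  | nil => exact .const _
  | cons a l ih =>
    simp only [List.filter_cons, decide_eq_true_eq]
    exact .ite (hp a) (ih.comp (a :: ·)) ih

theorem argmin_map {ι κ : Type*} (f : κ → ℝ) (p : ι → κ) (l : List ι) :
    (l.map p).argmin f = (l.argmin fun i => f (p i)).map p := by
  induction l using List.reverseRecOn with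
  | nil => rfl
  | append_singleton l a ih =>
    rw [List.map_append, List.map_singleton, List.argmin_concat, List.argmin_concat, ih]
    cases l.argmin fun i => f (p i) with
    | none => rfl
    | some m =>
      simp only [Option.map_some]
      split_ifs <;> rfl

theorem levelMeasurable_timeGroup (hc : Measurable c) (j : ℕ) :
    LevelMeasurable fun ω => timeGroup (c ω) j :=
  .finset fun a => by
    simp only [mem_timeGroup]
    exact (measurableSet_mem_cached hc a).inter
      (measurable_cacheTime hc a (measurableSet_singleton j))

theorem measurable_groupScale (hc : Measurable c) (j : ℕ) :
    Measurable fun ω => groupScale (c ω) j := by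
  classical
  have := (levelMeasurable_timeGroup hc j).measurable_cases
    (F := fun S ω => if h : S.Nonempty then S.inf' h (cacheScale (c ω)) else 0) fun S => by
      split_ifs with h
      · have := Finset.inf'_induction h (fun a ω => cacheScale (c ω) a) (p := Measurable)
          (fun _ h _ h' => h.inf h') fun a _ => measurable_cacheScale hc a
        convert this using 1
        funext ω
        rw [Finset.inf'_apply]
      · exact measurable_const
  exact this

variable [DecidableEq X]

theorem measurable_mmmCost (hc : Measurable c) (hb : Measurable b) (A : Finset (Query X)) :
    Measurable fun ω => mmmCost (c ω) A (b ω) :=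
  (levelMeasurable_paidStrategy hc hb A).measurable_cases
    (F := fun P ω => (mappedNorm P (buckets A) : ℝ) / b ω) fun _ => by fun_prop

theorem measurable_rpCost (hc : Measurable c) (hb : Measurable b) (j : ℕ) :
    Measurable fun ω => rpCost (c ω) j (b ω) := by
  have hg := measurable_groupScale hc j
  exact (levelMeasurable_timeGroup hc j).measurable_cases
    (F := fun S ω => (rawNorm S : ℝ) / b ω - rawNorm S / groupScale (c ω) j) fun _ => by fun_prop

theorem levelMeasurable_expandStrategy (cfg : Config) (hc : Measurable c) (hb : Measurable b)
    (A : Finset (Query X)) : LevelMeasurable fun ω => expandStrategy cfg (c ω) A (b ω) := by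
  have hloop : ∀ (l : List (Query X)) (E : Finset (Query X)),
      LevelMeasurable fun ω => expandLoop cfg.expandLimit (c ω) A (b ω) l E := by
    intro l
    induction l with
    | nil => exact fun E => .const _
    | cons a l ih =>
      intro E
      simp only [expandLoop]
      have hend : MeasurableSet {ω |
          A.card + cfg.expandLimit ≤ E.card ∨ b ω < cacheScale (c ω) a} :=
        (MeasurableSet.const _).union (measurableSet_lt hb (measurable_cacheScale hc a))
      refine .ite hend (.const _) ?_
      split_ifs
      exacts [ih _, ih _]
  have hsort : LevelMeasurable fun ω => sortByScale (c ω) (cached (c ω) \ A) :=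
    (levelMeasurable_cached hc).levelMeasurable_cases (F := fun C ω => sortByScale (c ω) (C \ A))
      fun C => levelMeasurable_sortByScale hc _
  exact hsort.levelMeasurable_cases
    (F := fun l ω => expandLoop cfg.expandLimit (c ω) A (b ω) l A) fun l => hloop l A

theorem levelMeasurable_rpChoice (hc : Measurable c) (hb : Measurable b) {now : Ω → ℕ}
    (hnow : Measurable now) (A : Finset (Query X)) :
    LevelMeasurable fun ω => rpChoice (c ω) (now ω) A (b ω) := by
  classical
  refine (LevelMeasurable.of_measurable hnow).levelMeasurable_cases
    (F := fun n ω => rpChoice (c ω) n A (b ω)) fun n => ?_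
  have hfilter := levelMeasurable_filter (Ω := Ω) (p := fun ω j => (timeGroup (c ω) j).Nonempty ∧
    A ⊆ timeGroup (c ω) j ∧ 0 < b ω ∧ b ω ≤ groupScale (c ω) j) (fun j =>
      ((levelMeasurable_timeGroup hc j).measurableSet Finset.Nonempty).inter
        (((levelMeasurable_timeGroup hc j).measurableSet (A ⊆ ·)).inter
          ((measurableSet_lt measurable_const hb).inter
            (measurableSet_le hb (measurable_groupScale hc j))))) (List.range n)
  have := hfilter.levelMeasurable_cases
    (F := fun l ω => l.argmin fun j => rpCost (c ω) j (b ω))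
    fun l => levelMeasurable_argmin (fun j => measurable_rpCost hc hb j) l
  convert this using 1
  funext ω
  unfold rpChoice
  congr!

theorem rpChoice_eq_some {c : Cache X} {now : ℕ} {A : Finset (Query X)} {b : ℝ} {j : ℕ}
    (h : rpChoice c now A b = some j) :
    (timeGroup c j).Nonempty ∧ A ⊆ timeGroup c j ∧ 0 < b ∧ b ≤ groupScale c j := by
  classical
  have := List.argmin_mem (Option.mem_def.2 h)
  simpa using (List.mem_filter.1 this).2

/-- The candidate mechanisms of a round: `inl j` is RP on the cached strategy with time stamp `j`,
`inr false` is MMM, and `inr true` is MMM with the expanded strategy. -/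
def candidate (A Ae : Finset (Query X)) (b₁ b₂ b₃ : ℝ) : ℕ ⊕ Bool → Plan X
  | .inl j => .rp A j b₂
  | .inr false => .mmm A b₁
  | .inr true => .mmm Ae b₃

/-- The available candidates, given the time stamp selected for RP, if any. -/
def candidates (cfg : Config) (o : Option ℕ) : List (ℕ ⊕ Bool) :=
  [.inr false] ++ o.toList.map .inl ++ if cfg.useSE then [.inr true] else []

/-- The candidate of least cost. -/
noncomputable def bestCandidate (cfg : Config) (c : Cache X) (now : ℕ) (A Ae : Finset (Query X))
    (b₁ b₂ b₃ : ℝ) : ℕ ⊕ Bool :=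
  ((candidates cfg (rpChoice c now A b₂)).argmin
    fun i => (candidate A Ae b₁ b₂ b₃ i).cost c).getD (.inr false)

theorem choosePlan_eq_candidate (cfg : Config) (c : Cache X) (now : ℕ)
    (A Ae : Finset (Query X)) (b₁ b₂ b₃ : ℝ) :
    choosePlan cfg c now A Ae b₁ b₂ b₃ =
      candidate A Ae b₁ b₂ b₃ (bestCandidate cfg c now A Ae b₁ b₂ b₃) := by
  have hlist : ([.mmm A b₁] ++ ((rpChoice c now A b₂).toList.map fun j => .rp A j b₂) ++
      (if cfg.useSE then [.mmm Ae b₃] else []) : List (Plan X)) =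
      (candidates cfg (rpChoice c now A b₂)).map (candidate A Ae b₁ b₂ b₃) := by
    unfold candidates
    cases rpChoice c now A b₂ <;> cases cfg.useSE <;> rfl
  simp only [choosePlan, bestCandidate]
  rw [hlist, argmin_map]
  cases (candidates cfg (rpChoice c now A b₂)).argmin
    fun i => (candidate A Ae b₁ b₂ b₃ i).cost c <;> rfl

theorem rpChoice_eq_of_bestCandidate {cfg : Config} {c : Cache X} {now : ℕ}
    {A Ae : Finset (Query X)} {b₁ b₂ b₃ : ℝ} {j : ℕ}
    (h : bestCandidate cfg c now A Ae b₁ b₂ b₃ = .inl j) : rpChoice c now A b₂ = some j := by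
  unfold bestCandidate at h
  cases ho : (candidates cfg (rpChoice c now A b₂)).argmin
      fun i => (candidate A Ae b₁ b₂ b₃ i).cost c with
  | none => rw [ho] at h; simp at h
  | some i =>
    rw [ho, Option.getD_some] at h
    subst h
    have := List.argmin_mem (Option.mem_def.2 ho)
    unfold candidates at this
    cases hr : rpChoice c now A b₂ <;> cases hs : cfg.useSE <;> simp_all

theorem measurable_candidate_cost (hc : Measurable c) {b₁ b₂ b₃ : Ω → ℝ} (h₁ : Measurable b₁)
    (h₂ : Measurable b₂) (h₃ : Measurable b₃) (A Ae : Finset (Query X)) :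
    ∀ i, Measurable fun ω => (candidate A Ae (b₁ ω) (b₂ ω) (b₃ ω) i).cost (c ω)
  | .inl j => measurable_rpCost hc h₂ j
  | .inr false => measurable_mmmCost hc h₁ A
  | .inr true => measurable_mmmCost hc h₃ Ae

theorem levelMeasurable_bestCandidate (cfg : Config) (hc : Measurable c) {now : Ω → ℕ}
    (hnow : Measurable now) {b₁ b₂ b₃ : Ω → ℝ} (h₁ : Measurable b₁)
    (h₂ : Measurable b₂) (h₃ : Measurable b₃) (A Ae : Finset (Query X)) :
    LevelMeasurable fun ω =>
      bestCandidate cfg (c ω) (now ω) A Ae (b₁ ω) (b₂ ω) (b₃ ω) :=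
  (levelMeasurable_rpChoice hc h₂ hnow A).levelMeasurable_cases
    (F := fun o ω => ((candidates cfg o).argmin
      fun i => (candidate A Ae (b₁ ω) (b₂ ω) (b₃ ω) i).cost (c ω)).getD (.inr false))
    fun _ => (levelMeasurable_argmin (measurable_candidate_cost hc h₁ h₂ h₃ A Ae) _).comp
      fun o => o.getD (.inr false)

end Planning

/-! ### Measurability of a round -/

section Round

open Set

theorem measurable_state {X : Type u} {Ω : Type*} [MeasurableSpace Ω] {f : Ω → State X}
    (h₁ : Measurable fun ω => (f ω).round) (h₂ : Measurable fun ω => (f ω).consumed)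
    (h₃ : Measurable fun ω => (f ω).cache) (h₄ : Measurable fun ω => (f ω).transcript) :
    Measurable f :=
  measurable_comap_iff.2 (h₁.prodMk (h₂.prodMk (h₃.prodMk h₄)))

theorem measurable_state_fields (X : Type u) :
    Measurable fun s : State X => (s.round, s.consumed, s.cache, s.transcript) :=
  comap_measurable _

theorem measurable_state_round (X : Type u) : Measurable (State.round : State X → ℕ) :=
  (measurable_state_fields X).fst

theorem measurable_state_consumed (X : Type u) : Measurable (State.consumed : State X → ℝ) :=
  (measurable_state_fields X).snd.fst

theorem measurable_state_cache (X : Type u) : Measurable (State.cache : State X → Cache X) :=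
  (measurable_state_fields X).snd.snd.fst

theorem measurable_state_transcript (X : Type u) :
    Measurable (State.transcript : State X → Transcript X) :=
  (measurable_state_fields X).snd.snd.snd

variable {X : Type u} {Ω : Type*} [MeasurableSpace Ω]

theorem measurable_advance {s : Ω → State X} {c : Ω → Cache X} {ε : Ω → ℝ} {r : Ω → Response X}
    (hs : Measurable s) (hc : Measurable c) (hε : Measurable ε) (hr : Measurable r) :
    Measurable fun ω => (s ω).advance (c ω) (ε ω) (r ω) := by
  have hround := (measurable_state_round X).comp hs
  have htr := (measurable_state_transcript X).comp hs
  refine measurable_state (hround.add_const 1)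
    (((measurable_state_consumed X).comp hs).add hε) hc ?_
  refine measurable_pi_lambda _ fun n => ?_
  have : (fun ω => ((s ω).advance (c ω) (ε ω) (r ω)).transcript n) =
      fun ω => if n = (s ω).round then r ω else (s ω).transcript n := by
    funext ω
    simp [State.advance, Function.update_apply]
  rw [this]
  refine Measurable.ite ?_ hr ((measurable_pi_apply n).comp htr)
  exact measurableSet_eq_fun measurable_const hround

variable [DecidableEq X] {c : Ω → Cache X} {b : Ω → ℝ} {now : Ω → ℕ}

theorem measurable_updateCache (hc : Measurable c) (hb : Measurable b) {y : Ω → Query X → ℝ}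
    (hy : Measurable y) (hnow : Measurable now) (P : Finset (Query X)) :
    Measurable fun ω => updateCache (c ω) P (b ω) (y ω) (now ω) := by
  refine measurable_pi_lambda _ fun a => ?_
  simp only [updateCache]
  split_ifs
  · exact hb.prodMk (((measurable_pi_apply a).comp hy).prodMk hnow)
  · exact (measurable_pi_apply a).comp hc

theorem measurable_refresh (D : Multiset X) (hc : Measurable c) (hb : Measurable b)
    (hnow : Measurable now) (P : Finset (Query X)) :
    Measurable fun p : Ω × (Query X → ℝ) =>
      updateCache (c p.1) P (b p.1) (fun a => trueCount D a + p.2 a) (now p.1) :=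
  measurable_updateCache (hc.comp measurable_fst) (hb.comp measurable_fst)
    (measurable_pi_lambda _ fun a =>
      ((measurable_pi_apply a).comp measurable_snd).const_add _) (hnow.comp measurable_fst) P

variable [Fintype X]

theorem measurable_workloadAnswer (hc : Measurable c) (W A : Finset (Query X)) :
    Measurable fun ω => workloadAnswer (c ω) W A := by
  have hcont : Continuous fun v : Query X → ℝ => (answerMatrix W A).mulVec v :=
    continuous_const.matrix_mulVec continuous_id
  refine hcont.measurable.comp (measurable_pi_lambda _ fun a => ?_)
  split_ifs
  · exact measurable_cacheResponse hc a
  · exact measurable_const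

theorem levelMeasurable_perturbedStrategy (T : StrategyTree X) (cfg : Config) (hc : Measurable c)
    (hb : Measurable b) (A : Finset (Query X)) :
    LevelMeasurable fun ω => perturbedStrategy T cfg (c ω) A (b ω) := by
  classical
  have := (levelMeasurable_cached hc).levelMeasurable_cases
    (F := fun C ω => (fun P => if cfg.usePQ then P ∪ T.searchProactive C P (rawNorm P) else P)
      (paidStrategy (c ω) A (b ω)))
    fun C => (levelMeasurable_paidStrategy hc hb A).comp
      fun P => if cfg.usePQ then P ∪ T.searchProactive C P (rawNorm P) else P
  convert this using 1
  funext ω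
  simp only [perturbedStrategy]

theorem isSubMarkov_runPlan_mmm (T : StrategyTree X) (cfg : Config) (D : Multiset X)
    (hc : Measurable c) (hb : Measurable b) (hnow : Measurable now) (A : Finset (Query X)) :
    IsSubMarkov fun ω => runPlan T cfg D (c ω) (now ω) (.mmm A (b ω)) := by
  refine (levelMeasurable_perturbedStrategy T cfg hc hb A).subMarkov_cases
    (F := fun P ω => (laplaceVector P fun _ => b ω).map fun η =>
        updateCache (c ω) P (b ω) (fun a => trueCount D a + η a) (now ω)) fun P => ?_
  exact (isSubMarkov_laplaceVector P fun _ => hb).map (measurable_refresh D hc hb hnow P)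

/-- Away from valid targets the relaxation is replaced by a point mass. -/
theorem isSubMarkov_runPlan_rp (T : StrategyTree X) (cfg : Config) (D : Multiset X)
    (hc : Measurable c) (hb : Measurable b) (hnow : Measurable now) (A : Finset (Query X))
    (j : ℕ) :
    IsSubMarkov fun ω => if 0 < b ω ∧ b ω ≤ groupScale (c ω) j then
      runPlan T cfg D (c ω) (now ω) (.rp A j (b ω)) else Measure.dirac emptyCache := by
  classical
  have hg := measurable_groupScale hc j
  have hvalid : MeasurableSet {ω | 0 < b ω ∧ b ω ≤ groupScale (c ω) j} :=
    (measurableSet_lt measurable_const hb).inter (measurableSet_le hb hg)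
  have main := IsSubMarkov.ite hvalid ((levelMeasurable_timeGroup hc j).subMarkov_cases
    (F := fun A₀ ω => (Measure.pi fun a => if a ∈ A₀ then
        (if 0 < b ω ∧ b ω ≤ groupScale (c ω) j then
          lapNoiseDown (groupScale (c ω) j) (b ω) (cacheResponse (c ω) a - trueCount D a)
          else Measure.dirac 0) else Measure.dirac 0).map fun η =>
        updateCache (c ω) A₀ (b ω) (fun a => trueCount D a + η a) (now ω)) fun A₀ => by
      refine IsSubMarkov.map (IsSubMarkov.pi fun a => ?_) (measurable_refresh D hc hb hnow A₀)
      split_ifs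
      · exact isSubMarkov_lapNoiseDown hg hb ((measurable_cacheResponse hc a).sub_const _)
      · exact .dirac measurable_const)
    (IsSubMarkov.dirac (measurable_const (a := emptyCache)))
  convert main using 1
  funext ω
  split_ifs with h
  · simp only [runPlan]
  · rfl

/-- The end of a round is measurable for every measurable way `κ` of updating the cache. -/
theorem isSubMarkov_finish {s : Ω → State X} (hs : Measurable s) {κ : Ω → Measure (Cache X)}
    (hκ : IsSubMarkov κ) {ε : Ω → ℝ} (hε : Measurable ε) (εtotal : ℝ) (W A : Finset (Query X))
    [DecidablePred fun ω => εtotal ≤ ε ω + (s ω).consumed] :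
    IsSubMarkov fun ω => if εtotal ≤ ε ω + (s ω).consumed then
      Measure.dirac ((s ω).advance (s ω).cache 0 (Status.rejected, 0, 0))
    else (κ ω).map fun c =>
      (s ω).advance c (ε ω) (Status.answered, workloadAnswer c W A, ε ω) := by
  refine .ite (measurableSet_le measurable_const
      (hε.add ((measurable_state_consumed X).comp hs)))
    (.dirac (measurable_advance hs ((measurable_state_cache X).comp hs) measurable_const
      measurable_const)) (hκ.map (measurable_advance (hs.comp measurable_fst) measurable_snd
      (hε.comp measurable_fst) (measurable_const.prodMk
        ((measurable_workloadAnswer measurable_snd W A).prodMk (hε.comp measurable_fst)))))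

/-- The level sets of the chosen candidate reduce the claim to each mechanism separately; RP is only
chosen with a valid target, so that its guarded form applies. -/
theorem isSubMarkov_finishRound_choosePlan (T : StrategyTree X) (cfg : Config) (εtotal : ℝ)
    (D : Multiset X) {s : Ω → State X} (hs : Measurable s) {b₁ b₂ b₃ : Ω → ℝ}
    (h₁ : Measurable b₁) (h₂ : Measurable b₂) (h₃ : Measurable b₃) (W A Ae : Finset (Query X)) :
    IsSubMarkov fun ω => finishRound T cfg εtotal D (s ω) W
      (choosePlan cfg (s ω).cache ((s ω).round + 1) A Ae (b₁ ω) (b₂ ω) (b₃ ω)) := by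
  classical
  have hc := (measurable_state_cache X).comp hs
  have hnow : Measurable fun ω => (s ω).round + 1 :=
    ((measurable_state_round X).comp hs).add_const 1
  simp only [choosePlan_eq_candidate]
  refine (levelMeasurable_bestCandidate cfg hc hnow h₁ h₂ h₃ A Ae).subMarkov_of_eq fun i => ?_
  have hcost := measurable_candidate_cost hc h₁ h₂ h₃ A Ae i
  match i with
  | .inr false =>
    refine ⟨_, isSubMarkov_finish hs (isSubMarkov_runPlan_mmm T cfg D hc h₁ hnow A) hcost
      εtotal W A, fun ω hω => ?_⟩
    simp only [Function.comp_apply] at hω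
    simp only [hω, finishRound, candidate, Plan.strategy]
    congr!
  | .inr true =>
    refine ⟨_, isSubMarkov_finish hs (isSubMarkov_runPlan_mmm T cfg D hc h₃ hnow Ae) hcost
      εtotal W Ae, fun ω hω => ?_⟩
    simp only [Function.comp_apply] at hω
    simp only [hω, finishRound, candidate, Plan.strategy]
    congr!
  | .inl j =>
    refine ⟨_, isSubMarkov_finish hs (isSubMarkov_runPlan_rp T cfg D hc h₂ hnow A j) hcost
      εtotal W A, fun ω hω => ?_⟩
    simp only [Function.comp_apply] at hω
    have hvalid := (rpChoice_eq_some (rpChoice_eq_of_bestCandidate hω)).2.2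
    simp only [hω, finishRound, candidate, Plan.strategy, Function.comp_apply, if_pos hvalid]

/-- A round in which the workload `W` is submitted. -/
noncomputable def answerRound (T : StrategyTree X) (cfg : Config) (εtotal : ℝ) (D : Multiset X)
    (W : Finset (Query X)) (α β : ℝ) (s : State X) : Measure (State X) :=
  (estimateNoise cfg s.cache W (T.instantStrategy W) α β).bind fun b₁ =>
  (estimateNoise cfg emptyCache W (T.instantStrategy W) α β).bind fun b₂ =>
  (estimateNoise cfg s.cache W (expandStrategy cfg s.cache (T.instantStrategy W) b₁) α β).bind
    fun b₃ => finishRound T cfg εtotal D s W (choosePlan cfg s.cache (s.round + 1)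
      (T.instantStrategy W) (expandStrategy cfg s.cache (T.instantStrategy W) b₁) b₁ b₂ b₃)

theorem step_eq (T : StrategyTree X) (cfg : Config) (εtotal : ℝ) (an : Analyst X)
    (D : Multiset X) (s : State X) :
    step T cfg εtotal an D s = (an.workload s.transcript).elim (Measure.dirac s) fun W =>
      answerRound T cfg εtotal D W (an.α s.transcript) (an.β s.transcript) s := by
  simp only [step, Analyst.next]
  cases an.workload s.transcript <;> rfl

theorem isSubMarkov_finish_stage (T : StrategyTree X) (cfg : Config) (εtotal : ℝ)
    (D : Multiset X) {s : Ω → State X} (hs : Measurable s) {b₁ b₂ b₃ : Ω → ℝ}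
    (h₁ : Measurable b₁) (h₂ : Measurable b₂) (h₃ : Measurable b₃) (W A : Finset (Query X)) :
    IsSubMarkov fun ω => finishRound T cfg εtotal D (s ω) W
      (choosePlan cfg (s ω).cache ((s ω).round + 1) A
        (expandStrategy cfg (s ω).cache A (b₁ ω)) (b₁ ω) (b₂ ω) (b₃ ω)) :=
  (levelMeasurable_expandStrategy cfg ((measurable_state_cache X).comp hs) h₁ A).subMarkov_cases
    (F := fun Ae ω => finishRound T cfg εtotal D (s ω) W
      (choosePlan cfg (s ω).cache ((s ω).round + 1) A Ae (b₁ ω) (b₂ ω) (b₃ ω)))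
    fun Ae => isSubMarkov_finishRound_choosePlan T cfg εtotal D hs h₁ h₂ h₃ W A Ae

theorem isSubMarkov_expanded_stage (T : StrategyTree X) (cfg : Config) (εtotal : ℝ)
    (D : Multiset X) {s : Ω → State X} (hs : Measurable s) {α β b₁ b₂ : Ω → ℝ}
    (hα : Measurable α) (hβ : Measurable β) (h₁ : Measurable b₁) (h₂ : Measurable b₂)
    (W A : Finset (Query X)) :
    IsSubMarkov fun ω => (estimateNoise cfg (s ω).cache W
        (expandStrategy cfg (s ω).cache A (b₁ ω)) (α ω) (β ω)).bind fun b₃ =>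
      finishRound T cfg εtotal D (s ω) W (choosePlan cfg (s ω).cache ((s ω).round + 1) A
        (expandStrategy cfg (s ω).cache A (b₁ ω)) (b₁ ω) (b₂ ω) b₃) := by
  have hc := (measurable_state_cache X).comp hs
  refine IsSubMarkov.bind ((levelMeasurable_expandStrategy cfg hc h₁ A).subMarkov_cases
    (F := fun Ae ω => estimateNoise cfg (s ω).cache W Ae (α ω) (β ω))
    fun Ae => isSubMarkov_estimateNoise cfg W Ae hc hα hβ) ?_
  exact isSubMarkov_finish_stage T cfg εtotal D (hs.comp measurable_fst)
    (h₁.comp measurable_fst) (h₂.comp measurable_fst) measurable_snd W A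

theorem isSubMarkov_answerRound (T : StrategyTree X) (cfg : Config) (εtotal : ℝ)
    (D : Multiset X) (W : Finset (Query X)) {s : Ω → State X} (hs : Measurable s)
    {α β : Ω → ℝ} (hα : Measurable α) (hβ : Measurable β) :
    IsSubMarkov fun ω => answerRound T cfg εtotal D W (α ω) (β ω) (s ω) := by
  have hc := (measurable_state_cache X).comp hs
  refine IsSubMarkov.bind (isSubMarkov_estimateNoise cfg W _ hc hα hβ) ?_
  refine IsSubMarkov.bind (isSubMarkov_estimateNoise cfg W _ measurable_const
    (hα.comp measurable_fst) (hβ.comp measurable_fst)) ?_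
  have h11 : Measurable fun p : (Ω × ℝ) × ℝ => p.1.1 := measurable_fst.comp measurable_fst
  exact isSubMarkov_expanded_stage T cfg εtotal D (hs.comp h11) (hα.comp h11) (hβ.comp h11)
    (measurable_snd.comp measurable_fst) measurable_snd W _

theorem isSubMarkov_step (T : StrategyTree X) (cfg : Config) (εtotal : ℝ) (an : Analyst X)
    (D : Multiset X) : IsSubMarkov (step T cfg εtotal an D) := by
  have htr := measurable_state_transcript X
  have hw : LevelMeasurable fun s : State X => an.workload s.transcript :=
    fun W => htr (an.measurable_workload W)
  have := hw.subMarkov_cases (F := fun o s => o.elim (Measure.dirac s) fun W =>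
    answerRound T cfg εtotal D W (an.α s.transcript) (an.β s.transcript) s) fun o => by
      cases o with
      | none => exact .dirac measurable_id
      | some W =>
        exact isSubMarkov_answerRound T cfg εtotal D W measurable_id
          (an.measurable_α.comp htr) (an.measurable_β.comp htr)
  convert this using 1
  funext s
  exact step_eq T cfg εtotal an D s

end Round

/-! ### Probability laws supported on a set -/

section Laws

open Set

/-- A probability measure under which `p` holds almost surely. -/
structure IsLawOn {β : Type*} [MeasurableSpace β] (μ : Measure β) (p : β → Prop) : Prop where
  isProbabilityMeasure : IsProbabilityMeasure μ
  ae : ∀ᵐ b ∂μ, p b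

namespace IsLawOn

variable {β γ : Type*} [MeasurableSpace β] [MeasurableSpace γ] {μ : Measure β} {p : β → Prop}
  {q : γ → Prop}

theorem of_forall (h : IsProbabilityMeasure μ) (hp : ∀ b, p b) : IsLawOn μ p :=
  ⟨h, ae_of_all _ hp⟩

theorem dirac {b : β} (hp : MeasurableSet {b | p b}) (hb : p b) : IsLawOn (Measure.dirac b) p :=
  ⟨inferInstance, (ae_dirac_iff hp).2 hb⟩

theorem bind (h : IsLawOn μ p) {f : β → Measure γ} (hf : Measurable f)
    (hq : MeasurableSet {c | q c}) (hfq : ∀ b, p b → IsLawOn (f b) q) :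
    IsLawOn (μ.bind f) q := by
  have := h.isProbabilityMeasure
  refine ⟨⟨?_⟩, ?_⟩
  · rw [Measure.bind_apply MeasurableSet.univ hf.aemeasurable]
    have : ∫⁻ b, f b univ ∂μ = ∫⁻ _, 1 ∂μ := by
      refine lintegral_congr_ae ?_
      filter_upwards [h.ae] with b hb
      exact (hfq b hb).isProbabilityMeasure.measure_univ
    rw [this]
    simp
  · rw [ae_iff]
    have hq' : MeasurableSet {c | ¬ q c} := hq.compl
    rw [Measure.bind_apply hq' hf.aemeasurable]
    have : ∫⁻ b, f b {c | ¬ q c} ∂μ = ∫⁻ _, 0 ∂μ := by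
      refine lintegral_congr_ae ?_
      filter_upwards [h.ae] with b hb
      exact ae_iff.1 (hfq b hb).ae
    rw [this]
    simp

theorem map (h : IsLawOn μ p) {f : β → γ} (hf : Measurable f) (hq : MeasurableSet {c | q c})
    (hfq : ∀ b, p b → q (f b)) : IsLawOn (μ.map f) q := by
  have := h.isProbabilityMeasure
  refine ⟨Measure.isProbabilityMeasure_map hf.aemeasurable, ?_⟩
  rw [ae_map_iff hf.aemeasurable hq]
  filter_upwards [h.ae] with b hb using hfq b hb

end IsLawOn

end Laws

/-! ### Noise parameters found by the cost estimation -/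

section Positivity

open Set

variable {X : Type u}

/-- The noise parameter `b` is usable for the strategy `A`: it is positive, unless there is
nothing to be perturbed. -/
def Usable (A : Finset (Query X)) (b : ℝ) : Prop := A.Nonempty → 0 < b

theorem Usable.mono {A : Finset (Query X)} {b b' : ℝ} (h : Usable A b) (hb : b ≤ b') :
    Usable A b' := fun hA => (h hA).trans_le hb

theorem measurableSet_usable (A : Finset (Query X)) : MeasurableSet {b | Usable A b} :=
  (MeasurableSet.const A.Nonempty).imp measurableSet_Ioi

theorem mem_sortByScale {c : Cache X} {S : Finset (Query X)} {a : Query X} :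
    a ∈ sortByScale c S ↔ a ∈ S := by
  simp [sortByScale]

section Search

variable {check : ℝ → Measure Bool} {A : Finset (Query X)}

theorem isLawOn_listSearch (hcheck : ∀ b, Usable A b → IsProbabilityMeasure (check b))
    {L : List ℝ} (hL : ∀ b ∈ L, Usable A b) (n lo hi : ℕ) (hlo : lo ≤ hi) (hhi : hi < L.length) :
    IsLawOn (listSearch check L n lo hi) (Usable A) := by
  have hget : ∀ i < L.length, Usable A (L.getD i 0) := fun i hi => by
    rw [List.getD_eq_getElem _ _ hi]
    exact hL _ (List.getElem_mem hi)
  have hd : ∀ i < L.length, IsLawOn (Measure.dirac (L.getD i 0)) (Usable A) := fun i hi =>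
    .dirac (measurableSet_usable A) (hget i hi)
  induction n generalizing lo hi with
  | zero => exact hd lo (hlo.trans_lt hhi)
  | succ n ih =>
    rw [listSearch]
    split_ifs with h
    · refine IsLawOn.bind (p := fun _ => True)
        (.of_forall (hcheck _ (hget _ (by omega))) fun _ => trivial) (measurable_of_countable _)
        (measurableSet_usable A) fun ok _ => ?_
      split_ifs
      · exact ih _ _ (by omega) hhi
      · exact ih _ _ (by omega) (by omega)
    · exact hd lo (hlo.trans_lt hhi)

theorem isLawOn_bisect (hcheck : ∀ b, Usable A b → IsProbabilityMeasure (check b))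
    (n : ℕ) {lo hi : ℝ} (hlo : Usable A lo) (hle : lo ≤ hi) :
    IsLawOn (bisect check n lo hi) (Usable A) := by
  induction n generalizing lo hi with
  | zero => exact .dirac (measurableSet_usable A) hlo
  | succ n ih =>
    have hmid : Usable A ((lo + hi) / 2) := hlo.mono (by linarith)
    refine IsLawOn.bind (p := fun _ => True) (.of_forall (hcheck _ hmid) fun _ => trivial)
      (measurable_of_countable _) (measurableSet_usable A) fun ok _ => ?_
    split_ifs
    · exact ih hmid (by linarith)
    · exact ih hlo (by linarith)

end Search

variable [Fintype X] [DecidableEq X]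

theorem isProbabilityMeasure_laplaceVector {A : Finset (Query X)} {scale : Query X → ℝ}
    (h : ∀ a ∈ A, 0 < scale a) : IsProbabilityMeasure (laplaceVector A scale) := by
  have : ∀ a, IsProbabilityMeasure
      (if a ∈ A then laplace (scale a) else Measure.dirac 0 : Measure ℝ) := fun a => by
    split_ifs with ha
    · exact isProbabilityMeasure_laplace (h a ha)
    · infer_instance
  unfold laplaceVector
  convert Measure.pi.instIsProbabilityMeasure
    (fun a => (if a ∈ A then laplace (scale a) else Measure.dirac 0 : Measure ℝ)) using 1

theorem isProbabilityMeasure_checkAccuracy {c : Cache X} (hc : ∀ a ∈ cached c, 0 < cacheScale c a)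
    (W A : Finset (Query X)) (α β : ℝ) {b : ℝ} (hb : Usable A b) :
    IsProbabilityMeasure (checkAccuracy c W A α β b) := by
  classical
  have : IsProbabilityMeasure (laplaceVector A fun a =>
      if a ∈ freeStrategy c A b then cacheScale c a else b) :=
    isProbabilityMeasure_laplaceVector fun a ha => by
      split_ifs with h
      · exact hc a (mem_freeStrategy.1 h).2.1
      · exact hb ⟨a, ha⟩
  have hm : Measurable (mcAccept W A α β) := by
    have h := measurable_mcAccept (Ω := Unit) W A (α := fun _ => α) (β := fun _ => β)
      measurable_const measurable_const
    exact Measurable.of_uncurry_left (f := fun _ : Unit => mcAccept W A α β) h (x := ())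
  have h : IsProbabilityMeasure ((Measure.pi fun _ : Fin mcSamples => laplaceVector A fun a =>
      if a ∈ freeStrategy c A b then cacheScale c a else b).map (mcAccept W A α β)) :=
    Measure.isProbabilityMeasure_map hm.aemeasurable
  convert h using 1
  unfold checkAccuracy
  congr!

/-- If `W A⁺ = 0`, the bound is the upper bound, which is positive because a nonempty row covers a
bucket. -/
theorem usable_looseNoise (cfg : Config) (W : Finset (Query X)) {A : Finset (Query X)}
    (hA : ∀ a ∈ A, a.Nonempty) {α β : ℝ} (hα : 0 < α) (hβ : 0 < β) :
    Usable A (looseNoise cfg W A α β) := by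
  rintro ⟨a, ha⟩
  unfold looseNoise
  split_ifs with h
  · have h1 : (0 : ℝ) < mappedNorm A (buckets A) := by exact_mod_cast mappedNorm_pos ha (hA a ha)
    exact div_pos h1 cfg.budgetPrecision_pos
  · have h1 : 0 < frobeniusNorm (answerMatrix W A) :=
      lt_of_le_of_ne (Real.sqrt_nonneg _) (Ne.symm h)
    positivity

theorem isLawOn_estimateNoise (cfg : Config) {c : Cache X}
    (hc : ∀ a ∈ cached c, 0 < cacheScale c a) (W : Finset (Query X)) {A : Finset (Query X)}
    (hA : ∀ a ∈ A, a.Nonempty) {α β : ℝ} (hα : 0 < α) (hβ : 0 < β) :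
    IsLawOn (estimateNoise cfg c W A α β) (Usable A) := by
  classical
  have hcheck : ∀ b, Usable A b → IsProbabilityMeasure (checkAccuracy c W A α β b) :=
    fun b hb => isProbabilityMeasure_checkAccuracy hc W A α β hb
  have hloose := usable_looseNoise cfg W hA hα hβ
  have hmeas : IsSubMarkov fun p : ℝ × ℝ => checkAccuracy c W A α β p.2 :=
    isSubMarkov_checkAccuracy W A measurable_const measurable_const measurable_const
      measurable_snd
  unfold estimateNoise
  refine IsLawOn.bind (isLawOn_listSearch hcheck ?_ _ _ _ (Nat.zero_le _) (by simp)) ?_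
    (measurableSet_usable A) fun b hb => isLawOn_bisect hcheck _ hb (le_max_left _ _)
  · intro b hb
    rcases List.mem_cons.1 hb with rfl | hb
    · exact hloose
    · obtain ⟨a, ha, rfl⟩ := List.mem_map.1 hb
      have := (Finset.mem_filter.1 (mem_sortByScale.1 ha)).2
      exact hloose.mono this.2.le
  · refine (isSubMarkov_bisect (Ω := ℝ) (check := fun _ => checkAccuracy c W A α β) hmeas _
      measurable_id (measurable_id.max ?_)).measurable
    exact measurable_find?_map (Ω := ℝ) (c := fun _ => c) measurable_const measurable_id _ _

theorem expandStrategy_subset (cfg : Config) (c : Cache X) (A : Finset (Query X)) (b : ℝ) :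
    expandStrategy cfg c A b ⊆ A ∪ cached c := by
  have key : ∀ (l : List (Query X)) (E : Finset (Query X)), (∀ a ∈ l, a ∈ cached c) →
      E ⊆ A ∪ cached c → expandLoop cfg.expandLimit c A b l E ⊆ A ∪ cached c := by
    intro l
    induction l with
    | nil => exact fun E _ hE => hE
    | cons a l ih =>
      intro E hl hE
      have hl' : ∀ a ∈ l, a ∈ cached c := fun a ha => hl a (List.mem_cons_of_mem _ ha)
      rw [expandLoop]
      split_ifs
      · exact hE
      · exact ih _ hl' (Finset.insert_subset
          (Finset.mem_union_right _ (hl a List.mem_cons_self)) hE)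
      · exact ih _ hl' hE
  refine key _ _ (fun a ha => ?_) Finset.subset_union_left
  exact (Finset.mem_sdiff.1 (mem_sortByScale.1 ha)).1

end Positivity

/-! ### Valid states and sound mechanisms -/

section Validity

variable {X : Type u} [Fintype X] [DecidableEq X]

/-- Invariants of the state: the budget is respected, and the cache holds tree nodes with positive
noise parameters, which agree for equal time stamps. -/
structure IsValid (T : StrategyTree X) (εtotal : ℝ) (s : State X) : Prop where
  consumed_le : s.consumed ≤ εtotal
  scale_pos : ∀ a ∈ cached s.cache, 0 < cacheScale s.cache a
  mem_nodes : ∀ a ∈ cached s.cache, a ∈ T.nodes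
  time_le : ∀ a ∈ cached s.cache, cacheTime s.cache a ≤ s.round
  scale_eq : ∀ a ∈ cached s.cache, ∀ a' ∈ cached s.cache,
    cacheTime s.cache a = cacheTime s.cache a' → cacheScale s.cache a = cacheScale s.cache a'

theorem isValid_iff (T : StrategyTree X) (εtotal : ℝ) (s : State X) :
    IsValid T εtotal s ↔ s.consumed ≤ εtotal ∧
      (∀ a, (a ∈ cached s.cache → 0 < cacheScale s.cache a) ∧
        (a ∈ cached s.cache → a ∈ T.nodes) ∧
        (a ∈ cached s.cache → cacheTime s.cache a ≤ s.round) ∧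
        ∀ a', a ∈ cached s.cache → a' ∈ cached s.cache →
          cacheTime s.cache a = cacheTime s.cache a' →
            cacheScale s.cache a = cacheScale s.cache a') :=
  ⟨fun h => ⟨h.1, fun a => ⟨h.2 a, h.3 a, h.4 a, fun a' ha ha' => h.5 a ha a' ha'⟩⟩,
    fun h => ⟨h.1, fun a => (h.2 a).1, fun a => (h.2 a).2.1, fun a => (h.2 a).2.2.1,
      fun a ha a' ha' => (h.2 a).2.2.2 a' ha ha'⟩⟩

theorem measurableSet_forall {Ω ι : Type*} [MeasurableSpace Ω] [Countable ι] {p : ι → Ω → Prop}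
    (h : ∀ i, MeasurableSet {ω | p i ω}) : MeasurableSet {ω | ∀ i, p i ω} := by
  rw [Set.ofPred_forall]
  exact MeasurableSet.iInter h

theorem measurableSet_isValid (T : StrategyTree X) (εtotal : ℝ) :
    MeasurableSet {s | IsValid T εtotal s} := by
  have hc := measurable_state_cache X
  have hmem := fun a => measurableSet_mem_cached hc a
  have hscale := fun a => measurable_cacheScale hc a
  have htime := fun a => measurable_cacheTime hc a
  simp only [isValid_iff]
  refine (measurableSet_le (measurable_state_consumed X) measurable_const).inter ?_
  refine measurableSet_forall fun a => ?_
  refine ((hmem a).imp (measurableSet_lt measurable_const (hscale a))).inter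
    (((hmem a).imp (MeasurableSet.const _)).inter
      (((hmem a).imp (measurableSet_le (htime a) (measurable_state_round X))).inter ?_))
  refine measurableSet_forall fun a' => ?_
  exact (hmem a).imp ((hmem a').imp ((measurableSet_eq_fun (htime a) (htime a')).imp
    (measurableSet_eq_fun (hscale a) (hscale a'))))

theorem isValid_initialState (T : StrategyTree X) {εtotal : ℝ} (hε : 0 ≤ εtotal) :
    IsValid T εtotal (initialState : State X) := by
  have : ∀ a : Query X, a ∉ cached (initialState : State X).cache := fun a => by
    simp [mem_cached, initialState, emptyCache, cacheTime]
  exact ⟨hε, fun a ha => absurd ha (this a), fun a ha => absurd ha (this a),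
    fun a ha => absurd ha (this a), fun a ha => absurd ha (this a)⟩

theorem IsValid.groupScale_eq {T : StrategyTree X} {εtotal : ℝ} {s : State X}
    (h : IsValid T εtotal s) {j : ℕ} {a : Query X} (ha : a ∈ timeGroup s.cache j) :
    groupScale s.cache j = cacheScale s.cache a := by
  unfold groupScale
  rw [dif_pos ⟨a, ha⟩]
  obtain ⟨a', ha', heq⟩ := Finset.exists_mem_eq_inf' ⟨a, ha⟩ (cacheScale s.cache)
  rw [heq]
  rw [mem_timeGroup] at ha ha'
  exact h.scale_eq a' ha'.1 a ha.1 (ha'.2.trans ha.2.symm)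

theorem IsValid.reject {T : StrategyTree X} {εtotal : ℝ} {s : State X}
    (h : IsValid T εtotal s) (r : Response X) : IsValid T εtotal (s.advance s.cache 0 r) :=
  ⟨by simpa [State.advance] using h.consumed_le, h.scale_pos, h.mem_nodes,
    fun a ha => (h.time_le a ha).trans (Nat.le_succ _), h.scale_eq⟩

/-- Entries stored in a new round have a fresh time stamp and a common noise parameter. -/
theorem IsValid.advance_updateCache {T : StrategyTree X} {εtotal : ℝ} {s : State X}
    (h : IsValid T εtotal s) {P : Finset (Query X)} (hP : P ⊆ T.nodes) {b : ℝ} (hb : Usable P b)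
    (y : Query X → ℝ) {ε : ℝ} (hε : s.consumed + ε ≤ εtotal) (r : Response X) :
    IsValid T εtotal (s.advance (updateCache s.cache P b y (s.round + 1)) ε r) := by
  have hin : ∀ a ∈ P, updateCache s.cache P b y (s.round + 1) a = (b, y a, s.round + 1) :=
    fun a ha => by simp [updateCache, ha]
  have hout : ∀ a ∉ P, updateCache s.cache P b y (s.round + 1) a = s.cache a :=
    fun a ha => by simp [updateCache, ha]
  refine ⟨hε, ?_, ?_, ?_, ?_⟩
  · intro a ha
    rw [mem_cached] at ha
    simp only [State.advance, cacheTime, cacheScale] at ha ⊢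
    by_cases haP : a ∈ P
    · rw [hin a haP]; exact hb ⟨a, haP⟩
    · rw [hout a haP] at ha ⊢; exact h.scale_pos a (mem_cached.2 ha)
  · intro a ha
    rw [mem_cached] at ha
    simp only [State.advance, cacheTime] at ha
    by_cases haP : a ∈ P
    · exact hP haP
    · rw [hout a haP] at ha; exact h.mem_nodes a (mem_cached.2 ha)
  · intro a ha
    rw [mem_cached] at ha
    simp only [State.advance, cacheTime] at ha ⊢
    by_cases haP : a ∈ P
    · rw [hin a haP]
    · rw [hout a haP] at ha ⊢
      exact (h.time_le a (mem_cached.2 ha)).trans (Nat.le_succ _)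
  · intro a ha a' ha' heq
    rw [mem_cached] at ha ha'
    simp only [State.advance, cacheTime, cacheScale] at ha ha' heq ⊢
    have hold : ∀ a, 0 < (s.cache a).2.2 → (s.cache a).2.2 ≠ s.round + 1 := fun a ha =>
      (Nat.lt_succ_of_le (h.time_le a (mem_cached.2 ha))).ne
    by_cases haP : a ∈ P <;> by_cases haP' : a' ∈ P
    · rw [hin a haP, hin a' haP']
    · rw [hin a haP, hout a' haP'] at heq
      rw [hout a' haP'] at ha'
      exact absurd heq.symm (hold a' ha')
    · rw [hout a haP, hin a' haP'] at heq
      rw [hout a haP] at ha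
      exact absurd heq (hold a ha)
    · rw [hout a haP] at ha heq ⊢
      rw [hout a' haP'] at ha' heq ⊢
      exact h.scale_eq a (mem_cached.2 ha) a' (mem_cached.2 ha') heq

/-- The plans that the system can choose: MMM through tree nodes with a usable noise parameter, and
RP with a valid refinement of the noise. -/
def Plan.IsSound (T : StrategyTree X) (c : Cache X) : Plan X → Prop
  | .mmm A b => A ⊆ T.nodes ∧ Usable A b
  | .rp _ j b => 0 < b ∧ b ≤ groupScale c j

theorem isSound_choosePlan {T : StrategyTree X} (cfg : Config) (c : Cache X) (now : ℕ)
    {A Ae : Finset (Query X)} {b₁ b₂ b₃ : ℝ} (hA : A ⊆ T.nodes) (hAe : Ae ⊆ T.nodes)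
    (h₁ : Usable A b₁) (h₃ : Usable Ae b₃) :
    (choosePlan cfg c now A Ae b₁ b₂ b₃).IsSound T c := by
  rw [choosePlan_eq_candidate]
  match h : bestCandidate cfg c now A Ae b₁ b₂ b₃ with
  | .inr false => exact ⟨hA, h₁⟩
  | .inr true => exact ⟨hAe, h₃⟩
  | .inl j => exact (rpChoice_eq_some (rpChoice_eq_of_bestCandidate h)).2.2

/-- The queries whose responses are replaced by a plan. -/
noncomputable def Plan.refreshed (T : StrategyTree X) (cfg : Config) (c : Cache X) :
    Plan X → Finset (Query X)
  | .mmm A b => perturbedStrategy T cfg c A b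
  | .rp _ j _ => timeGroup c j

/-- The noise parameter of the new responses of a plan. -/
def Plan.scale : Plan X → ℝ
  | .mmm _ b => b
  | .rp _ _ b => b

/-- The law of the new response to the query `a` under a plan. -/
noncomputable def Plan.responseLaw (D : Multiset X) (c : Cache X) (a : Query X) :
    Plan X → Measure ℝ
  | .mmm _ b => (laplace b).map fun η => trueCount D a + η
  | .rp _ j b => (lapNoiseDown (groupScale c j) b (cacheResponse c a - trueCount D a)).map
      fun η => trueCount D a + η

theorem paidStrategy_subset (c : Cache X) (A : Finset (Query X)) (b : ℝ) :
    paidStrategy c A b ⊆ A := Finset.sdiff_subset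

theorem perturbedStrategy_subset_nodes (T : StrategyTree X) (cfg : Config) (c : Cache X)
    {A : Finset (Query X)} (hA : A ⊆ T.nodes) (b : ℝ) :
    perturbedStrategy T cfg c A b ⊆ T.nodes := by
  have hP := (paidStrategy_subset c A b).trans hA
  simp only [perturbedStrategy]
  split_ifs
  · exact Finset.union_subset hP (T.searchProactive_subset_nodes _ _ _)
  · exact hP

theorem rawNorm_perturbedStrategy_le {k : ℕ} {T : StrategyTree X} (hT : T.IsHierarchical k)
    (cfg : Config) (c : Cache X) {A : Finset (Query X)} (hA : A ⊆ T.nodes) (b : ℝ) :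
    rawNorm (perturbedStrategy T cfg c A b) ≤ rawNorm (paidStrategy c A b) := by
  have hP := (paidStrategy_subset c A b).trans hA
  simp only [perturbedStrategy]
  split_ifs
  · exact hT.rawNorm_union_searchProactive_le _ hP
  · exact le_rfl

theorem eq_empty_of_rawNorm_eq_zero {P : Finset (Query X)} (hP : ∀ a ∈ P, a.Nonempty)
    (h : rawNorm P = 0) : P = ∅ := by
  refine Finset.eq_empty_of_forall_notMem fun a ha => ?_
  obtain ⟨x, hx⟩ := hP a ha
  have h1 := hits_le_rawNorm P x
  have h2 : 0 < StrategyTree.hits P x := Finset.card_pos.2 ⟨a, Finset.mem_filter.2 ⟨ha, hx⟩⟩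
  omega

/-- The empty strategy may come with the noise parameter `0`, for which `laplace` is not a
probability measure; no noise is drawn for it. -/
theorem perturbedStrategy_eq_empty {k : ℕ} {T : StrategyTree X} (hT : T.IsHierarchical k)
    (cfg : Config) (c : Cache X) (b : ℝ) : perturbedStrategy T cfg c ∅ b = ∅ := by
  refine eq_empty_of_rawNorm_eq_zero (fun a ha => hT.nonempty_of_mem_nodes
    (perturbedStrategy_subset_nodes T cfg c (Finset.empty_subset _) b ha)) ?_
  have h := rawNorm_perturbedStrategy_le hT cfg c (Finset.empty_subset _) b
  have h0 : rawNorm (paidStrategy c ∅ b) = 0 := by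
    rw [Finset.subset_empty.1 (paidStrategy_subset c ∅ b)]
    simp [rawNorm]
  omega

theorem Plan.IsSound.refreshed_subset {T : StrategyTree X} {εtotal : ℝ} {s : State X}
    (hs : IsValid T εtotal s) (cfg : Config) {plan : Plan X} (h : plan.IsSound T s.cache) :
    plan.refreshed T cfg s.cache ⊆ T.nodes := by
  cases plan with
  | mmm A b => exact perturbedStrategy_subset_nodes T cfg _ h.1 b
  | rp A j b => exact fun a ha => hs.mem_nodes a (mem_timeGroup.1 ha).1

theorem Plan.IsSound.usable_scale {k : ℕ} {T : StrategyTree X} (hT : T.IsHierarchical k)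
    {c : Cache X} (cfg : Config) {plan : Plan X} (h : plan.IsSound T c) :
    Usable (plan.refreshed T cfg c) plan.scale := by
  cases plan with
  | mmm A b =>
    rintro ⟨a, ha⟩
    refine h.2 (Finset.nonempty_iff_ne_empty.2 ?_)
    rintro rfl
    simp [refreshed, perturbedStrategy_eq_empty hT] at ha
  | rp A j b => exact fun _ => h.1

theorem Plan.IsSound.isProbabilityMeasure_responseLaw {k : ℕ} {T : StrategyTree X}
    (hT : T.IsHierarchical k) (cfg : Config) (D : Multiset X) {c : Cache X} {plan : Plan X}
    (h : plan.IsSound T c) {a : Query X} (ha : a ∈ plan.refreshed T cfg c) :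
    IsProbabilityMeasure (plan.responseLaw D c a) := by
  have hadd : Measurable fun η : ℝ => trueCount D a + η := by fun_prop
  have hb := h.usable_scale hT cfg ⟨a, ha⟩
  cases plan with
  | mmm A b =>
    have : IsProbabilityMeasure (laplace b) := isProbabilityMeasure_laplace hb
    exact Measure.isProbabilityMeasure_map hadd.aemeasurable
  | rp A j b =>
    have := isProbabilityMeasure_lapNoiseDown h.1 h.2 (cacheResponse c a - trueCount D a)
    exact Measure.isProbabilityMeasure_map hadd.aemeasurable

open Classical in
/-- The joint law of the new responses under a plan; coordinates that are not refreshed are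
irrelevant. -/
noncomputable def Plan.responsesLaw (T : StrategyTree X) (cfg : Config) (D : Multiset X)
    (c : Cache X) (plan : Plan X) : Measure (Query X → ℝ) :=
  Measure.pi fun a =>
    if a ∈ plan.refreshed T cfg c then plan.responseLaw D c a else Measure.dirac 0

open Classical in
theorem Plan.IsSound.isProbabilityMeasure_ite {k : ℕ} {T : StrategyTree X}
    (hT : T.IsHierarchical k) (cfg : Config) (D : Multiset X) {c : Cache X} {plan : Plan X}
    (h : plan.IsSound T c) (a : Query X) :
    IsProbabilityMeasure (if a ∈ plan.refreshed T cfg c then plan.responseLaw D c a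
      else Measure.dirac 0) := by
  split_ifs with ha
  · exact h.isProbabilityMeasure_responseLaw hT cfg D ha
  · infer_instance

theorem Plan.IsSound.isProbabilityMeasure_responsesLaw {k : ℕ} {T : StrategyTree X}
    (hT : T.IsHierarchical k) (cfg : Config) (D : Multiset X) {c : Cache X} {plan : Plan X}
    (h : plan.IsSound T c) : IsProbabilityMeasure (plan.responsesLaw T cfg D c) := by
  have := fun a => h.isProbabilityMeasure_ite hT cfg D a
  unfold responsesLaw
  infer_instance

open Classical in
/-- The true answers may be added to the noise before or within the update of the cache, since the
update ignores all coordinates outside `P`. -/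
theorem map_noise_updateCache (D : Multiset X) (c : Cache X) (P : Finset (Query X)) (b : ℝ)
    (now : ℕ) (κ : Query X → Measure ℝ) (hκ : ∀ a ∈ P, IsProbabilityMeasure (κ a)) :
    (Measure.pi fun a => if a ∈ P then κ a else Measure.dirac 0).map
        (fun η => updateCache c P b (fun a => trueCount D a + η a) now) =
      (Measure.pi fun a => if a ∈ P then (κ a).map (fun η => trueCount D a + η)
        else Measure.dirac 0).map fun y => updateCache c P b y now := by
  let f : Query X → ℝ → ℝ := fun a => if a ∈ P then fun η => trueCount D a + η else id
  have hf : ∀ a, Measurable (f a) := fun a => by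
    simp only [f]
    split_ifs
    · fun_prop
    · exact measurable_id
  have hprob : ∀ a, IsProbabilityMeasure
      (if a ∈ P then κ a else Measure.dirac 0 : Measure ℝ) := fun a => by
    split_ifs with ha
    · exact hκ a ha
    · infer_instance
  have hprob' := fun a => Measure.isProbabilityMeasure_map
    (μ := (if a ∈ P then κ a else Measure.dirac 0 : Measure ℝ)) (hf a).aemeasurable
  have hmap := Measure.pi_map_pi (μ := fun a => (if a ∈ P then κ a else Measure.dirac 0 :
    Measure ℝ)) (f := f) fun a => (hf a).aemeasurable
  have hfam : (fun a => if a ∈ P then (κ a).map (fun η => trueCount D a + η)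
        else Measure.dirac 0) =
      fun a => (if a ∈ P then κ a else Measure.dirac 0 : Measure ℝ).map (f a) := by
    funext a
    by_cases ha : a ∈ P
    · simp [f, ha]
    · simp [f, ha]
  have hup : Measurable fun y : Query X → ℝ => updateCache c P b y now :=
    measurable_updateCache measurable_const measurable_const measurable_id measurable_const P
  have hpi : Measurable fun (η : Query X → ℝ) a => f a (η a) :=
    measurable_pi_lambda _ fun a => (hf a).comp (measurable_pi_apply a)
  rw [hfam, ← hmap, Measure.map_map hup hpi]
  congr 1
  funext η a
  by_cases ha : a ∈ P <;> simp [updateCache, f, ha]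

/-- Both mechanisms replace the responses of some queries by new ones of a common scale. -/
theorem Plan.IsSound.runPlan_eq {k : ℕ} {T : StrategyTree X} (hT : T.IsHierarchical k)
    (cfg : Config) (D : Multiset X) {c : Cache X} (now : ℕ) {plan : Plan X}
    (h : plan.IsSound T c) :
    runPlan T cfg D c now plan = (plan.responsesLaw T cfg D c).map
      fun y => updateCache c (plan.refreshed T cfg c) plan.scale y now := by
  classical
  have hb := h.usable_scale hT cfg
  cases plan with
  | mmm A b =>
    have := map_noise_updateCache D c (perturbedStrategy T cfg c A b) b now
      (fun _ => laplace b) fun a ha => isProbabilityMeasure_laplace (hb ⟨a, ha⟩)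
    convert this using 1
    · simp only [runPlan, laplaceVector]
    · simp only [responsesLaw, refreshed, responseLaw, scale]
      congr!
  | rp A j b =>
    have := map_noise_updateCache D c (timeGroup c j) b now
      (fun a => lapNoiseDown (groupScale c j) b (cacheResponse c a - trueCount D a))
      fun a _ => isProbabilityMeasure_lapNoiseDown h.1 h.2 _
    convert this using 1
    · simp only [runPlan]
    · simp only [responsesLaw, refreshed, responseLaw, scale]
      congr!

end Validity

/-! ### Domination of measures by a likelihood ratio -/

section Domination

open Set

/-- `C • μ` has density at most `R` with respect to `ν`. For `C = R s`, where `s` is the state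
before a round, this is the local form of the privacy guarantee. -/
def Dominates {β : Type*} [MeasurableSpace β] (R : β → ENNReal) (C : ENNReal)
    (μ ν : Measure β) : Prop := C • μ ≤ ν.withDensity R

variable {β γ : Type*} [MeasurableSpace β] [MeasurableSpace γ]

theorem Dominates.map {μ ν : Measure β} {f : β → γ} (hf : Measurable f) {R : γ → ENNReal}
    (hR : Measurable R) {C : ENNReal} (h : Dominates (fun b => R (f b)) C μ ν) :
    Dominates R C (μ.map f) (ν.map f) := by
  refine Measure.le_iff.2 fun S hS => ?_
  have := Measure.le_iff.1 h _ (hf hS)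
  rw [Measure.smul_apply, withDensity_apply _ (hf hS)] at this
  rw [Measure.smul_apply, withDensity_apply _ hS, Measure.map_apply hf hS,
    setLIntegral_map hS hR hf]
  exact this

/-- A data-independent choice followed by a dominated law is dominated. -/
theorem Dominates.bind {μ : Measure β} {f g : β → Measure γ} (hf : Measurable f)
    (hg : Measurable g) {R : γ → ENNReal} (hR : Measurable R) {C : ENNReal}
    (h : ∀ᵐ b ∂μ, Dominates R C (f b) (g b)) : Dominates R C (μ.bind f) (μ.bind g) := by
  refine Measure.le_iff.2 fun S hS => ?_
  have hfS : Measurable fun b => f b S := (Measure.measurable_coe hS).comp hf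
  rw [Measure.smul_apply, withDensity_apply _ hS, Measure.bind_apply hS hf.aemeasurable,
    smul_eq_mul, ← lintegral_const_mul _ hfS,
    ← lintegral_indicator hS, Measure.lintegral_bind hg.aemeasurable
      (hR.indicator hS).aemeasurable]
  refine lintegral_mono_ae ?_
  filter_upwards [h] with b hb
  have := Measure.le_iff.1 hb S hS
  rwa [Measure.smul_apply, withDensity_apply _ hS, ← lintegral_indicator hS, smul_eq_mul] at this

theorem dominates_dirac {R : β → ENNReal} (hR : Measurable R) (b : β) :
    Dominates R (R b) (Measure.dirac b) (Measure.dirac b) := by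
  rw [Dominates, dirac_withDensity' hR]

/-- If the state laws have likelihood ratio at most `R` and the transition kernels are locally
dominated, then the laws of the next state have likelihood ratio at most `R`. -/
theorem bind_le_withDensity {μ ν : Measure β} {κ κ' : β → Measure β} (hκ : Measurable κ)
    (hκ' : Measurable κ') {R : β → ENNReal} (hR : Measurable R) (h : μ ≤ ν.withDensity R)
    (hloc : ∀ᵐ b ∂ν, Dominates R (R b) (κ b) (κ' b)) :
    μ.bind κ ≤ (ν.bind κ').withDensity R := by
  refine Measure.le_iff.2 fun S hS => ?_
  have hκS : Measurable fun b => κ b S := (Measure.measurable_coe hS).comp hκ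
  rw [Measure.bind_apply hS hκ.aemeasurable, withDensity_apply _ hS, ← lintegral_indicator hS,
    Measure.lintegral_bind hκ'.aemeasurable (hR.indicator hS).aemeasurable]
  refine (lintegral_mono' h le_rfl).trans ?_
  rw [lintegral_withDensity_eq_lintegral_mul _ hR hκS]
  refine lintegral_mono_ae ?_
  filter_upwards [hloc] with b hb
  have := Measure.le_iff.1 hb S hS
  rwa [Measure.smul_apply, withDensity_apply _ hS, ← lintegral_indicator hS, smul_eq_mul] at this

theorem pi_smul {ι : Type*} [Fintype ι] {α : ι → Type*} [∀ i, MeasurableSpace (α i)]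
    (μ : ∀ i, Measure (α i)) [∀ i, IsProbabilityMeasure (μ i)] (w : ι → ENNReal)
    (hw : ∀ i, w i ≠ ⊤) :
    Measure.pi (fun i => w i • μ i) = (∏ i, w i) • Measure.pi μ := by
  have : ∀ i, IsFiniteMeasure (w i • μ i) := fun i => Measure.smul_finite _ (hw i)
  refine Measure.pi_eq fun s _ => ?_
  rw [Measure.smul_apply, Measure.pi_pi, smul_eq_mul, ← Finset.prod_mul_distrib]
  rfl

end Domination

/-! ### The privacy loss of a state -/

section PrivacyLoss

variable {X : Type u} [DecidableEq X]

theorem Neighbor.exists_forall_count {D D' : Multiset X} (h : Neighbor D D') :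
    ∃ x, ∀ y, |(D.count y : ℝ) - D'.count y| ≤ if y = x then 1 else 0 := by
  obtain ⟨x, hx⟩ := Multiset.card_eq_one.1 h
  refine ⟨x, fun y => ?_⟩
  have hy := congrArg (Multiset.count y) hx
  rw [Multiset.count_union, Multiset.count_sub, Multiset.count_sub, Multiset.count_singleton] at hy
  rw [abs_le]
  split_ifs at hy ⊢ with hyx
  · have h1 : D.count y ≤ D'.count y + 1 := by omega
    have h2 : D'.count y ≤ D.count y + 1 := by omega
    have h1' : (D.count y : ℝ) ≤ D'.count y + 1 := by exact_mod_cast h1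
    have h2' : (D'.count y : ℝ) ≤ D.count y + 1 := by exact_mod_cast h2
    constructor <;> linarith
  · have h1 : D.count y = D'.count y := by omega
    simp [h1]

theorem abs_trueCount_sub_le {D D' : Multiset X} {x : X}
    (h : ∀ y, |(D.count y : ℝ) - D'.count y| ≤ if y = x then 1 else 0) (a : Query X) :
    |trueCount D a - trueCount D' a| ≤ if x ∈ a then 1 else 0 := by
  unfold trueCount
  rw [← Finset.sum_sub_distrib]
  refine (Finset.abs_sum_le_sum_abs _ _).trans ((Finset.sum_le_sum fun y _ => h y).trans ?_)
  rw [Finset.sum_ite_eq']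

/-- The true answers of neighbouring databases to the queries of `P` differ in total by at most
the `L₁` norm of `P`. -/
theorem Neighbor.sum_abs_trueCount_sub_le [Fintype X] {D D' : Multiset X} (h : Neighbor D D')
    (P : Finset (Query X)) :
    ∑ a ∈ P, |trueCount D a - trueCount D' a| ≤ rawNorm P := by
  obtain ⟨x, hx⟩ := h.exists_forall_count
  refine (Finset.sum_le_sum fun a _ => abs_trueCount_sub_le hx a).trans ?_
  rw [Finset.sum_boole]
  exact_mod_cast hits_le_rawNorm P x

/-- The part of the privacy loss budgeted for the current response to `a` that this response has
not used: the worst-case loss at its scale minus the actual log-likelihood ratio. -/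
noncomputable def slack (D D' : Multiset X) (c : Cache X) (a : Query X) : ℝ :=
  if 0 < cacheTime c a then
    (|trueCount D a - trueCount D' a| - (|cacheResponse c a - trueCount D' a| -
      |cacheResponse c a - trueCount D a|)) / cacheScale c a
  else 0

variable [Fintype X]

/-- Bound on the log-likelihood ratio of a state between `D` and `D'`: the consumed budget,
reduced by the slack of the current cache entries. Overwritten responses count with their
worst-case loss. -/
noncomputable def lossBound (D D' : Multiset X) (s : State X) : ℝ :=
  s.consumed - ∑ a, slack D D' s.cache a

/-- The bound on the likelihood ratio of a state. -/
noncomputable def ratioBound (D D' : Multiset X) (s : State X) : ENNReal :=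
  ENNReal.ofReal (Real.exp (lossBound D D' s))

theorem measurable_ratioBound (D D' : Multiset X) : Measurable (ratioBound D D') := by
  have hc := measurable_state_cache X
  have hslack : ∀ a, Measurable fun s : State X => slack D D' s.cache a := fun a => by
    have h1 := measurable_cacheResponse hc a
    have h2 := measurable_cacheScale hc a
    have h3 := measurable_cacheTime hc a
    unfold slack
    exact Measurable.ite (measurableSet_lt measurable_const h3) (by fun_prop) measurable_const
  exact ((((measurable_state_consumed X).sub
    (Finset.measurable_fun_sum _ fun a _ => hslack a))).exp).ennreal_ofReal

theorem IsValid.slack_nonneg {T : StrategyTree X} {εtotal : ℝ} {s : State X}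
    (h : IsValid T εtotal s) (D D' : Multiset X) (a : Query X) : 0 ≤ slack D D' s.cache a := by
  unfold slack
  split_ifs with ha
  · refine div_nonneg ?_ (h.scale_pos a (mem_cached.2 ha)).le
    have := abs_sub_abs_le_abs_sub (cacheResponse s.cache a - trueCount D' a)
      (cacheResponse s.cache a - trueCount D a)
    rw [sub_sub_sub_cancel_left] at this
    linarith
  · exact le_rfl

theorem IsValid.ratioBound_le {T : StrategyTree X} {εtotal : ℝ} {s : State X}
    (h : IsValid T εtotal s) (D D' : Multiset X) :
    ratioBound D D' s ≤ ENNReal.ofReal (Real.exp εtotal) := by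
  refine ENNReal.ofReal_le_ofReal (Real.exp_le_exp.2 ?_)
  have h1 := h.consumed_le
  have h2 := Finset.sum_nonneg fun a (_ : a ∈ Finset.univ) => h.slack_nonneg D D' a
  unfold lossBound
  linarith

theorem ratioBound_initialState (D D' : Multiset X) :
    ratioBound D D' (initialState : State X) = 1 := by
  simp [ratioBound, lossBound, slack, initialState, emptyCache, cacheTime]

theorem ratioBound_reject (D D' : Multiset X) (s : State X) (r : Response X) :
    ratioBound D D' (s.advance s.cache 0 r) = ratioBound D D' s := by
  simp [ratioBound, lossBound, State.advance]

/-- Replacing the responses of `P` exchanges their slack. -/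
theorem lossBound_advance_updateCache (D D' : Multiset X) (s : State X) (P : Finset (Query X))
    (b : ℝ) (y : Query X → ℝ) (ε : ℝ) (r : Response X) :
    lossBound D D' (s.advance (updateCache s.cache P b y (s.round + 1)) ε r) =
      lossBound D D' s + ε + ∑ a ∈ P, slack D D' s.cache a -
        (∑ a ∈ P, |trueCount D a - trueCount D' a|) / b +
        ∑ a ∈ P, (|y a - trueCount D' a| - |y a - trueCount D a|) / b := by
  classical
  have hsplit : ∑ a, slack D D' (updateCache s.cache P b y (s.round + 1)) a =
      ∑ a ∈ P, (|trueCount D a - trueCount D' a| / b -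
          (|y a - trueCount D' a| - |y a - trueCount D a|) / b) +
        ∑ a ∈ Pᶜ, slack D D' s.cache a := by
    rw [← Finset.sum_add_sum_compl P]
    congr 1
    · refine Finset.sum_congr rfl fun a ha => ?_
      simp [slack, updateCache, cacheTime, cacheResponse, cacheScale, ha, sub_div]
    · refine Finset.sum_congr rfl fun a ha => ?_
      have ha' : a ∉ P := Finset.mem_compl.1 ha
      have hold : updateCache s.cache P b y (s.round + 1) a = s.cache a := by
        simp [updateCache, ha']
      have h1 : cacheScale (updateCache s.cache P b y (s.round + 1)) a =
          cacheScale s.cache a := congrArg (fun e => e.1) hold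
      have h2 : cacheResponse (updateCache s.cache P b y (s.round + 1)) a =
          cacheResponse s.cache a := congrArg (fun e => e.2.1) hold
      have h3 : cacheTime (updateCache s.cache P b y (s.round + 1)) a =
          cacheTime s.cache a := congrArg (fun e => e.2.2) hold
      simp only [slack, h1, h2, h3]
  simp only [lossBound, State.advance]
  rw [hsplit, ← Finset.sum_add_sum_compl P (slack D D' s.cache), Finset.sum_sub_distrib,
    Finset.sum_div]
  ring

/-- The log-likelihood ratio of the current response that a plan gives back before it charges for
the new one: that of the refined response for RP, nothing for MMM. -/
noncomputable def Plan.credit (D D' : Multiset X) (c : Cache X) (a : Query X) : Plan X → ℝ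
  | .mmm _ _ => 0
  | .rp _ j _ => (|cacheResponse c a - trueCount D' a| - |cacheResponse c a - trueCount D a|) /
      groupScale c j

theorem Plan.withDensity_responseLaw (D D' : Multiset X) (c : Cache X) (a : Query X)
    (plan : Plan X) :
    (plan.responseLaw D' c a).withDensity (fun y =>
        ENNReal.ofReal (lapRatio (trueCount D a) (trueCount D' a) plan.scale y)) =
      ENNReal.ofReal (Real.exp (plan.credit D D' c a)) • plan.responseLaw D c a := by
  cases plan with
  | mmm A b =>
    simpa [responseLaw, scale, credit] using withDensity_lapRatio_laplace _ _ b
  | rp A j b => exact withDensity_lapRatio_lapNoiseDown _ _ _ b _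

/-- The likelihood ratio of the new responses, given the current ones, is the product of their Laplace
ratios divided by the exponential of the total credit. -/
theorem Plan.withDensity_responsesLaw {k : ℕ} {T : StrategyTree X} (hT : T.IsHierarchical k)
    (cfg : Config) (D D' : Multiset X) {c : Cache X} {plan : Plan X} (h : plan.IsSound T c) :
    (plan.responsesLaw T cfg D' c).withDensity (fun y => ENNReal.ofReal (Real.exp
        (∑ a ∈ plan.refreshed T cfg c,
          (|y a - trueCount D' a| - |y a - trueCount D a|) / plan.scale))) =
      ENNReal.ofReal (Real.exp (∑ a ∈ plan.refreshed T cfg c, plan.credit D D' c a)) •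
        plan.responsesLaw T cfg D c := by
  classical
  set P := plan.refreshed T cfg c with hP
  have hprob := fun a => h.isProbabilityMeasure_ite hT cfg D a
  have hprob' := fun a => h.isProbabilityMeasure_ite hT cfg D' a
  rw [← hP] at hprob hprob'
  let f : Query X → ℝ → ENNReal := fun a y => if a ∈ P then
    ENNReal.ofReal (lapRatio (trueCount D a) (trueCount D' a) plan.scale y) else 1
  let w : Query X → ENNReal := fun a => if a ∈ P then
    ENNReal.ofReal (Real.exp (plan.credit D D' c a)) else 1
  have hw : ∀ a, w a ≠ ⊤ := fun a => by
    simp only [w]; split_ifs <;> simp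
  have hf : ∀ a, Measurable (f a) := fun a => by
    simp only [f]
    split_ifs
    · exact (measurable_lapRatio _ _ _).ennreal_ofReal
    · exact measurable_const
  have hcoord : ∀ a, (if a ∈ P then plan.responseLaw D' c a else Measure.dirac 0 :
      Measure ℝ).withDensity (f a) =
      w a • (if a ∈ P then plan.responseLaw D c a else Measure.dirac 0 : Measure ℝ) := by
    intro a
    by_cases ha : a ∈ P
    · simp only [f, w, ha, if_true]
      exact plan.withDensity_responseLaw D D' c a
    · simp only [f, w, ha, if_false, one_smul]
      exact withDensity_one
  have hfin : ∀ a, SigmaFinite ((if a ∈ P then plan.responseLaw D' c a else Measure.dirac 0 :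
      Measure ℝ).withDensity (f a)) := fun a => by
    rw [hcoord a]
    have := Measure.smul_finite
      (if a ∈ P then plan.responseLaw D c a else Measure.dirac 0 : Measure ℝ) (hw a)
    infer_instance
  have hpi := pi_withDensity
    (fun a => (if a ∈ P then plan.responseLaw D' c a else Measure.dirac 0 : Measure ℝ)) hf
  simp only [hcoord] at hpi
  rw [pi_smul _ _ hw] at hpi
  have hfprod : (fun y : Query X → ℝ => ∏ a, f a (y a)) = fun y => ENNReal.ofReal (Real.exp
      (∑ a ∈ P, (|y a - trueCount D' a| - |y a - trueCount D a|) / plan.scale)) := by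
    funext y
    rw [Real.exp_sum, ENNReal.ofReal_prod_of_nonneg fun _ _ => (Real.exp_pos _).le,
      Finset.prod_ite_mem, Finset.univ_inter]
    rfl
  have hwprod : ∏ a, w a =
      ENNReal.ofReal (Real.exp (∑ a ∈ P, plan.credit D D' c a)) := by
    rw [Real.exp_sum, ENNReal.ofReal_prod_of_nonneg fun _ _ => (Real.exp_pos _).le,
      Finset.prod_ite_mem, Finset.univ_inter]
  rw [hfprod, hwprod] at hpi
  exact hpi.symm

/-- The cost of a plan pays for the worst-case loss of the new responses, after crediting the
current ones. For MMM this is the sensitivity of the perturbed strategy. For RP, the credit leaves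
of each refined response only the increase of the inverse noise parameter. -/
theorem Plan.IsSound.sum_loss_le_cost {k : ℕ} {T : StrategyTree X} (hT : T.IsHierarchical k)
    {εtotal : ℝ} {s : State X} (hs : IsValid T εtotal s) (cfg : Config) {D D' : Multiset X}
    (hD : Neighbor D D') {plan : Plan X} (h : plan.IsSound T s.cache) :
    (∑ a ∈ plan.refreshed T cfg s.cache, |trueCount D a - trueCount D' a|) / plan.scale ≤
      plan.cost s.cache + ∑ a ∈ plan.refreshed T cfg s.cache, slack D D' s.cache a +
        ∑ a ∈ plan.refreshed T cfg s.cache, plan.credit D D' s.cache a := by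
  cases plan with
  | mmm A b =>
    have hslack := Finset.sum_nonneg fun a (_ : a ∈ perturbedStrategy T cfg s.cache A b) =>
      hs.slack_nonneg D D' a
    have hmain : (∑ a ∈ perturbedStrategy T cfg s.cache A b,
        |trueCount D a - trueCount D' a|) / b ≤ mmmCost s.cache A b := by
      rcases A.eq_empty_or_nonempty with rfl | hA
      · have h0 : mappedNorm (∅ : Finset (Query X)) (buckets ∅) = 0 :=
          Nat.le_zero.1 (Finset.sup_le fun _ _ => by simp)
        simp [perturbedStrategy_eq_empty hT, mmmCost, paidStrategy, h0]
      · have hb : 0 < b := h.2 hA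
        refine div_le_div_of_nonneg_right ((hD.sum_abs_trueCount_sub_le _).trans ?_) hb.le
        exact_mod_cast (rawNorm_perturbedStrategy_le hT cfg s.cache h.1 b).trans
          (rawNorm_le_mappedNorm (paidStrategy_subset s.cache A b))
    simp only [refreshed, scale, cost, credit, Finset.sum_const_zero]
    linarith
  | rp A j b =>
    obtain ⟨hb, hb₀⟩ := h
    have h₀ : 0 < groupScale s.cache j := hb.trans_le hb₀
    have hback : ∑ a ∈ timeGroup s.cache j, slack D D' s.cache a +
        ∑ a ∈ timeGroup s.cache j, (Plan.rp A j b).credit D D' s.cache a =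
        (∑ a ∈ timeGroup s.cache j, |trueCount D a - trueCount D' a|) /
          groupScale s.cache j := by
      rw [← Finset.sum_add_distrib, Finset.sum_div]
      refine Finset.sum_congr rfl fun a ha => ?_
      rw [slack, if_pos (mem_cached.1 (mem_timeGroup.1 ha).1), credit, ← hs.groupScale_eq ha,
        ← add_div, sub_add_cancel]
    have hinv : 0 ≤ 1 / b - 1 / groupScale s.cache j :=
      sub_nonneg.2 (one_div_le_one_div_of_le hb hb₀)
    have hmul := mul_le_mul_of_nonneg_right
      (hD.sum_abs_trueCount_sub_le (timeGroup s.cache j)) hinv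
    simp only [refreshed, scale, cost, rpCost]
    rw [add_assoc, hback]
    simp only [mul_sub, mul_one_div] at hmul
    linarith

/-- The local privacy guarantee of a plan. -/
theorem Plan.IsSound.dominates_responsesLaw {k : ℕ} {T : StrategyTree X}
    (hT : T.IsHierarchical k) {εtotal : ℝ} {s : State X} (hs : IsValid T εtotal s)
    (cfg : Config) {D D' : Multiset X} (hD : Neighbor D D') {plan : Plan X}
    (h : plan.IsSound T s.cache) (r : (Query X → ℝ) → Response X) :
    Dominates (fun y => ratioBound D D' (s.advance (updateCache s.cache
        (plan.refreshed T cfg s.cache) plan.scale y (s.round + 1)) (plan.cost s.cache) (r y)))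
      (ratioBound D D' s) (plan.responsesLaw T cfg D s.cache)
      (plan.responsesLaw T cfg D' s.cache) := by
  set P := plan.refreshed T cfg s.cache with hP
  have hcost := h.sum_loss_le_cost hT hs cfg hD
  rw [← hP] at hcost
  have hden := Plan.withDensity_responsesLaw hT cfg D D' h
  rw [← hP] at hden
  set L := ∑ a ∈ P, plan.credit D D' s.cache a with hL
  have hmeas : Measurable fun y : Query X → ℝ => ENNReal.ofReal (Real.exp
      (∑ a ∈ P, (|y a - trueCount D' a| - |y a - trueCount D a|) / plan.scale)) := by
    fun_prop
  have hC : ratioBound D D' s = ENNReal.ofReal (Real.exp (lossBound D D' s - L)) *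
      ENNReal.ofReal (Real.exp L) := by
    rw [← ENNReal.ofReal_mul (Real.exp_pos _).le, ← Real.exp_add, sub_add_cancel, ratioBound]
  rw [Dominates, hC, ← smul_smul, ← hden, ← withDensity_smul _ hmeas]
  refine withDensity_mono (ae_of_all _ fun y => ?_)
  simp only [Pi.smul_apply, smul_eq_mul, ratioBound, lossBound_advance_updateCache]
  rw [← ENNReal.ofReal_mul (Real.exp_pos _).le, ← Real.exp_add]
  refine ENNReal.ofReal_le_ofReal (Real.exp_le_exp.2 ?_)
  linarith

end PrivacyLoss

/-! ### The interactive system -/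

section Interaction

theorem cached_emptyCache {X : Type u} [Fintype X] : cached (emptyCache : Cache X) = ∅ := by
  simp [cached, cacheTime, emptyCache]

variable {X : Type u} [DecidableEq X]

theorem measurable_store (c : Cache X) (P : Finset (Query X)) (b : ℝ) (now : ℕ) :
    Measurable fun y : Query X → ℝ => updateCache c P b y now :=
  measurable_updateCache measurable_const measurable_const measurable_id measurable_const P

variable [Fintype X]

theorem measurable_answered (s : State X) (W A : Finset (Query X)) (ε : ℝ) :
    Measurable fun c => s.advance c ε (Status.answered, workloadAnswer c W A, ε) :=
  measurable_advance measurable_const measurable_id measurable_const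
    (measurable_const.prodMk ((measurable_workloadAnswer measurable_id W A).prodMk
      measurable_const))

theorem isLawOn_finishRound {k : ℕ} {T : StrategyTree X} (hT : T.IsHierarchical k)
    (cfg : Config) {εtotal : ℝ} (D : Multiset X) {s : State X} (hs : IsValid T εtotal s)
    (W : Finset (Query X)) {plan : Plan X} (h : plan.IsSound T s.cache) :
    IsLawOn (finishRound T cfg εtotal D s W plan) (IsValid T εtotal) := by
  have hvalid := measurableSet_isValid T εtotal
  simp only [finishRound]
  split_ifs with hε
  · exact .dirac hvalid (hs.reject _)
  · rw [h.runPlan_eq hT cfg D, Measure.map_map (measurable_answered ..) (measurable_store ..)]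
    refine IsLawOn.map (p := fun _ => True)
      (.of_forall (h.isProbabilityMeasure_responsesLaw hT cfg D) fun _ => trivial)
      ((measurable_answered ..).comp (measurable_store ..)) hvalid fun y _ => ?_
    exact hs.advance_updateCache (h.refreshed_subset hs cfg) (h.usable_scale hT cfg) y
      (by rw [add_comm]; exact (not_le.1 hε).le) _

theorem dominates_finishRound {k : ℕ} {T : StrategyTree X} (hT : T.IsHierarchical k)
    (cfg : Config) {εtotal : ℝ} {D D' : Multiset X} (hD : Neighbor D D') {s : State X}
    (hs : IsValid T εtotal s) (W : Finset (Query X)) {plan : Plan X}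
    (h : plan.IsSound T s.cache) :
    Dominates (ratioBound D D') (ratioBound D D' s) (finishRound T cfg εtotal D s W plan)
      (finishRound T cfg εtotal D' s W plan) := by
  have hR := measurable_ratioBound D D'
  simp only [finishRound]
  split_ifs with hε
  · rw [← ratioBound_reject D D' s (Status.rejected, 0, 0)]
    exact dominates_dirac hR _
  · rw [h.runPlan_eq hT cfg D, h.runPlan_eq hT cfg D',
      Measure.map_map (measurable_answered ..) (measurable_store ..),
      Measure.map_map (measurable_answered ..) (measurable_store ..)]
    exact Dominates.map ((measurable_answered ..).comp (measurable_store ..)) hR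
      (h.dominates_responsesLaw hT hs cfg hD _)

/-- The noise parameters found in a round are usable. -/
theorem IsValid.isLawOn_estimateNoise {k : ℕ} {T : StrategyTree X} (hT : T.IsHierarchical k)
    (cfg : Config) {εtotal : ℝ} {s : State X} (hs : IsValid T εtotal s) (W : Finset (Query X))
    {A : Finset (Query X)} (hA : A ⊆ T.nodes) {α β : ℝ} (hα : 0 < α) (hβ : 0 < β) :
    IsLawOn (estimateNoise cfg s.cache W A α β) (Usable A) ∧
      IsLawOn (estimateNoise cfg emptyCache W A α β) (Usable A) := by
  have hne : ∀ a ∈ A, a.Nonempty := fun a ha => hT.nonempty_of_mem_nodes (hA ha)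
  exact ⟨CacheDP.isLawOn_estimateNoise cfg hs.scale_pos W hne hα hβ,
    CacheDP.isLawOn_estimateNoise cfg (by simp [cached_emptyCache]) W hne hα hβ⟩

theorem IsValid.expandStrategy_subset_nodes {T : StrategyTree X} (cfg : Config) {εtotal : ℝ}
    {s : State X} (hs : IsValid T εtotal s) {A : Finset (Query X)} (hA : A ⊆ T.nodes) (b : ℝ) :
    expandStrategy cfg s.cache A b ⊆ T.nodes :=
  (expandStrategy_subset cfg s.cache A b).trans (Finset.union_subset hA hs.mem_nodes)

section Measurability

variable (T : StrategyTree X) (cfg : Config) (εtotal : ℝ) (D : Multiset X) (s : State X)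
  (W A : Finset (Query X))

theorem measurable_finish_stage (b₁ b₂ : ℝ) :
    Measurable fun b₃ => finishRound T cfg εtotal D s W
      (choosePlan cfg s.cache (s.round + 1) A (expandStrategy cfg s.cache A b₁) b₁ b₂ b₃) :=
  (isSubMarkov_finish_stage (Ω := ℝ) T cfg εtotal D (s := fun _ => s) measurable_const
    measurable_const measurable_const measurable_id W A).measurable

theorem measurable_expanded_stage (α β b₁ : ℝ) :
    Measurable fun b₂ => (estimateNoise cfg s.cache W
        (expandStrategy cfg s.cache A b₁) α β).bind fun b₃ => finishRound T cfg εtotal D s W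
      (choosePlan cfg s.cache (s.round + 1) A (expandStrategy cfg s.cache A b₁) b₁ b₂ b₃) :=
  (isSubMarkov_expanded_stage (Ω := ℝ) T cfg εtotal D (s := fun _ => s) measurable_const
    measurable_const measurable_const measurable_const measurable_id W A).measurable

theorem measurable_target_stage (α β : ℝ) :
    Measurable fun b₁ => (estimateNoise cfg emptyCache W A α β).bind fun b₂ =>
      (estimateNoise cfg s.cache W (expandStrategy cfg s.cache A b₁) α β).bind fun b₃ =>
        finishRound T cfg εtotal D s W (choosePlan cfg s.cache (s.round + 1) A
          (expandStrategy cfg s.cache A b₁) b₁ b₂ b₃) := by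
  refine (IsSubMarkov.bind (isSubMarkov_estimateNoise cfg W A measurable_const measurable_const
    measurable_const) ?_).measurable
  exact isSubMarkov_expanded_stage (Ω := ℝ × ℝ) T cfg εtotal D (s := fun _ => s)
    measurable_const measurable_const measurable_const measurable_fst measurable_snd W A

end Measurability

theorem isLawOn_answerRound {k : ℕ} {T : StrategyTree X} (hT : T.IsHierarchical k)
    (cfg : Config) {εtotal : ℝ} (D : Multiset X) {s : State X} (hs : IsValid T εtotal s)
    (W : Finset (Query X)) {α β : ℝ} (hα : 0 < α) (hβ : 0 < β) :
    IsLawOn (answerRound T cfg εtotal D W α β s) (IsValid T εtotal) := by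
  have hvalid := measurableSet_isValid T εtotal
  have hA := T.instantStrategy_subset_nodes W
  obtain ⟨hb₁, hb₂⟩ := hs.isLawOn_estimateNoise hT cfg W hA hα hβ
  refine hb₁.bind (measurable_target_stage ..) hvalid fun b₁ h₁ => ?_
  refine hb₂.bind (measurable_expanded_stage ..) hvalid fun b₂ _ => ?_
  have hAe := hs.expandStrategy_subset_nodes cfg hA b₁
  refine (hs.isLawOn_estimateNoise hT cfg W hAe hα hβ).1.bind (measurable_finish_stage ..)
    hvalid fun b₃ h₃ => ?_
  exact isLawOn_finishRound hT cfg D hs W (isSound_choosePlan cfg _ _ hA hAe h₁ h₃)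

theorem dominates_answerRound {k : ℕ} {T : StrategyTree X} (hT : T.IsHierarchical k)
    (cfg : Config) {εtotal : ℝ} {D D' : Multiset X} (hD : Neighbor D D') {s : State X}
    (hs : IsValid T εtotal s) (W : Finset (Query X)) {α β : ℝ} (hα : 0 < α) (hβ : 0 < β) :
    Dominates (ratioBound D D') (ratioBound D D' s) (answerRound T cfg εtotal D W α β s)
      (answerRound T cfg εtotal D' W α β s) := by
  have hR := measurable_ratioBound D D'
  have hA := T.instantStrategy_subset_nodes W
  refine Dominates.bind (measurable_target_stage ..) (measurable_target_stage ..) hR ?_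
  filter_upwards [(hs.isLawOn_estimateNoise hT cfg W hA hα hβ).1.ae] with b₁ h₁
  refine Dominates.bind (measurable_expanded_stage ..) (measurable_expanded_stage ..) hR
    (ae_of_all _ fun b₂ => ?_)
  have hAe := hs.expandStrategy_subset_nodes cfg hA b₁
  refine Dominates.bind (measurable_finish_stage ..) (measurable_finish_stage ..) hR ?_
  filter_upwards [(hs.isLawOn_estimateNoise hT cfg W hAe hα hβ).1.ae] with b₃ h₃
  exact dominates_finishRound hT cfg hD hs W (isSound_choosePlan cfg _ _ hA hAe h₁ h₃)

theorem isLawOn_step {k : ℕ} {T : StrategyTree X} (hT : T.IsHierarchical k) (cfg : Config)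
    {εtotal : ℝ} (an : Analyst X) (D : Multiset X) {s : State X} (hs : IsValid T εtotal s) :
    IsLawOn (step T cfg εtotal an D s) (IsValid T εtotal) := by
  rw [step_eq]
  cases an.workload s.transcript with
  | none => exact .dirac (measurableSet_isValid T εtotal) hs
  | some W => exact isLawOn_answerRound hT cfg D hs W (an.α_pos _) (an.β_pos _)

theorem dominates_step {k : ℕ} {T : StrategyTree X} (hT : T.IsHierarchical k) (cfg : Config)
    {εtotal : ℝ} (an : Analyst X) {D D' : Multiset X} (hD : Neighbor D D') {s : State X}
    (hs : IsValid T εtotal s) :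
    Dominates (ratioBound D D') (ratioBound D D' s) (step T cfg εtotal an D s)
      (step T cfg εtotal an D' s) := by
  rw [step_eq, step_eq]
  cases an.workload s.transcript with
  | none => exact dominates_dirac (measurable_ratioBound D D') s
  | some W => exact dominates_answerRound hT cfg hD hs W (an.α_pos _) (an.β_pos _)

theorem isLawOn_stateLaw {k : ℕ} {T : StrategyTree X} (hT : T.IsHierarchical k) (cfg : Config)
    {εtotal : ℝ} (hε : 0 ≤ εtotal) (an : Analyst X) (D : Multiset X) (n : ℕ) :
    IsLawOn (stateLaw T cfg εtotal an D n) (IsValid T εtotal) := by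
  induction n with
  | zero => exact .dirac (measurableSet_isValid T εtotal) (isValid_initialState T hε)
  | succ n ih =>
    exact ih.bind (isSubMarkov_step T cfg εtotal an D).measurable
      (measurableSet_isValid T εtotal) fun s hs => isLawOn_step hT cfg an D hs

/-- After any number of rounds, the state laws of neighbouring databases have likelihood ratio at
most `ratioBound`. -/
theorem stateLaw_le_withDensity {k : ℕ} {T : StrategyTree X} (hT : T.IsHierarchical k)
    (cfg : Config) {εtotal : ℝ} (hε : 0 ≤ εtotal) (an : Analyst X) {D D' : Multiset X}
    (hD : Neighbor D D') (n : ℕ) :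
    stateLaw T cfg εtotal an D n ≤
      (stateLaw T cfg εtotal an D' n).withDensity (ratioBound D D') := by
  have hR := measurable_ratioBound D D'
  induction n with
  | zero => simp [stateLaw, dirac_withDensity' hR, ratioBound_initialState]
  | succ n ih =>
    refine bind_le_withDensity (isSubMarkov_step T cfg εtotal an D).measurable
      (isSubMarkov_step T cfg εtotal an D').measurable hR ih ?_
    filter_upwards [(isLawOn_stateLaw hT cfg hε an D' n).ae] with s hs
    exact dominates_step hT cfg an hD hs

end Interaction

end CacheDP

theorem mainTheorem1 {X : Type*} [Fintype X] [DecidableEq X]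
    (k : ℕ) (T : CacheDP.StrategyTree X) (hT : T.IsHierarchical k) (hroot : T.query = Finset.univ)
    (cfg : CacheDP.Config) (εtotal : ℝ) (hε : 0 ≤ εtotal)
    (an : CacheDP.Analyst X) (rounds : ℕ) :
    (∀ D : Multiset X,
      MeasureTheory.IsProbabilityMeasure (CacheDP.system T cfg εtotal an rounds D)) ∧
    CacheDP.IsDP (CacheDP.system T cfg εtotal an rounds) εtotal := by
  have htr := CacheDP.measurable_state_transcript X
  refine ⟨fun D => ?_, fun D D' hD S hS => ?_⟩
  · have := (CacheDP.isLawOn_stateLaw hT cfg hε an D rounds).isProbabilityMeasure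
    exact Measure.isProbabilityMeasure_map htr.aemeasurable
  · have hlaw := CacheDP.isLawOn_stateLaw hT cfg hε an D' rounds
    have hle := CacheDP.stateLaw_le_withDensity hT cfg hε an hD rounds
    have hS' : MeasurableSet (CacheDP.State.transcript ⁻¹' S) := htr hS
    rw [CacheDP.system, CacheDP.system, Measure.map_apply htr hS, Measure.map_apply htr hS]
    calc CacheDP.stateLaw T cfg εtotal an D rounds (CacheDP.State.transcript ⁻¹' S)
        ≤ ∫⁻ s in CacheDP.State.transcript ⁻¹' S, CacheDP.ratioBound D D' s
            ∂(CacheDP.stateLaw T cfg εtotal an D' rounds) := by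
          rw [← withDensity_apply _ hS']
          exact hle _
      _ ≤ ∫⁻ _ in CacheDP.State.transcript ⁻¹' S, ENNReal.ofReal (Real.exp εtotal)
            ∂(CacheDP.stateLaw T cfg εtotal an D' rounds) := by
          refine lintegral_mono_ae (ae_restrict_of_ae ?_)
          filter_upwards [hlaw.ae] with s hs using hs.ratioBound_le D D'
      _ = _ := setLIntegral_const _ _
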